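/- Let $so(n)$ be the space of skew-symmetric real $n\times n$ matrices with the scalar product $\langle X,Y\rangle=-\tfrac12\mathrm{tr}(XY)$, by which $so(n)^*$ is identified with $so(n)$. Write $x\wedge y=xy^T-yx^T$ for $x,y\in\mathbb R^n$, let $E_1,\dots,E_n$ be the standard basis of $\mathbb R^n$, and for $\gamma\in S^{n-1}\subset\mathbb R^n$ let $\mathrm{pr}_{\mathfrak v_\gamma}$, $\mathrm{pr}_{\mathfrak h_\gamma}$ be the orthogonal projections of $so(n)$ onto $\mathfrak v_\gamma=\mathbb R^n\wedge\gamma$ and onto its orthogonal complement $\mathfrak h_\gamma$. Let $\mathbb I: so(n)\to so(n)$ be an inertia operator (symmetric and positive definite) of a ball of mass $m>0$ and radius $\rho>0$ which rolls over a fixed sphere of radius $\sigma>0$. Put $D=m\rho^2$, $\mathbf I=\mathbb I+D\,\mathrm{Id}$ and $\epsilon=\frac{\sigma}{\sigma\pm\rho}$ (for either choice of the sign, with $\sigma\pm\rho\ne0$). The extended system of the rubber rolling (without slipping and twisting) is the system on $so(n)^*\times S^{n-1}$, in the variables $(\mathbf m,\gamma)$, $$\dot\gamma=-\epsilon\,\omega\gamma,\qquad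 \dot{\mathbf m}=\epsilon[\mathbf m,\omega]+(1-\epsilon)\,\mathrm{pr}_{\mathfrak v_\gamma}[\mathbf I\omega,\omega],$$ where the angular velocity $\omega\in so(n)$ is determined by $\mathbf m=\mathrm{pr}_{\mathfrak v_\gamma}(\mathbf I\omega)+\mathrm{pr}_{\mathfrak h_\gamma}\omega$. Let $\mathbf I|_{\mathfrak v_\gamma}:\mathfrak v_\gamma\to\mathfrak v_\gamma$, $\xi\mapsto\mathrm{pr}_{\mathfrak v_\gamma}(\mathbf I\xi)$, be the operator of the restriction to $\mathfrak v_\gamma$ of the quadratic form of $\mathbf I$, and let $\mathrm d\mathbf m$ and $\mathrm d\gamma$ be the standard volumes on $so(n)^*$ and $S^{n-1}$. **Theorem.** (i) For every $\gamma \in S^{n-1}$ one has $\det(\mathbf I|_{\mathfrak v_\gamma})>0$, and the extended system has the invariant measure $$\tilde\mu_\epsilon\,\mathrm d\mathbf m\wedge\mathrm d\gamma,\qquad \tilde\mu_\epsilon(\gamma)=\big(\det\mathbf I|_{\mathfrak v_\gamma}\big)^{\frac1{2\epsilon}-1},$$ that is, the (local) flow of the system preserves this measure: if $B$ is a Borel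 set such that the solutions starting in $B$ at time $0$ exist up to the (positive or negative) time $t$, then $B$ and the set of their values at time $t$ have the same measure. (ii) Let $a_1,\dots,a_n>0$, $A=\mathrm{diag}(a_1,\dots,a_n)$. If $\mathbb I(E_i\wedge E_j)=(a_ia_j-D)\,E_i\wedge E_j$ for all $i,j$, then $\mathbf I(E_i\wedge E_j)=a_ia_j\,E_i\wedge E_j$ for all $i,j$, and the density $\tilde\mu_\epsilon(\gamma)$ is proportional to $(\gamma,A\gamma)^{(\frac1{2\epsilon}-1)(n-2)}$: there is a constant $C>0$ with $\tilde\mu_\epsilon(\gamma)=C\,(\gamma,A\gamma)^{(\frac1{2\epsilon}-1)(n-2)}$ for all $\gamma\in S^{n-1}$. -/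

import Mathlib

open scoped Matrix

namespace RubberRolling

/-- The Lie algebra `so(n)` of skew-symmetric real `n × n` matrices. -/
abbrev SO (n : ℕ) : Type := LieAlgebra.Orthogonal.so (Fin n) ℝ

/-- The unit sphere `S^{n-1}` of Euclidean space `ℝⁿ`. -/
abbrev Sph (n : ℕ) : Type := Metric.sphere (0 : EuclideanSpace ℝ (Fin n)) 1

/-- The Cartesian coordinates of a point of the unit sphere. -/
def vec {n : ℕ} (γ : Sph n) : Fin n → ℝ := fun i => (γ : EuclideanSpace ℝ (Fin n)) i

/-- The scalar product `⟨X, Y⟩ = -½ tr (X Y)` on `so(n)`. -/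
noncomputable def ip {n : ℕ} (X Y : SO n) : ℝ :=
  -(1 / 2) * ((X : Matrix (Fin n) (Fin n) ℝ) * (Y : Matrix (Fin n) (Fin n) ℝ)).trace

/-- The wedge product `x ∧ y = x yᵀ - y xᵀ` of two vectors of `ℝⁿ`. -/
def wedge {n : ℕ} (x y : Fin n → ℝ) : SO n :=
  ⟨Matrix.vecMulVec x y - Matrix.vecMulVec y x, by
    rw [LieAlgebra.Orthogonal.mem_so, Matrix.transpose_sub, neg_sub,
      Matrix.transpose_vecMulVec, Matrix.transpose_vecMulVec]⟩

theorem wedge_apply {n : ℕ} (x y : Fin n → ℝ) (i j : Fin n) :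
    (wedge x y : Matrix (Fin n) (Fin n) ℝ) i j = x i * y j - y i * x j := rfl

/-- The vectors `E_1, …, E_n` of the standard basis of `ℝⁿ`. -/
def E {n : ℕ} (i : Fin n) : Fin n → ℝ := Pi.single i 1

/-- The linear map `x ↦ x ∧ γ`. -/
def wedgeRight {n : ℕ} (γ : Sph n) : (Fin n → ℝ) →ₗ[ℝ] SO n where
  toFun x := wedge x (vec γ)
  map_add' x y := by
    apply Subtype.ext; ext i j
    change (x i + y i) * vec γ j - vec γ i * (x j + y j) =
      (x i * vec γ j - vec γ i * x j) + (y i * vec γ j - vec γ i * y j)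
    ring
  map_smul' r x := by
    apply Subtype.ext; ext i j
    change (r * x i) * vec γ j - vec γ i * (r * x j) = r * (x i * vec γ j - vec γ i * x j)
    ring

/-- The subspace `𝔳_γ = ℝⁿ ∧ γ` of `so(n)`. -/
def v {n : ℕ} (γ : Sph n) : Submodule ℝ (SO n) := LinearMap.range (wedgeRight γ)

/-- The map `ξ ↦ (ξ γ) ∧ γ = ξ γ ⊗ γ + γ ⊗ γ ξ`, which is the orthogonal projection of `so(n)`
onto `𝔳_γ`. -/
def prV {n : ℕ} (γ : Sph n) : SO n →ₗ[ℝ] SO n where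
  toFun ξ := wedge ((ξ : Matrix (Fin n) (Fin n) ℝ) *ᵥ vec γ) (vec γ)
  map_add' ξ η := by
    have h := (wedgeRight γ).map_add ((ξ : Matrix (Fin n) (Fin n) ℝ) *ᵥ vec γ)
      ((η : Matrix (Fin n) (Fin n) ℝ) *ᵥ vec γ)
    rw [← Matrix.add_mulVec] at h
    exact h
  map_smul' r ξ := by
    have h := (wedgeRight γ).map_smul r ((ξ : Matrix (Fin n) (Fin n) ℝ) *ᵥ vec γ)
    rw [← Matrix.smul_mulVec] at h
    exact h

theorem prV_mem {n : ℕ} (γ : Sph n) (ξ : SO n) : prV γ ξ ∈ v γ := ⟨_, rfl⟩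

/-- The projection `ξ ↦ ξ - pr_{𝔳_γ} ξ` onto the orthogonal complement `𝔥_γ` of `𝔳_γ`. -/
def prH {n : ℕ} (γ : Sph n) : SO n →ₗ[ℝ] SO n := LinearMap.id - prV γ

/-- An inertia operator: a linear operator on `so(n)`, symmetric and positive definite with respect
to the scalar product `ip` (so that it defines a left-invariant metric on the group). -/
structure IsInertia {n : ℕ} (J : SO n →ₗ[ℝ] SO n) : Prop where
  symm : ∀ X Y : SO n, ip (J X) Y = ip X (J Y)
  pos : ∀ X : SO n, X ≠ 0 → 0 < ip (J X) X

/-- `D = m ρ²`, where `m` is the mass of the ball and `ρ` its radius. -/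
def coefD (mass ρ : ℝ) : ℝ := mass * ρ ^ 2

/-- The modified inertia operator `𝐈 = 𝕀 + D·id`. -/
def modInertia {n : ℕ} (J : SO n →ₗ[ℝ] SO n) (D : ℝ) : SO n →ₗ[ℝ] SO n := J + D • LinearMap.id

/-- The parameter `ε = σ / (σ ± ρ)`; the sign is passed as `s = 1` or `s = -1`. -/
noncomputable def eps (σ ρ s : ℝ) : ℝ := σ / (σ + s * ρ)

/-- The restriction `I|_{𝔳_γ}` of (the quadratic form of) `I` to `𝔳_γ`, as an operator on `𝔳_γ`:
`ξ ↦ pr_{𝔳_γ} (I ξ)`. -/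
def restrictV {n : ℕ} (I : SO n →ₗ[ℝ] SO n) (γ : Sph n) : v γ →ₗ[ℝ] v γ :=
  ((prV γ).codRestrict (v γ) (prV_mem γ)) ∘ₗ I ∘ₗ (v γ).subtype

/-- The density `(det I|_{𝔳_γ}) ^ (1/(2ε) - 1)`. -/
noncomputable def density {n : ℕ} (I : SO n →ₗ[ℝ] SO n) (ε : ℝ) (γ : Sph n) : ℝ :=
  (LinearMap.det (restrictV I γ)) ^ (1 / (2 * ε) - 1)

/-- The momentum `𝐦 = pr_{𝔳_γ} (I ω) + pr_{𝔥_γ} ω`. -/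
def momentum {n : ℕ} (I : SO n →ₗ[ℝ] SO n) (γ : Sph n) (ω : SO n) : SO n :=
  prV γ (I ω) + prH γ ω

/-- The phase space `so(n)* × S^{n-1}` of the variables `(𝐦, γ)`. -/
abbrev Phase (n : ℕ) : Type := SO n × Sph n

/-- The curve `c = (𝐦, γ)` is, on the set `T` of times, a solution of the extended system
`γ' = -ε ω γ`, `𝐦' = ε [𝐦, ω] + (1 - ε) pr_{𝔳_γ} [I ω, ω]`, where the angular velocity `ω` is
determined by `𝐦 = pr_{𝔳_γ} (I ω) + pr_{𝔥_γ} ω`. The derivatives are taken entry by entry. -/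
def IsSolution {n : ℕ} (I : SO n →ₗ[ℝ] SO n) (ε : ℝ) (T : Set ℝ) (c : ℝ → Phase n) : Prop :=
  ∃ ω : ℝ → SO n, ∀ t ∈ T,
    (c t).1 = momentum I (c t).2 (ω t) ∧
    (∀ i, HasDerivWithinAt (fun τ => vec (c τ).2 i)
      (-ε * ((ω t : Matrix (Fin n) (Fin n) ℝ) *ᵥ vec (c t).2) i) T t) ∧
    (∀ i j, HasDerivWithinAt (fun τ => ((c τ).1 : Matrix (Fin n) (Fin n) ℝ) i j)
      (((ε • ⁅(c t).1, ω t⁆ + (1 - ε) • prV (c t).2 ⁅I (ω t), ω t⁆ : SO n) :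
        Matrix (Fin n) (Fin n) ℝ) i j) T t)

/-- Borel sets of `so(n)`. -/
instance instMeasurableSpaceSO (n : ℕ) : MeasurableSpace (SO n) := borel (SO n)

instance instBorelSpaceSO (n : ℕ) : BorelSpace (SO n) := ⟨rfl⟩

/-- The skew-symmetric matrix `∑_{i<j} x_{ij} E_i ∧ E_j` with given entries above the diagonal. -/
def ofCoords (n : ℕ) (x : {p : Fin n × Fin n // p.1 < p.2} → ℝ) : SO n :=
  ∑ p, x p • wedge (E p.1.1) (E p.1.2)

/-- The standard volume `d𝐦 = ∏_{i<j} d𝐦_{ij}` on `so(n)`; the `E_i ∧ E_j` with `i < j` form an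
orthonormal basis for the scalar product `ip`. -/
noncomputable def volSO (n : ℕ) : MeasureTheory.Measure (SO n) :=
  MeasureTheory.Measure.map (ofCoords n) MeasureTheory.volume

/-- The measure `(det I|_{𝔳_γ}) ^ (1/(2ε) - 1) d𝐦 ∧ dγ` on `so(n)* × S^{n-1}`, where `dγ` is the
standard surface measure of the sphere. -/
noncomputable def phaseMeasure {n : ℕ} (I : SO n →ₗ[ℝ] SO n) (ε : ℝ) :
    MeasureTheory.Measure (Phase n) :=
  ((volSO n).prod
    (MeasureTheory.volume : MeasureTheory.Measure (EuclideanSpace ℝ (Fin n))).toSphere).withDensity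
    (fun p => ENNReal.ofReal (density I ε p.2))

/-- `μ` is an invariant measure of the extended system: its (possibly only local) flow preserves
`μ`. If `B` is a Borel set such that the solution starting at each `x ∈ B` at time `0` exists up to
time `t` (positive or negative), where it is at the point `Φ x`, then `Φ '' B` and `B` have the
same measure. -/
def IsInvariantMeasure {n : ℕ} (I : SO n →ₗ[ℝ] SO n) (ε : ℝ)
    (μ : MeasureTheory.Measure (Phase n)) : Prop :=
  ∀ (t : ℝ) (Φ : Phase n → Phase n) (B : Set (Phase n)), MeasurableSet B →
    (∀ x ∈ B, ∃ c : ℝ → Phase n,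
      IsSolution I ε (Set.uIcc 0 t) c ∧ c 0 = x ∧ c t = Φ x) →
    μ (Φ '' B) = μ B

end RubberRolling

open RubberRolling

/-! The proof passes from the momentum to the angular velocity. Writing `𝐦 = ω + ((I - id)ω γ) ∧ γ`
and differentiating along a solution, the terms containing `ε` cancel (`momentum_equation`), and
what remains says that `ω'` is the element of `𝔳_γ` with `pr_𝔳 (I ω') = pr_𝔳 [I ω, ω]`. In the
variables `(ω, γ)` the parameter `ε` therefore enters only through `γ' = -ε ω γ`. For fixed `γ` the
Jacobian of `ω ↦ 𝐦` is `det I|_𝔳`, so the density to be verified becomes `(det I|_𝔳)^(1/(2ε))`.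

To work in a vector space, `γ` is replaced by a nonzero vector `x`. The symmetric matrix `gram I x`
of `y ↦ (I (y ∧ x)) x + (x, y) x` is positive definite, is quadratic in `x`, and for a unit vector
has determinant `det I|_𝔳` (`det_gram_vec`). The equation for `ω` depends only on the direction of
`x`, and the motion of `x` is a rotation, so the extended system lives on `x ≠ 0` and preserves
`|x|`.

The divergence vanishes by `trace_inv_mul_fieldMap`. With `S` the inverse of the Gram matrix, the
`x`-block of the derivative of the field is skew and has trace zero, while the `ω`-block has trace
`½ tr (S G')`, where `G'` is the derivative of the Gram matrix in the direction `ω x`. By Jacobi's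
formula the logarithm of `(det gram)^(1/(2ε))` changes along `x' = -ε ω x` at the rate `-½ tr (S
G')`.

Liouville's theorem is proved directly for time-`t` maps given pointwise by integral curves, with no
flow constructed. A short-time map is an Euler step plus an error with Lipschitz constant `O(h²)`,
so it changes the weighted volume by a factor at most `1 + o(h)`; iteration yields an inequality,
and reversing time yields equality.

Finally a Borel set `B` of the phase space is replaced by the cone over it with radii in `[1/2, 1)`.
In polar coordinates the weighted volume of the cone is the phase measure of `B` times a finite
nonzero radial constant (`lintegral_cone`), which cancels. For the diagonal operator the Gram matrix
is a diagonal matrix times a rank-two perturbation of a multiple of the identity, so its determinant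
is explicit. -/

namespace Liouville

open MeasureTheory Set Filter Topology
open scoped NNReal ENNReal

/-! ### First-order expansion of the determinant at the identity -/

section Determinant

theorem hasDerivAt_det_one_add_smul {ι : Type*} [Fintype ι] [DecidableEq ι] (M : Matrix ι ι ℝ) :
    HasDerivAt (fun r : ℝ => (1 + r • M).det) M.trace 0 := by
  set p := (1 + (Polynomial.X : Polynomial ℝ) • M.map Polynomial.C).det.divX.divX with hp
  have h : (fun r : ℝ => (1 + r • M).det) = fun r => 1 + M.trace * r + p.eval r * r ^ 2 := by
    funext r
    exact Matrix.det_one_add_smul r M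
  rw [h]
  have := (((hasDerivAt_id (0 : ℝ)).const_mul M.trace).const_add 1).add
    ((p.hasDerivAt 0).mul ((hasDerivAt_id (0 : ℝ)).pow 2))
  exact this.congr_deriv (by simp)

variable {E : Type*} [NormedAddCommGroup E] [NormedSpace ℝ E] [FiniteDimensional ℝ E]

theorem contDiff_det : ContDiff ℝ 1 (fun A : E →L[ℝ] E => A.det) := by
  classical
  let b := Module.finBasis ℝ E
  have h : (fun A : E →L[ℝ] E => A.det) = fun A : E →L[ℝ] E =>
      ∑ σ : Equiv.Perm (Fin (Module.finrank ℝ E)), (Equiv.Perm.sign σ : ℝ) *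
        ∏ i, b.coord (σ i) (A (b i)) := by
    funext A
    rw [ContinuousLinearMap.det, ← LinearMap.det_toMatrix b, Matrix.det_apply']
    simp [LinearMap.toMatrix_apply]
  rw [h]
  refine ContDiff.sum fun σ _ => contDiff_const.mul (contDiff_prod fun i _ => ?_)
  exact (LinearMap.toContinuousLinearMap (b.coord (σ i))).contDiff.comp
    (ContinuousLinearMap.apply ℝ E (b i)).contDiff

/-- Smoothness supplies a derivative; its values are then read off along the lines `1 + r B`. -/
theorem exists_hasFDerivAt_det_one : ∃ φ : (E →L[ℝ] E) →L[ℝ] ℝ,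
    (∀ B : E →L[ℝ] E, φ B = LinearMap.trace ℝ E B) ∧
      HasFDerivAt (fun A : E →L[ℝ] E => A.det) φ 1 := by
  classical
  have hd : HasFDerivAt (fun A : E →L[ℝ] E => A.det) _ 1 :=
    ((contDiff_det (E := E)).differentiable one_ne_zero 1).hasFDerivAt
  refine ⟨_, fun B => ?_, hd⟩
  let b := Module.finBasis ℝ E
  have h1 : HasDerivAt (fun r : ℝ => (1 : E →L[ℝ] E) + r • B) B 0 := by
    simpa using ((hasDerivAt_id (0 : ℝ)).smul_const B).const_add 1
  have h2 := HasFDerivAt.comp_hasDerivAt_of_eq (0 : ℝ) hd h1 (by simp)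
  have h3 := hasDerivAt_det_one_add_smul (LinearMap.toMatrix b b (B : E →ₗ[ℝ] E))
  rw [← LinearMap.trace_eq_matrix_trace] at h3
  refine h2.unique (h3.congr_of_eventuallyEq (Eventually.of_forall fun r => ?_))
  simp only [Function.comp, ContinuousLinearMap.det]
  rw [← LinearMap.det_toMatrix b]
  congr 1
  have : ((1 + r • B : E →L[ℝ] E) : E →ₗ[ℝ] E) = LinearMap.id + r • (B : E →ₗ[ℝ] E) := rfl
  rw [this, map_add, map_smul, LinearMap.toMatrix_id]

/-- Uniform first-order expansion of the determinant near the identity. -/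
theorem exists_det_le_of_norm_le (M : ℝ) {δ : ℝ} (hδ : 0 < δ) :
    ∃ h₀ > 0, ∀ h, 0 < h → h ≤ h₀ → ∀ B : E →L[ℝ] E, ‖B‖ ≤ M →
      |(1 + h • B : E →L[ℝ] E).det| ≤ 1 + h * LinearMap.trace ℝ E B + δ * h := by
  obtain ⟨φ, hφ, hd⟩ := exists_hasFDerivAt_det_one (E := E)
  set M' := max M 1 with hM'
  have hM'0 : 0 < M' := lt_of_lt_of_le one_pos (le_max_right _ _)
  -- The first entry of the minimum makes the error at most `δ h`; the second keeps the error below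
  -- `1/4`, which is used to show that the determinant is positive.
  have hev := hd.isLittleO.def (show 0 < min (δ / M') (1 / (4 * M')) by positivity)
  obtain ⟨r, hr, hball⟩ := Metric.eventually_nhds_iff.1 hev
  set a := min (δ / M') (1 / (4 * M')) with ha
  have hb0 : 0 < min (r / (2 * M')) (1 / (2 * M' * (‖φ‖ + 1))) := by positivity
  refine ⟨min (min (r / (2 * M')) (1 / (2 * M' * (‖φ‖ + 1)))) 1, lt_min hb0 one_pos,
    fun h h0 hh B hB => ?_⟩
  have hB' : ‖B‖ ≤ M' := hB.trans (le_max_left _ _)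
  have hh1 : h ≤ r / (2 * M') := hh.trans ((min_le_left _ _).trans (min_le_left _ _))
  have hh2 : h ≤ 1 / (2 * M' * (‖φ‖ + 1)) := hh.trans ((min_le_left _ _).trans (min_le_right _ _))
  have hh3 : h ≤ 1 := hh.trans (min_le_right _ _)
  have hnB : ‖h • B‖ ≤ h * M' := by
    rw [norm_smul, Real.norm_of_nonneg h0.le]
    gcongr
  have hlt : h * M' < r := by
    rw [le_div_iff₀ (by positivity)] at hh1
    nlinarith
  have h1 := hball (y := 1 + h • B) (by
    rw [dist_eq_norm, add_sub_cancel_left]; exact hnB.trans_lt hlt)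
  rw [add_sub_cancel_left, hφ] at h1
  have hdet1 : (1 : E →L[ℝ] E).det = 1 := LinearMap.det_id
  have htr : LinearMap.trace ℝ E ((h • B : E →L[ℝ] E) : E →ₗ[ℝ] E)
      = h * LinearMap.trace ℝ E (B : E →ₗ[ℝ] E) := by
    rw [← smul_eq_mul, ← map_smul]; rfl
  rw [hdet1, htr, Real.norm_eq_abs] at h1
  have h2 : a * ‖h • B‖ ≤ δ * h := by
    calc a * ‖h • B‖ ≤ (δ / M') * (h * M') := by gcongr; exact min_le_left _ _
      _ = δ * h := by field_simp
  have h3 : a * ‖h • B‖ ≤ 1 / 4 := by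
    calc a * ‖h • B‖ ≤ (1 / (4 * M')) * (h * M') := by gcongr; exact min_le_right _ _
      _ = h / 4 := by field_simp
      _ ≤ 1 / 4 := by linarith
  have h4 : |h * LinearMap.trace ℝ E (B : E →ₗ[ℝ] E)| ≤ 1 / 2 := by
    rw [← hφ, abs_mul, abs_of_pos h0]
    have : |φ B| ≤ ‖φ‖ * M' := (φ.le_opNorm B).trans (by gcongr)
    rw [le_div_iff₀ (by positivity)] at hh2
    have hp : 0 ≤ h * M' := by positivity
    calc h * |φ B| ≤ h * (‖φ‖ * M') := by gcongr
      _ ≤ 1 / 2 := by nlinarith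
  have h5 := abs_le.1 h1
  have h6 := abs_le.1 h4
  -- The determinant is at least `1 - 1/2 - 1/4`, so the absolute value can be dropped.
  rw [abs_of_nonneg (by linarith)]
  linarith

end Determinant

/-! ### Integral curves compared with each other and with Euler steps -/

section Curves

variable {E : Type*} [NormedAddCommGroup E] [NormedSpace ℝ E]

/-- There is an integral curve of `X` on `[0, h]` that stays in `K` and leads from `x` to `y`. -/
def FlowsIn (X : E → E) (K : Set E) (h : ℝ) (x y : E) : Prop :=
  ∃ c : ℝ → E, (∀ s ∈ Icc 0 h, c s ∈ K ∧ HasDerivWithinAt c (X (c s)) (Icc 0 h) s) ∧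
    c 0 = x ∧ c h = y

variable {X : E → E} {K : Set E} {h : ℝ} {x y x' y' : E} {L : ℝ≥0}

theorem FlowsIn.mono {K' : Set E} (H : FlowsIn X K h x y) (hK : K ⊆ K') : FlowsIn X K' h x y := by
  obtain ⟨c, hc, h0, h1⟩ := H
  exact ⟨c, fun s hs => ⟨hK (hc s hs).1, (hc s hs).2⟩, h0, h1⟩

theorem FlowsIn.left_mem (H : FlowsIn X K h x y) (hh : 0 ≤ h) : x ∈ K := by
  obtain ⟨c, hc, h0, -⟩ := H
  exact h0 ▸ (hc 0 (left_mem_Icc.2 hh)).1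

theorem FlowsIn.right_mem (H : FlowsIn X K h x y) (hh : 0 ≤ h) : y ∈ K := by
  obtain ⟨c, hc, -, h1⟩ := H
  exact h1 ▸ (hc h (right_mem_Icc.2 hh)).1

theorem FlowsIn.reverse (H : FlowsIn X K h x y) : FlowsIn (-X) K h y x := by
  obtain ⟨c, hc, h0, h1⟩ := H
  have hm : MapsTo (fun s => h - s) (Icc 0 h) (Icc 0 h) := fun s hs =>
    ⟨by linarith [hs.2], by linarith [hs.1]⟩
  refine ⟨fun s => c (h - s), fun s hs => ⟨(hc _ (hm hs)).1, ?_⟩, by simpa, by simpa⟩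
  have hd : HasDerivWithinAt (fun s : ℝ => h - s) (-1) (Icc 0 h) s := by
    simpa using ((hasDerivAt_id s).const_sub h).hasDerivWithinAt
  exact ((hc _ (hm hs)).2.scomp s hd hm).congr_deriv (by simp)

theorem FlowsIn.split {s t : ℝ} (hs : 0 ≤ s) (ht : 0 ≤ t) (H : FlowsIn X K (s + t) x y) :
    ∃ z, FlowsIn X K s x z ∧ FlowsIn X K t z y := by
  obtain ⟨c, hc, h0, h1⟩ := H
  refine ⟨c s, ⟨c, fun r hr => ?_, h0, rfl⟩, fun r => c (s + r), fun r hr => ?_, by simp, h1⟩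
  · have hr' : r ∈ Icc 0 (s + t) := ⟨hr.1, by linarith [hr.2]⟩
    exact ⟨(hc r hr').1, (hc r hr').2.mono (Icc_subset_Icc_right (by linarith))⟩
  · have hm : MapsTo (fun r => s + r) (Icc 0 t) (Icc 0 (s + t)) := fun r hr =>
      ⟨by linarith [hr.1], by linarith [hr.2]⟩
    refine ⟨(hc _ (hm hr)).1, ?_⟩
    have hd : HasDerivWithinAt (fun r : ℝ => s + r) 1 (Icc 0 t) r := by
      simpa using ((hasDerivAt_id r).const_add s).hasDerivWithinAt
    exact ((hc _ (hm hr)).2.scomp r hd hm).congr_deriv (by simp)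

theorem dist_le_of_integralCurves (hX : LipschitzOnWith L X K) {c d : ℝ → E}
    (hc : ∀ s ∈ Icc 0 h, c s ∈ K ∧ HasDerivWithinAt c (X (c s)) (Icc 0 h) s)
    (hd : ∀ s ∈ Icc 0 h, d s ∈ K ∧ HasDerivWithinAt d (X (d s)) (Icc 0 h) s) :
    ∀ s ∈ Icc 0 h, dist (c s) (d s) ≤ dist (c 0) (d 0) * Real.exp (L * s) := by
  have key : ∀ c : ℝ → E,
      (∀ s ∈ Icc 0 h, c s ∈ K ∧ HasDerivWithinAt c (X (c s)) (Icc 0 h) s) →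
      ContinuousOn c (Icc 0 h) ∧ ∀ s ∈ Ico 0 h, HasDerivWithinAt c (X (c s)) (Ici s) s := by
    intro c hc
    refine ⟨fun s hs => (hc s hs).2.continuousWithinAt, fun s hs => ?_⟩
    refine (hc s (Ico_subset_Icc_self hs)).2.mono_of_mem_nhdsWithin ?_
    exact mem_of_superset (Icc_mem_nhdsGE hs.2) (Icc_subset_Icc_left hs.1)
  intro s hs
  have := dist_le_of_trajectories_ODE_of_mem (v := fun _ => X) (s := fun _ => K)
    (fun _ _ => hX) (key c hc).1 (key c hc).2 (fun t ht => (hc t (Ico_subset_Icc_self ht)).1)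
    (key d hd).1 (key d hd).2 (fun t ht => (hd t (Ico_subset_Icc_self ht)).1) le_rfl s hs
  simpa using this

theorem FlowsIn.dist_le (hX : LipschitzOnWith L X K) (hh : 0 ≤ h)
    (H : FlowsIn X K h x y) (H' : FlowsIn X K h x' y') :
    dist y y' ≤ Real.exp (L * h) * dist x x' := by
  obtain ⟨c, hc, rfl, rfl⟩ := H
  obtain ⟨d, hd, rfl, rfl⟩ := H'
  rw [mul_comm]
  exact dist_le_of_integralCurves hX hc hd h (right_mem_Icc.2 hh)

theorem FlowsIn.right_unique (hX : LipschitzOnWith L X K) (hh : 0 ≤ h)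
    (H : FlowsIn X K h x y) (H' : FlowsIn X K h x y') : y = y' := by
  have := H.dist_le hX hh H'
  rw [dist_self, mul_zero] at this
  exact dist_le_zero.1 this

theorem FlowsIn.left_unique (hX : LipschitzOnWith L X K) (hh : 0 ≤ h)
    (H : FlowsIn X K h x y) (H' : FlowsIn X K h x' y) : x = x' :=
  H.reverse.right_unique (hX.neg) hh H'.reverse

/-- The flow differs from its Euler step by a map with Lipschitz constant of order `h²`. -/
theorem FlowsIn.norm_sub_euler_le {Y : E → E} {L' : ℝ≥0} (hX : LipschitzOnWith L X K)
    (hY : LipschitzOnWith L' Y K)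
    (hXY : ∀ x ∈ K, ∃ X' : E →L[ℝ] E, HasFDerivAt X X' x ∧ Y x = X' (X x)) (hh : 0 ≤ h)
    (H : FlowsIn X K h x y) (H' : FlowsIn X K h x' y') :
    ‖(y - x - h • X x) - (y' - x' - h • X x')‖ ≤ L' * Real.exp (L * h) * h ^ 2 * ‖x - x'‖ := by
  obtain ⟨c, hc, rfl, rfl⟩ := H
  obtain ⟨d, hd, rfl, rfl⟩ := H'
  have h0 : (0 : ℝ) ∈ Icc 0 h := left_mem_Icc.2 hh
  have h1 : h ∈ Icc 0 h := right_mem_Icc.2 hh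
  -- `u` is the derivative of `c - d`, and its own derivative is `Y(c) - Y(d)`, which Grönwall
  -- bounds by a multiple of the initial distance. Applying the mean value inequality twice produces
  -- the factor `h²`.
  set u := fun s => X (c s) - X (d s) with hu
  set M := L' * Real.exp (L * h) * ‖c 0 - d 0‖ with hM
  have hM0 : 0 ≤ M := by positivity
  have huD : ∀ s ∈ Icc 0 h, HasDerivWithinAt u (Y (c s) - Y (d s)) (Icc 0 h) s := by
    intro s hs
    obtain ⟨A, hA, hA'⟩ := hXY _ (hc s hs).1
    obtain ⟨B, hB, hB'⟩ := hXY _ (hd s hs).1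
    rw [hA', hB']
    exact (hA.comp_hasDerivWithinAt s (hc s hs).2).sub (hB.comp_hasDerivWithinAt s (hd s hs).2)
  have hYb : ∀ s ∈ Icc 0 h, ‖Y (c s) - Y (d s)‖ ≤ M := by
    intro s hs
    have h2 := hY.dist_le_mul _ (hc s hs).1 _ (hd s hs).1
    have h3 := dist_le_of_integralCurves hX hc hd s hs
    rw [dist_eq_norm] at h2
    rw [dist_eq_norm (c 0)] at h3
    refine h2.trans ?_
    rw [hM, mul_assoc, mul_comm (Real.exp _)]
    gcongr
    refine h3.trans ?_
    gcongr
    exact hs.2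
  have hub : ∀ s ∈ Icc 0 h, ‖u s - u 0‖ ≤ M * h := by
    intro s hs
    have := Convex.norm_image_sub_le_of_norm_hasDerivWithin_le huD hYb (convex_Icc 0 h) h0 hs
    refine this.trans ?_
    rw [sub_zero, Real.norm_of_nonneg hs.1]
    gcongr
    exact hs.2
  have hwD : ∀ s ∈ Icc 0 h, HasDerivWithinAt (fun s => (c s - d s) - s • u 0)
      (u s - u 0) (Icc 0 h) s := by
    intro s hs
    have := ((hc s hs).2.sub (hd s hs).2).sub
      (((hasDerivAt_id s).hasDerivWithinAt (s := Icc 0 h)).smul_const (u 0))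
    exact this.congr_deriv (by simp [hu])
  have := Convex.norm_image_sub_le_of_norm_hasDerivWithin_le hwD hub (convex_Icc 0 h) h0 h1
  simp only [zero_smul, sub_zero, Real.norm_of_nonneg hh] at this
  calc _ = ‖(c h - d h - h • u 0) - (c 0 - d 0)‖ := by
        congr 1; simp only [hu, smul_sub]; abel
    _ ≤ M * h * h := this
    _ = _ := by rw [hM]; ring

/-- First-order expansion of a function along an integral curve. -/
theorem FlowsIn.le_add_of_lipschitz {ρ Z : E → ℝ} {L' : ℝ≥0} {M : ℝ}
    (hM : ∀ x ∈ K, ‖X x‖ ≤ M) (hZ : LipschitzOnWith L' Z K)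
    (hρ : ∀ x ∈ K, ∃ ρ' : E →L[ℝ] ℝ, HasFDerivAt ρ ρ' x ∧ Z x = ρ' (X x)) (hh : 0 ≤ h)
    (H : FlowsIn X K h x y) : ρ y ≤ ρ x + h * Z x + L' * M * h ^ 2 := by
  obtain ⟨c, hc, rfl, rfl⟩ := H
  have h0 : (0 : ℝ) ∈ Icc 0 h := left_mem_Icc.2 hh
  have h1 : h ∈ Icc 0 h := right_mem_Icc.2 hh
  have hM0 : 0 ≤ M := (norm_nonneg _).trans (hM _ (hc 0 h0).1)
  have hcb : ∀ s ∈ Icc 0 h, ‖c s - c 0‖ ≤ M * h := by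
    intro s hs
    have := Convex.norm_image_sub_le_of_norm_hasDerivWithin_le (fun s hs => (hc s hs).2)
      (fun s hs => hM _ (hc s hs).1) (convex_Icc 0 h) h0 hs
    refine this.trans ?_
    rw [sub_zero, Real.norm_of_nonneg hs.1]
    gcongr
    exact hs.2
  have hD : ∀ s ∈ Icc 0 h, HasDerivWithinAt (fun s => ρ (c s) - s * Z (c 0))
      (Z (c s) - Z (c 0)) (Icc 0 h) s := by
    intro s hs
    obtain ⟨A, hA, hA'⟩ := hρ _ (hc s hs).1
    rw [hA']
    have := (hA.comp_hasDerivWithinAt s (hc s hs).2).sub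
      (((hasDerivAt_id s).hasDerivWithinAt (s := Icc 0 h)).mul_const (Z (c 0)))
    exact this.congr_deriv (by simp)
  have hb : ∀ s ∈ Icc 0 h, ‖Z (c s) - Z (c 0)‖ ≤ L' * (M * h) := by
    intro s hs
    have := hZ.dist_le_mul _ (hc s hs).1 _ (hc 0 h0).1
    rw [dist_eq_norm, dist_eq_norm] at this
    exact this.trans (by gcongr; exact hcb s hs)
  have := Convex.norm_image_sub_le_of_norm_hasDerivWithin_le hD hb (convex_Icc 0 h) h0 h1
  simp only [zero_mul, sub_zero, Real.norm_of_nonneg hh] at this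
  have := (le_abs_self _).trans this
  nlinarith

end Curves

/-! ### Liouville's theorem for local flows -/

variable {E : Type*} [NormedAddCommGroup E] [NormedSpace ℝ E]

theorem exists_lipschitzOnWith_of_contDiffOn {F : Type*} [NormedAddCommGroup F] [NormedSpace ℝ F]
    {f : E → F} {U K : Set E} (hU : IsOpen U) (hf : ContDiffOn ℝ 1 f U) (hK : IsCompact K)
    (hKU : K ⊆ U) : ∃ L : ℝ≥0, LipschitzOnWith L f K := by
  refine LocallyLipschitzOn.exists_lipschitzOnWith_of_compact hK fun x hx => ?_
  obtain ⟨L, t, ht, h⟩ := (hf.contDiffAt (hU.mem_nhds (hKU hx))).exists_lipschitzOnWith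
  exact ⟨L, t, mem_nhdsWithin_of_mem_nhds ht, h⟩

theorem exists_compact_exhaustion [FiniteDimensional ℝ E] {U : Set E} (hU : IsOpen U) :
    ∃ K : ℕ → Set E, Monotone K ∧ (∀ k, IsCompact (K k)) ∧ (∀ k, K k ⊆ U) ∧
      ∀ T : Set E, IsCompact T → T ⊆ U → ∃ k, T ⊆ K k := by
  have : ProperSpace E := FiniteDimensional.proper ℝ E
  have : LocallyCompactSpace U := hU.locallyCompactSpace
  let C := CompactExhaustion.choice U
  refine ⟨fun k => Subtype.val '' C k, fun i j hij => image_mono (C.subset hij),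
    fun k => (C.isCompact k).image continuous_subtype_val, fun k => ?_, fun T hT hTU => ?_⟩
  · rintro _ ⟨x, -, rfl⟩
    exact x.2
  · have hT' : IsCompact (Subtype.val ⁻¹' T : Set U) :=
      Topology.IsInducing.subtypeVal.isCompact_preimage' hT (by simpa using hTU)
    obtain ⟨k, hk⟩ := C.exists_superset_of_isCompact hT'
    exact ⟨k, fun x hx => ⟨⟨x, hTU hx⟩, hk hx, rfl⟩⟩

/-- `ρ` is a positive `C²` function with `div (ρ X) = 0` on the open set `U`. -/
structure IsInvariantDensity (X : E → E) (ρ : E → ℝ) (U : Set E) : Prop where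
  isOpen : IsOpen U
  contDiffOn_field : ContDiffOn ℝ 2 X U
  contDiffOn_density : ContDiffOn ℝ 2 ρ U
  pos : ∀ x ∈ U, 0 < ρ x
  div_eq_zero : ∀ x ∈ U, fderiv ℝ ρ x (X x) + ρ x * LinearMap.trace ℝ E (fderiv ℝ X x) = 0

theorem IsInvariantDensity.neg {X : E → E} {ρ : E → ℝ} {U : Set E}
    (H : IsInvariantDensity X ρ U) : IsInvariantDensity (-X) ρ U where
  isOpen := H.isOpen
  contDiffOn_field := H.contDiffOn_field.neg
  contDiffOn_density := H.contDiffOn_density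
  pos := H.pos
  div_eq_zero x hx := by
    have := H.div_eq_zero x hx
    rw [fderiv_neg, ContinuousLinearMap.toLinearMap_neg, map_neg, Pi.neg_apply, map_neg]
    linarith

/-- The first-order terms `±t` of the volume and of the density cancel in the product, leaving `(1 +
e)² - t²`; this is at most `1 + 3e` because `e ≤ 1`. -/
theorem mul_le_of_expansions {d r r' t e : ℝ} (hd : 0 ≤ d) (hr : 0 < r) (hr' : 0 < r')
    (he : 0 ≤ e) (he1 : e ≤ 1) (h1 : d ≤ 1 + t + e) (h2 : r' ≤ r * (1 - t + e)) :
    d * r' ≤ (1 + 3 * e) * r := by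
  calc d * r' ≤ (1 + t + e) * (r * (1 - t + e)) := mul_le_mul h1 h2 hr'.le (hd.trans h1)
    _ = ((1 + e) ^ 2 - t ^ 2) * r := by ring
    _ ≤ (1 + 3 * e) * r := by
      gcongr
      nlinarith [sq_nonneg t]

variable [FiniteDimensional ℝ E] [MeasurableSpace E] [BorelSpace E]
  (μ : Measure E) [μ.IsAddHaarMeasure]

/-- Haar measure and the Hausdorff measure of top dimension have the same null sets, and Lipschitz
maps increase the latter by at most a constant factor. -/
theorem measure_image_eq_zero_of_lipschitzOnWith {f : E → E} {s : Set E} {L : ℝ≥0}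
    (hf : LipschitzOnWith L f s) (hs : μ s = 0) : μ (f '' s) = 0 := by
  have h1 : (μH[Module.finrank ℝ E] : Measure E) s = 0 :=
    Measure.absolutelyContinuous_isAddHaarMeasure _ μ hs
  have h2 : (μH[Module.finrank ℝ E] : Measure E) (f '' s) = 0 := by
    refine le_antisymm ((hf.hausdorffMeasure_image_le (Nat.cast_nonneg _)).trans ?_) zero_le
    rw [h1, mul_zero]
  exact Measure.absolutelyContinuous_isAddHaarMeasure μ _ h2

variable {X : E → E} {ρ : E → ℝ} {U K : Set E}

/-- The remainder `g` of the Euler step is Lipschitz with constant `O(h²)`, hence differentiable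
almost everywhere on `A` by Rademacher's theorem, with derivative `O(h²)`. The change of variables
formula then needs no smooth dependence of the flow on initial conditions. The threshold `h₀`
depends on `K` and `δ` but not on `A`, which allows iteration. -/
theorem lintegral_image_le_of_isInvariantDensity_step (H : IsInvariantDensity X ρ U)
    (hK : IsCompact K) (hKU : K ⊆ U) {δ : ℝ} (hδ : 0 < δ) :
    ∃ h₀ > 0, ∀ h, 0 < h → h ≤ h₀ → ∀ (A : Set E) (f : E → E), MeasurableSet A →
      (∀ x ∈ A, FlowsIn X K h x (f x)) →
      ∫⁻ x in f '' A, ENNReal.ofReal (ρ x) ∂μ ≤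
        ENNReal.ofReal (1 + δ * h) * ∫⁻ x in A, ENNReal.ofReal (ρ x) ∂μ := by
  have hU := H.isOpen
  have hdX : ∀ x ∈ U, HasFDerivAt X (fderiv ℝ X x) x := fun x hx =>
    ((H.contDiffOn_field.contDiffAt (hU.mem_nhds hx)).differentiableAt two_ne_zero).hasFDerivAt
  have hdρ : ∀ x ∈ U, HasFDerivAt ρ (fderiv ℝ ρ x) x := fun x hx =>
    ((H.contDiffOn_density.contDiffAt (hU.mem_nhds hx)).differentiableAt two_ne_zero).hasFDerivAt
  have hX1 : ContDiffOn ℝ 1 X U := H.contDiffOn_field.of_le one_le_two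
  have hDX : ContDiffOn ℝ 1 (fderiv ℝ X) U :=
    H.contDiffOn_field.fderiv_of_isOpen hU (by norm_num)
  have hDρ : ContDiffOn ℝ 1 (fderiv ℝ ρ) U :=
    H.contDiffOn_density.fderiv_of_isOpen hU (by norm_num)
  obtain ⟨L, hL⟩ := exists_lipschitzOnWith_of_contDiffOn hU hX1 hK hKU
  obtain ⟨L₁, hL₁⟩ := exists_lipschitzOnWith_of_contDiffOn hU (hDX.clm_apply hX1) hK hKU
  obtain ⟨L₂, hL₂⟩ := exists_lipschitzOnWith_of_contDiffOn hU (hDρ.clm_apply hX1) hK hKU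
  obtain ⟨M, hM⟩ := hK.exists_bound_of_continuousOn (hX1.continuousOn.mono hKU)
  obtain ⟨M₁, hM₁⟩ := hK.exists_bound_of_continuousOn (hDX.continuousOn.mono hKU)
  obtain ⟨r₀, hr₀, hr⟩ : ∃ r₀ > 0, ∀ x ∈ K, r₀ ≤ ρ x :=
    hK.exists_forall_le' (H.contDiffOn_density.continuousOn.mono hKU) fun x hx => H.pos x (hKU hx)
  obtain ⟨φ, hφ, -⟩ := exists_hasFDerivAt_det_one (E := E)
  -- Since `h ≤ 1`, the factor `exp (L h)` in the bound for the remainder is at most `exp L`.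
  set C : ℝ≥0 := L₁ * Real.toNNReal (Real.exp L) with hC
  -- The division by three compensates the factor in `mul_le_of_expansions`.
  set δ' := δ / 3 with hδ'
  obtain ⟨h₁, hh₁, hdet⟩ := exists_det_le_of_norm_le (E := E) (M₁ + C)
    (δ := δ' / 2) (by positivity)
  -- `a₂` controls the trace of the remainder's derivative and `a₃` the second-order term of `ρ`
  -- relative to its minimum on `K`; the added ones only make them positive.
  set a₂ := ‖φ‖ * C + 1 with ha₂
  set a₃ := |L₂ * M / r₀| + 1 with ha₃
  have ha₂0 : 0 < a₂ := by positivity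
  have ha₃0 : 0 < a₃ := by positivity
  have hδ'0 : 0 < δ' := by positivity
  refine ⟨min (min (min h₁ 1) (δ' / 2 / a₂)) (min (δ' / a₃) (1 / δ')), by positivity,
    fun h h0 hh A f hA hf => ?_⟩
  have hb1 : h ≤ h₁ := hh.trans ((min_le_left _ _).trans ((min_le_left _ _).trans (min_le_left _ _)))
  have hb2 : h ≤ 1 := hh.trans ((min_le_left _ _).trans ((min_le_left _ _).trans (min_le_right _ _)))
  have hb3 : h ≤ δ' / 2 / a₂ := hh.trans ((min_le_left _ _).trans (min_le_right _ _))
  have hb4 : h ≤ δ' / a₃ := hh.trans ((min_le_right _ _).trans (min_le_left _ _))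
  have hb5 : h ≤ 1 / δ' := hh.trans ((min_le_right _ _).trans (min_le_right _ _))
  rw [le_div_iff₀ (by positivity)] at hb3 hb4 hb5
  have hAK : A ⊆ K := fun x hx => (hf x hx).left_mem h0.le
  set g : E → E := fun x => f x - x - h • X x with hg
  have hfL : LipschitzOnWith (Real.toNNReal (Real.exp (L * h))) f A := by
    refine LipschitzOnWith.of_dist_le_mul fun x hx y hy => ?_
    rw [Real.coe_toNNReal _ (Real.exp_pos _).le]
    exact (hf x hx).dist_le hL h0.le (hf y hy)
  have hinj : InjOn f A := by
    intro x hx y hy hxy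
    have h2 := hf y hy
    rw [← hxy] at h2
    exact (hf x hx).left_unique hL h0.le h2
  set η : ℝ≥0 := C * Real.toNNReal (h ^ 2) with hη
  have hηr : (η : ℝ) = C * h ^ 2 := by
    rw [hη, NNReal.coe_mul, Real.coe_toNNReal _ (by positivity)]
  have hgb : ∀ x ∈ A, ∀ y ∈ A, ‖g x - g y‖ ≤ η * ‖x - y‖ := by
    intro x hx y hy
    refine ((hf x hx).norm_sub_euler_le hL hL₁
      (fun z hz => ⟨_, hdX z (hKU hz), rfl⟩) h0.le (hf y hy)).trans ?_
    rw [hηr, hC, NNReal.coe_mul, Real.coe_toNNReal _ (Real.exp_pos _).le]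
    gcongr
    exact mul_le_of_le_one_right L.coe_nonneg hb2
  have hgL : LipschitzOnWith η g A := by
    refine LipschitzOnWith.of_dist_le_mul fun x hx y hy => ?_
    rw [dist_eq_norm, dist_eq_norm]
    exact hgb x hx y hy
  -- the points of differentiability of the flow have full measure
  have hae := hgL.ae_differentiableWithinAt_of_mem (μ := μ)
  obtain ⟨N, hNsub, hNm, hN0⟩ := exists_measurable_superset_of_null (ae_iff.1 hae)
  set A₁ := A \ N with hA₁
  have hA₁m : MeasurableSet A₁ := hA.diff hNm
  have hgd : ∀ x ∈ A₁, HasFDerivWithinAt g (fderivWithin ℝ g A₁ x) A₁ x := by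
    intro x hx
    have : DifferentiableWithinAt ℝ g A x := by
      by_contra hcon
      exact hx.2 (hNsub fun hc => hcon (hc hx.1))
    exact (this.mono sdiff_subset).hasFDerivWithinAt
  -- A map with Lipschitz constant `η` is approximated by `0` up to `η`, so its derivative within
  -- `A₁` has norm at most `η` almost everywhere.
  have happ : ApproximatesLinearOn g (0 : E →L[ℝ] E) A₁ η := by
    intro x hx y hy
    simpa using hgb x hx.1 y hy.1
  have hgn := happ.norm_fderiv_sub_le (μ := μ) hA₁m _ hgd
  have hfd : ∀ x ∈ A₁, HasFDerivWithinAt f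
      (1 + h • (fderiv ℝ X x + h⁻¹ • fderivWithin ℝ g A₁ x)) A₁ x := by
    intro x hx
    have h1 := ((hasFDerivWithinAt_id x A₁).add
      ((hdX x (hKU (hAK hx.1))).hasFDerivWithinAt.const_smul h)).add (hgd x hx)
    have h2 : (id + h • X + g : E → E) = f := by
      funext y
      simp [hg]
    rw [h2] at h1
    refine h1.congr_fderiv ?_
    rw [smul_add, smul_inv_smul₀ h0.ne', add_assoc]
    rfl
  have hImA : μ (f '' A \ f '' A₁) = 0 := by
    refine measure_mono_null (t := f '' (A ∩ N)) ?_
      (measure_image_eq_zero_of_lipschitzOnWith μ (hfL.mono inter_subset_left)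
        (measure_mono_null inter_subset_right hN0))
    rintro _ ⟨⟨x, hx, rfl⟩, hx'⟩
    refine ⟨x, ⟨hx, ?_⟩, rfl⟩
    by_contra hxN
    exact hx' ⟨x, ⟨hx, hxN⟩, rfl⟩
  calc ∫⁻ x in f '' A, ENNReal.ofReal (ρ x) ∂μ
      ≤ ∫⁻ x in f '' A₁, ENNReal.ofReal (ρ x) ∂μ := by
        refine (lintegral_mono_set (subset_union_right (s := f '' A₁))).trans ?_
        rw [← union_sdiff_self]
        refine (lintegral_union_le _ _ _).trans ?_
        rw [setLIntegral_measure_zero _ _ hImA, add_zero]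
    _ = ∫⁻ x in A₁, ENNReal.ofReal
          |(1 + h • (fderiv ℝ X x + h⁻¹ • fderivWithin ℝ g A₁ x) : E →L[ℝ] E).det| *
          ENNReal.ofReal (ρ (f x)) ∂μ :=
        lintegral_image_eq_lintegral_abs_det_fderiv_mul μ hA₁m hfd (hinj.mono sdiff_subset) _
    _ ≤ ∫⁻ x in A₁, ENNReal.ofReal (1 + δ * h) * ENNReal.ofReal (ρ x) ∂μ := by
        refine lintegral_mono_ae ?_
        filter_upwards [hgn, ae_restrict_mem hA₁m] with x hx hxA
        have hxK : x ∈ K := hAK hxA.1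
        set G := fderivWithin ℝ g A₁ x with hG
        rw [sub_zero] at hx
        have hx' : ‖G‖ ≤ C * h ^ 2 := hηr ▸ hx
        have hiG : ‖h⁻¹ • G‖ ≤ C * h := by
          rw [norm_smul, norm_inv, Real.norm_of_nonneg h0.le, inv_mul_le_iff₀ h0]
          linarith
        have hB : ‖fderiv ℝ X x + h⁻¹ • G‖ ≤ M₁ + C :=
          (norm_add_le _ _).trans (add_le_add (hM₁ x hxK)
            (hiG.trans (mul_le_of_le_one_right C.coe_nonneg hb2)))
        set τ := LinearMap.trace ℝ E (fderiv ℝ X x) with hτ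
        have htr : h * LinearMap.trace ℝ E (fderiv ℝ X x + h⁻¹ • G : E →L[ℝ] E) ≤
            h * τ + δ' / 2 * h := by
          rw [← hφ, map_add, hφ, ← hτ]
          have h3 : φ (h⁻¹ • G) ≤ ‖φ‖ * (C * h) :=
            (le_abs_self _).trans ((φ.le_opNorm _).trans (by gcongr))
          have h4 : ‖φ‖ * (C * h) ≤ δ' / 2 := by linarith
          have h5 := mul_le_mul_of_nonneg_left (h3.trans h4) h0.le
          linarith
        have hdet' : |(1 + h • (fderiv ℝ X x + h⁻¹ • G) : E →L[ℝ] E).det| ≤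
            1 + h * τ + δ' * h := by
          linarith [hdet h h0 hb1 _ hB]
        have hρx : 0 < ρ x := H.pos x (hKU hxK)
        have hdiv := H.div_eq_zero x (hKU hxK)
        rw [← hτ] at hdiv
        have hρf : ρ (f x) ≤ ρ x * (1 - h * τ + δ' * h) := by
          have h5 := (hf x hxA.1).le_add_of_lipschitz hM hL₂
            (fun z hz => ⟨_, hdρ z (hKU hz), rfl⟩) h0.le
          rw [show fderiv ℝ ρ x (X x) = -(ρ x * τ) by linarith] at h5
          have h7 : L₂ * M / r₀ * h ≤ δ' := by
            refine le_trans ?_ hb4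
            rw [mul_comm h]
            gcongr
            exact (le_abs_self _).trans (by linarith)
          rw [div_mul_eq_mul_div, div_le_iff₀ hr₀] at h7
          have h8 : L₂ * M * h ≤ ρ x * δ' := by
            rw [mul_comm (ρ x)]
            exact h7.trans (by gcongr; exact hr x hxK)
          have h9 : L₂ * M * h ^ 2 ≤ ρ x * δ' * h := by
            rw [pow_two, ← mul_assoc]
            gcongr
          linarith
        have hρfp : 0 < ρ (f x) := H.pos _ (hKU ((hf x hxA.1).right_mem h0.le))
        rw [← ENNReal.ofReal_mul (abs_nonneg _), ← ENNReal.ofReal_mul (by positivity)]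
        refine ENNReal.ofReal_le_ofReal ?_
        have := mul_le_of_expansions (abs_nonneg _) hρx hρfp (mul_pos hδ'0 h0).le
          (by linarith) hdet' hρf
        rwa [hδ', show 3 * (δ / 3 * h) = δ * h by ring] at this
    _ ≤ ∫⁻ x in A, ENNReal.ofReal (1 + δ * h) * ENNReal.ofReal (ρ x) ∂μ :=
        lintegral_mono_set sdiff_subset
    _ = _ := lintegral_const_mul' _ _ ENNReal.ofReal_ne_top

variable {E : Type*} [NormedAddCommGroup E] [NormedSpace ℝ E] [FiniteDimensional ℝ E]
  [MeasurableSpace E] [BorelSpace E] {X : E → E} {ρ : E → ℝ} {U K : Set E} {h : ℝ}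

theorem measurableSet_image_of_flowsIn {L : ℝ≥0} (hX : LipschitzOnWith L X K) (hh : 0 ≤ h)
    {A : Set E} (hA : MeasurableSet A) {f : E → E} (hf : ∀ x ∈ A, FlowsIn X K h x (f x)) :
    MeasurableSet (f '' A) := by
  have : ProperSpace E := FiniteDimensional.proper ℝ E
  refine hA.image_of_continuousOn_injOn (f := f) ?_ fun x hx y hy hxy => ?_
  · have : LipschitzOnWith (Real.toNNReal (Real.exp (L * h))) f A := by
      refine LipschitzOnWith.of_dist_le_mul fun x hx y hy => ?_
      rw [Real.coe_toNNReal _ (Real.exp_pos _).le]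
      exact (hf x hx).dist_le hX hh (hf y hy)
    exact this.continuousOn
  · have h2 := hf y hy
    rw [← hxy] at h2
    exact (hf x hx).left_unique hX hh h2

variable (μ : Measure E)

/-- Each trajectory is cut before its last step. Uniqueness of integral curves makes the last piece
a function of the intermediate point, so the image is obtained by composing two maps. -/
theorem lintegral_image_le_pow {L : ℝ≥0} (hX : LipschitzOnWith L X K) (hh : 0 ≤ h) {C : ℝ≥0∞}
    (hstep : ∀ (A : Set E) (f : E → E), MeasurableSet A → (∀ x ∈ A, FlowsIn X K h x (f x)) →
      ∫⁻ x in f '' A, ENNReal.ofReal (ρ x) ∂μ ≤ C * ∫⁻ x in A, ENNReal.ofReal (ρ x) ∂μ)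
    (N : ℕ) : ∀ (A : Set E) (f : E → E), MeasurableSet A →
      (∀ x ∈ A, FlowsIn X K (N * h) x (f x)) →
      ∫⁻ x in f '' A, ENNReal.ofReal (ρ x) ∂μ ≤ C ^ N * ∫⁻ x in A, ENNReal.ofReal (ρ x) ∂μ := by
  classical
  induction N with
  | zero =>
    intro A f hA hf
    have : f '' A = A := by
      refine (image_congr fun x hx => ?_).trans (image_id A)
      obtain ⟨c, -, h0, h1⟩ := hf x hx
      rw [Nat.cast_zero, zero_mul] at h1
      exact h1.symm.trans h0
    simp [this]
  | succ N ih =>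
    intro A f hA hf
    have hNh : 0 ≤ (N : ℝ) * h := by positivity
    have hs : ∀ x, ∃ z, x ∈ A → FlowsIn X K (N * h) x z ∧ FlowsIn X K h z (f x) := by
      intro x
      by_cases hx : x ∈ A
      · have hfx := hf x hx
        rw [Nat.cast_succ, add_one_mul] at hfx
        obtain ⟨z, hz⟩ := hfx.split hNh hh
        exact ⟨z, fun _ => hz⟩
      · exact ⟨x, fun h => absurd h hx⟩
    choose f₁ hf₁ using hs
    have hs₂ : ∀ y, ∃ w, y ∈ f₁ '' A → FlowsIn X K h y w := by
      intro y
      by_cases hy : y ∈ f₁ '' A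
      · obtain ⟨x, hx, rfl⟩ := hy
        exact ⟨f x, fun _ => (hf₁ x hx).2⟩
      · exact ⟨y, fun h => absurd h hy⟩
    choose f₂ hf₂ using hs₂
    have hcomp : f '' A = f₂ '' (f₁ '' A) := by
      rw [image_image]
      exact image_congr fun x hx =>
        (hf₁ x hx).2.right_unique hX hh (hf₂ _ (mem_image_of_mem f₁ hx))
    have hm := measurableSet_image_of_flowsIn hX hNh hA fun x hx => (hf₁ x hx).1
    rw [hcomp, pow_succ', mul_assoc]
    exact (hstep _ f₂ hm hf₂).trans (by gcongr; exact ih A f₁ hA fun x hx => (hf₁ x hx).1)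

variable [μ.IsAddHaarMeasure]

/-- With `N` steps of length `t / N` the factor is `(1 + δ t / N)^N ≤ exp (δ t)`, and `δ` is
arbitrary. -/
theorem lintegral_image_le_of_flowsIn (H : IsInvariantDensity X ρ U) (hK : IsCompact K)
    (hKU : K ⊆ U) {t : ℝ} (ht : 0 ≤ t) {A : Set E} (hA : MeasurableSet A) {f : E → E}
    (hf : ∀ x ∈ A, FlowsIn X K t x (f x)) :
    ∫⁻ x in f '' A, ENNReal.ofReal (ρ x) ∂μ ≤ ∫⁻ x in A, ENNReal.ofReal (ρ x) ∂μ := by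
  obtain ⟨L, hL⟩ := exists_lipschitzOnWith_of_contDiffOn H.isOpen
    (H.contDiffOn_field.of_le one_le_two) hK hKU
  have key : ∀ δ : ℝ, 0 < δ → ∫⁻ x in f '' A, ENNReal.ofReal (ρ x) ∂μ ≤
      ENNReal.ofReal (Real.exp (δ * t)) * ∫⁻ x in A, ENNReal.ofReal (ρ x) ∂μ := by
    intro δ hδ
    rcases ht.eq_or_lt with rfl | ht
    · have hfA : f '' A = A := by
        refine (image_congr fun x hx => ?_).trans (image_id A)
        obtain ⟨c, -, h0, h1⟩ := hf x hx
        exact h1.symm.trans h0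
      simp [hfA]
    obtain ⟨h₀, hh₀, hstep⟩ := lintegral_image_le_of_isInvariantDensity_step μ H hK hKU hδ
    obtain ⟨N, hN⟩ := exists_nat_gt (t / h₀)
    have hN0 : (0 : ℝ) < N := (by positivity : 0 < t / h₀).trans hN
    have hh : t / N ≤ h₀ := by
      rw [div_lt_iff₀ hh₀] at hN
      rw [div_le_iff₀ hN0]
      linarith
    have htN : 0 < t / N := by positivity
    have := lintegral_image_le_pow μ hL htN.le (hstep _ htN hh) N A f hA (by
      rwa [mul_div_cancel₀ _ hN0.ne'])
    refine this.trans ?_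
    gcongr
    rw [← ENNReal.ofReal_pow (by positivity)]
    refine ENNReal.ofReal_le_ofReal ?_
    calc (1 + δ * (t / N)) ^ N ≤ (Real.exp (δ * (t / N))) ^ N := by
          gcongr
          linarith [Real.add_one_le_exp (δ * (t / N))]
      _ = Real.exp (δ * t) := by
          rw [← Real.exp_nat_mul]
          congr 1
          field_simp
  have hlim : Tendsto (fun δ : ℝ => ENNReal.ofReal (Real.exp (δ * t)) *
      ∫⁻ x in A, ENNReal.ofReal (ρ x) ∂μ) (𝓝[>] 0)
      (𝓝 (1 * ∫⁻ x in A, ENNReal.ofReal (ρ x) ∂μ)) := by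
    refine ENNReal.Tendsto.mul_const ?_ (Or.inl one_ne_zero)
    have : Continuous fun δ : ℝ => ENNReal.ofReal (Real.exp (δ * t)) :=
      ENNReal.continuous_ofReal.comp (by fun_prop)
    have h1 := this.tendsto 0
    rw [zero_mul, Real.exp_zero, ENNReal.ofReal_one] at h1
    exact h1.mono_left nhdsWithin_le_nhds
  rw [one_mul] at hlim
  exact ge_of_tendsto hlim (eventually_mem_nhdsWithin.mono fun δ hδ => key δ hδ)

/-- The opposite inequality is the previous one for `-X`, which has the same invariant density and
carries the image back to `A`. -/
theorem lintegral_image_eq_of_flowsIn (H : IsInvariantDensity X ρ U) (hK : IsCompact K)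
    (hKU : K ⊆ U) {t : ℝ} (ht : 0 ≤ t) {A : Set E} (hA : MeasurableSet A) {f : E → E}
    (hf : ∀ x ∈ A, FlowsIn X K t x (f x)) : MeasurableSet (f '' A) ∧
    ∫⁻ x in f '' A, ENNReal.ofReal (ρ x) ∂μ = ∫⁻ x in A, ENNReal.ofReal (ρ x) ∂μ := by
  obtain ⟨L, hL⟩ := exists_lipschitzOnWith_of_contDiffOn H.isOpen
    (H.contDiffOn_field.of_le one_le_two) hK hKU
  have hm := measurableSet_image_of_flowsIn hL ht hA hf
  refine ⟨hm, (lintegral_image_le_of_flowsIn μ H hK hKU ht hA hf).antisymm ?_⟩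
  have hg : ∀ y, ∃ x, y ∈ f '' A → x ∈ A ∧ f x = y := by
    intro y
    by_cases hy : y ∈ f '' A
    · obtain ⟨x, hx⟩ := hy
      exact ⟨x, fun _ => hx⟩
    · exact ⟨y, fun h => absurd h hy⟩
  choose g hg using hg
  have hgf : g '' (f '' A) = A := by
    rw [image_image]
    refine (image_congr fun x hx => ?_).trans (image_id A)
    have h1 := hg (f x) (mem_image_of_mem f hx)
    have h2 := hf _ h1.1
    rw [h1.2] at h2
    exact h2.left_unique hL ht (hf x hx)
  have := lintegral_image_le_of_flowsIn μ H.neg hK hKU ht hm (f := g) fun y hy => by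
    have h1 := hg y hy
    have h2 := hf _ h1.1
    rw [h1.2] at h2
    exact h2.reverse
  rwa [hgf] at this

/-- **Liouville's theorem** for the local flow of a vector field. -/
theorem lintegral_image_eq_of_isInvariantDensity (H : IsInvariantDensity X ρ U) {t : ℝ}
    (ht : 0 ≤ t) {B : Set E} (hB : MeasurableSet B) {f : E → E}
    (hf : ∀ x ∈ B, FlowsIn X U t x (f x)) : MeasurableSet (f '' B) ∧
    ∫⁻ x in f '' B, ENNReal.ofReal (ρ x) ∂μ = ∫⁻ x in B, ENNReal.ofReal (ρ x) ∂μ := by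
  have : ProperSpace E := FiniteDimensional.proper ℝ E
  obtain ⟨K, hKmono, hKc, hKU, hKex⟩ := exists_compact_exhaustion H.isOpen
  set P : ℕ → Set E := fun k => {x ∈ B | FlowsIn X (K k) t x (f x)} with hP
  have hlift : ∀ x ∈ B, ∃ k, FlowsIn X (K k) t x (f x) := by
    intro x hx
    obtain ⟨c, hc, h0, h1⟩ := hf x hx
    obtain ⟨k, hk⟩ := hKex (c '' Icc 0 t) (isCompact_Icc.image_of_continuousOn fun s hs =>
      (hc s hs).2.continuousWithinAt) (by rintro _ ⟨s, hs, rfl⟩; exact (hc s hs).1)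
    exact ⟨k, c, fun s hs => ⟨hk (mem_image_of_mem c hs), (hc s hs).2⟩, h0, h1⟩
  have hPmono : Monotone P := fun i j hij x hx => ⟨hx.1, hx.2.mono (hKmono hij)⟩
  have hBP : B = ⋃ k, P k := by
    refine Subset.antisymm (fun x hx => ?_) (iUnion_subset fun k x hx => hx.1)
    obtain ⟨k, hk⟩ := hlift x hx
    exact mem_iUnion.2 ⟨k, hx, hk⟩
  -- This gives measurability of `P k`. If points of `P k` approach `x`, their trajectories approach
  -- that of `x` uniformly on `[0, t]`, which therefore stays in the closed set `K k`. The
  -- comparison takes place in the larger compact set `K l`, which contains the trajectories of both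
  -- kinds.
  have hPclosed : ∀ k, P k = B ∩ closure (P k) := by
    intro k
    refine Subset.antisymm (fun x hx => ⟨hx.1, subset_closure hx⟩) ?_
    rintro x ⟨hxB, hxcl⟩
    refine ⟨hxB, ?_⟩
    obtain ⟨j, hj⟩ := hlift x hxB
    set l := max k j
    obtain ⟨L, hL⟩ := exists_lipschitzOnWith_of_contDiffOn H.isOpen
      (H.contDiffOn_field.of_le one_le_two) (hKc l) (hKU l)
    obtain ⟨c, hc, hc0, hc1⟩ := hj.mono (hKmono (le_max_right k j))
    refine ⟨c, fun s hs => ⟨?_, (hc s hs).2⟩, hc0, hc1⟩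
    rw [← (hKc k).isClosed.closure_eq, Metric.mem_closure_iff]
    intro e he
    obtain ⟨y, hy, hxy⟩ := Metric.mem_closure_iff.1 hxcl (e / Real.exp (L * s)) (by positivity)
    obtain ⟨d, hd, hd0, hd1⟩ := hy.2
    refine ⟨d s, (hd s hs).1, ?_⟩
    have := dist_le_of_integralCurves hL hc
      (fun r hr => ⟨hKmono (le_max_left k j) (hd r hr).1, (hd r hr).2⟩) s hs
    rw [hc0, hd0] at this
    rw [lt_div_iff₀ (Real.exp_pos _)] at hxy
    exact this.trans_lt hxy
  have hPm : ∀ k, MeasurableSet (P k) := fun k => by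
    rw [hPclosed k]
    exact hB.inter isClosed_closure.measurableSet
  have hstep : ∀ k, MeasurableSet (f '' P k) ∧
      ∫⁻ x in f '' P k, ENNReal.ofReal (ρ x) ∂μ = ∫⁻ x in P k, ENNReal.ofReal (ρ x) ∂μ :=
    fun k => lintegral_image_eq_of_flowsIn μ H (hKc k) (hKU k) ht (hPm k) fun x hx => hx.2
  have hfB : f '' B = ⋃ k, f '' P k := by rw [hBP, image_iUnion]
  refine ⟨hfB ▸ MeasurableSet.iUnion fun k => (hstep k).1, ?_⟩
  -- Both sides become measures of increasing unions, to which continuity from below applies.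
  simp_rw [← withDensity_apply' _ (_ : Set E)] at hstep ⊢
  have hfmono : Monotone fun k => f '' P k := fun i j hij => image_mono (hPmono hij)
  rw [hfB, hfmono.measure_iUnion]
  conv_rhs => rw [hBP, hPmono.measure_iUnion]
  exact iSup_congr fun k => (hstep k).2

end Liouville

namespace RubberRolling

variable {n : ℕ}

/-! ### Coordinates on `so(n)` -/

section Coordinates

theorem transpose_coe (X : SO n) : (X : Matrix (Fin n) (Fin n) ℝ)ᵀ = -X :=
  (LieAlgebra.Orthogonal.mem_so _ _ _).1 X.2

theorem apply_swap (X : SO n) (i j : Fin n) :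
    (X : Matrix (Fin n) (Fin n) ℝ) i j = -(X : Matrix (Fin n) (Fin n) ℝ) j i :=
  congrFun (congrFun (transpose_coe X) j) i

theorem ext_of_lt {X Y : SO n} (h : ∀ i j, i < j →
    (X : Matrix (Fin n) (Fin n) ℝ) i j = (Y : Matrix (Fin n) (Fin n) ℝ) i j) : X = Y := by
  apply Subtype.ext
  ext i j
  rcases lt_trichotomy i j with hij | rfl | hij
  · exact h i j hij
  · linarith [apply_swap X i i, apply_swap Y i i]
  · rw [apply_swap X, apply_swap Y, h j i hij]

/-- Index set of the entries above the diagonal. -/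
abbrev Upper (n : ℕ) : Type := {p : Fin n × Fin n // p.1 < p.2}

theorem coe_sum {ι : Type*} (s : Finset ι) (f : ι → SO n) :
    ((∑ p ∈ s, f p : SO n) : Matrix (Fin n) (Fin n) ℝ) =
      ∑ p ∈ s, (f p : Matrix (Fin n) (Fin n) ℝ) := by
  classical
  induction s using Finset.induction_on with
  | empty => rfl
  | insert p s hp ih =>
    rw [Finset.sum_insert hp, Finset.sum_insert hp, ← ih]
    rfl

theorem ofCoords_apply (q : Upper n → ℝ) {i j : Fin n} (h : i < j) :
    (ofCoords n q : Matrix (Fin n) (Fin n) ℝ) i j = q ⟨(i, j), h⟩ := by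
  rw [ofCoords, coe_sum, Matrix.sum_apply, Finset.sum_eq_single ⟨(i, j), h⟩]
  · change q _ * (wedge (E i) (E j) : Matrix (Fin n) (Fin n) ℝ) i j = _
    simp [wedge_apply, E, h.ne, h.ne']
  · rintro ⟨⟨k, l⟩, hkl⟩ - hne
    change q _ * (wedge (E k) (E l) : Matrix (Fin n) (Fin n) ℝ) i j = 0
    have h1 : ¬ (i = k ∧ j = l) := by rintro ⟨rfl, rfl⟩; exact hne rfl
    have h2 : ¬ (i = l ∧ j = k) := by rintro ⟨rfl, rfl⟩; exact absurd h hkl.not_gt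
    simp only [wedge_apply, E, Pi.single_apply]
    by_cases hik : i = k <;> by_cases hjl : j = l <;> by_cases hil : i = l <;>
      by_cases hjk : j = k <;> simp_all
  · intro h
    exact absurd (Finset.mem_univ _) h

/-- The coordinates above the diagonal identify `so(n)` with a space of functions. -/
def coordEquiv (n : ℕ) : (Upper n → ℝ) ≃ₗ[ℝ] SO n where
  toFun := ofCoords n
  map_add' q r := by
    simp only [ofCoords, Pi.add_apply, add_smul, Finset.sum_add_distrib]
  map_smul' a q := by
    simp only [ofCoords, Pi.smul_apply, smul_eq_mul, mul_smul, Finset.smul_sum, RingHom.id_apply]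
  invFun X := fun p => (X : Matrix (Fin n) (Fin n) ℝ) p.1.1 p.1.2
  left_inv q := by
    funext p
    exact ofCoords_apply q p.2
  right_inv X := ext_of_lt fun i j h => ofCoords_apply _ h

theorem linearMap_ext_wedge {M : Type*} [AddCommGroup M] [Module ℝ M] {f g : SO n →ₗ[ℝ] M}
    (h : ∀ i j, f (wedge (E i) (E j)) = g (wedge (E i) (E j))) : f = g := by
  ext X
  obtain ⟨q, rfl⟩ := (coordEquiv n).surjective X
  change f (∑ p, q p • wedge (E p.1.1) (E p.1.2)) = g (∑ p, q p • wedge (E p.1.1) (E p.1.2))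
  simp only [map_sum, map_smul, h]

end Coordinates

/-! ### Wedge products, brackets and the scalar product -/

section Wedge

/-- The linear map `y ↦ y ∧ x`. -/
def wedgeL (x : Fin n → ℝ) : (Fin n → ℝ) →ₗ[ℝ] SO n where
  toFun y := wedge y x
  map_add' y z := by
    apply Subtype.ext; ext i j
    change (y i + z i) * x j - x i * (y j + z j) =
      (y i * x j - x i * y j) + (z i * x j - x i * z j)
    ring
  map_smul' r y := by
    apply Subtype.ext; ext i j
    change (r * y i) * x j - x i * (r * y j) = r * (y i * x j - x i * y j)
    ring

@[simp] theorem wedgeL_apply (x y : Fin n → ℝ) : wedgeL x y = wedge y x := rfl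

theorem wedge_swap (x y : Fin n → ℝ) : wedge x y = -wedge y x := by
  apply Subtype.ext; ext i j
  change x i * y j - y i * x j = -(y i * x j - x i * y j)
  ring

theorem wedge_add_right (x y z : Fin n → ℝ) : wedge x (y + z) = wedge x y + wedge x z := by
  rw [wedge_swap, ← wedgeL_apply, map_add, neg_add, wedgeL_apply, wedgeL_apply, ← wedge_swap,
    ← wedge_swap]

theorem wedge_smul_right (r : ℝ) (x y : Fin n → ℝ) : wedge x (r • y) = r • wedge x y := by
  rw [wedge_swap, ← wedgeL_apply, map_smul, wedgeL_apply, ← smul_neg, ← wedge_swap]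

theorem wedge_smul_left (r : ℝ) (x y : Fin n → ℝ) : wedge (r • x) y = r • wedge x y :=
  (wedgeL y).map_smul r x

theorem wedge_add_left (x y z : Fin n → ℝ) : wedge (x + y) z = wedge x z + wedge y z :=
  (wedgeL z).map_add x y

theorem wedge_sub_left (x y z : Fin n → ℝ) : wedge (x - y) z = wedge x z - wedge y z :=
  (wedgeL z).map_sub x y

theorem wedge_self (x : Fin n → ℝ) : wedge x x = 0 := by
  apply Subtype.ext; ext i j
  change x i * x j - x i * x j = 0
  ring

/-- The linear map `ξ ↦ ξ x`. -/
def applyAt (x : Fin n → ℝ) : SO n →ₗ[ℝ] (Fin n → ℝ) where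
  toFun ξ := (ξ : Matrix (Fin n) (Fin n) ℝ) *ᵥ x
  map_add' _ _ := Matrix.add_mulVec _ _ _
  map_smul' _ _ := Matrix.smul_mulVec _ _ _

@[simp] theorem applyAt_apply (x : Fin n → ℝ) (ξ : SO n) :
    applyAt x ξ = (ξ : Matrix (Fin n) (Fin n) ℝ) *ᵥ x := rfl

theorem applyAt_smul (x : Fin n → ℝ) (r : ℝ) (ξ : SO n) :
    applyAt (r • x) ξ = r • applyAt x ξ := by
  simp only [applyAt_apply, Matrix.mulVec_smul]

theorem applyAt_add (x y : Fin n → ℝ) (ξ : SO n) :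
    applyAt (x + y) ξ = applyAt x ξ + applyAt y ξ := by
  simp only [applyAt_apply, Matrix.mulVec_add]

theorem wedge_mulVec (y x z : Fin n → ℝ) :
    (wedge y x : Matrix (Fin n) (Fin n) ℝ) *ᵥ z = (x ⬝ᵥ z) • y - (y ⬝ᵥ z) • x := by
  change (Matrix.vecMulVec y x - Matrix.vecMulVec x y) *ᵥ z = _
  rw [Matrix.sub_mulVec, Matrix.vecMulVec_mulVec, Matrix.vecMulVec_mulVec]
  simp

theorem dotProduct_mulVec_comm (X : SO n) (y z : Fin n → ℝ) :
    y ⬝ᵥ ((X : Matrix (Fin n) (Fin n) ℝ) *ᵥ z) = -(z ⬝ᵥ ((X : Matrix (Fin n) (Fin n) ℝ) *ᵥ y)) := by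
  rw [Matrix.dotProduct_mulVec, ← Matrix.mulVec_transpose, transpose_coe, Matrix.neg_mulVec,
    neg_dotProduct, dotProduct_comm]

theorem dotProduct_mulVec_self (X : SO n) (y : Fin n → ℝ) :
    y ⬝ᵥ ((X : Matrix (Fin n) (Fin n) ℝ) *ᵥ y) = 0 := by
  linarith [dotProduct_mulVec_comm X y y]

theorem ip_wedge (X : SO n) (y x : Fin n → ℝ) :
    ip X (wedge y x) = y ⬝ᵥ ((X : Matrix (Fin n) (Fin n) ℝ) *ᵥ x) := by
  rw [ip]
  change -(1 / 2) * ((X : Matrix (Fin n) (Fin n) ℝ) *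
    (Matrix.vecMulVec y x - Matrix.vecMulVec x y)).trace = _
  rw [Matrix.mul_sub, Matrix.mul_vecMulVec, Matrix.mul_vecMulVec, Matrix.trace_sub,
    Matrix.trace_vecMulVec, Matrix.trace_vecMulVec, dotProduct_comm _ x,
    dotProduct_mulVec_comm X x y, dotProduct_comm _ y]
  ring

theorem coe_lie (X Y : SO n) : ((⁅X, Y⁆ : SO n) : Matrix (Fin n) (Fin n) ℝ) =
    (X : Matrix (Fin n) (Fin n) ℝ) * Y - Y * X := rfl

theorem lie_mulVec (X Y : SO n) (x : Fin n → ℝ) :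
    ((⁅X, Y⁆ : SO n) : Matrix (Fin n) (Fin n) ℝ) *ᵥ x =
      (X : Matrix (Fin n) (Fin n) ℝ) *ᵥ ((Y : Matrix (Fin n) (Fin n) ℝ) *ᵥ x) -
      (Y : Matrix (Fin n) (Fin n) ℝ) *ᵥ ((X : Matrix (Fin n) (Fin n) ℝ) *ᵥ x) := by
  rw [coe_lie, Matrix.sub_mulVec, Matrix.mulVec_mulVec, Matrix.mulVec_mulVec]

theorem wedge_lie (y x : Fin n → ℝ) (ω : SO n) : ⁅wedge y x, ω⁆ =
    -wedge ((ω : Matrix (Fin n) (Fin n) ℝ) *ᵥ y) x -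
      wedge y ((ω : Matrix (Fin n) (Fin n) ℝ) *ᵥ x) := by
  apply Subtype.ext
  have h : ∀ z : Fin n → ℝ, z ᵥ* (ω : Matrix (Fin n) (Fin n) ℝ) =
      -((ω : Matrix (Fin n) (Fin n) ℝ) *ᵥ z) := fun z => by
    rw [← Matrix.mulVec_transpose, transpose_coe, Matrix.neg_mulVec]
  rw [coe_lie]
  change (Matrix.vecMulVec y x - Matrix.vecMulVec x y) * _ -
    _ * (Matrix.vecMulVec y x - Matrix.vecMulVec x y) =
    -(Matrix.vecMulVec _ x - Matrix.vecMulVec x _) - (Matrix.vecMulVec y _ - Matrix.vecMulVec _ y)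
  rw [Matrix.sub_mul, Matrix.mul_sub, Matrix.vecMulVec_mul, Matrix.vecMulVec_mul,
    Matrix.mul_vecMulVec, Matrix.mul_vecMulVec, h, h, Matrix.vecMulVec_neg, Matrix.vecMulVec_neg]
  abel

end Wedge

/-! ### The Gram matrix and the trace identity -/

section Gram

/-- The operator `y ↦ (I (y ∧ x)) x + (x, y) x` of `ℝⁿ`. -/
def gramMap (I : SO n →ₗ[ℝ] SO n) (x : Fin n → ℝ) : (Fin n → ℝ) →ₗ[ℝ] (Fin n → ℝ) :=
  applyAt x ∘ₗ I ∘ₗ wedgeL x + Matrix.toLin' (Matrix.vecMulVec x x)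

/-- The matrix of `gramMap I x`. -/
def gram (I : SO n →ₗ[ℝ] SO n) (x : Fin n → ℝ) : Matrix (Fin n) (Fin n) ℝ :=
  LinearMap.toMatrix' (gramMap I x)

variable {I : SO n →ₗ[ℝ] SO n} {x : Fin n → ℝ}

theorem gram_mulVec (I : SO n →ₗ[ℝ] SO n) (x y : Fin n → ℝ) : gram I x *ᵥ y =
    (I (wedge y x) : Matrix (Fin n) (Fin n) ℝ) *ᵥ x + (x ⬝ᵥ y) • x := by
  rw [gram, LinearMap.toMatrix'_mulVec]
  simp [gramMap, Matrix.vecMulVec_mulVec]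

theorem gram_mulVec_self (I : SO n →ₗ[ℝ] SO n) (x : Fin n → ℝ) :
    gram I x *ᵥ x = (x ⬝ᵥ x) • x := by
  rw [gram_mulVec, wedge_self, map_zero]
  simp

theorem dotProduct_gram_mulVec (I : SO n →ₗ[ℝ] SO n) (x y z : Fin n → ℝ) :
    z ⬝ᵥ (gram I x *ᵥ y) = ip (I (wedge y x)) (wedge z x) + (x ⬝ᵥ y) * (x ⬝ᵥ z) := by
  rw [gram_mulVec, dotProduct_add, dotProduct_smul, ip_wedge, smul_eq_mul, dotProduct_comm z x]

theorem ip_comm (X Y : SO n) : ip X Y = ip Y X := by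
  rw [ip, ip, Matrix.trace_mul_comm]

theorem gram_transpose (hI : IsInertia I) (x : Fin n → ℝ) : (gram I x)ᵀ = gram I x := by
  refine Matrix.ext_of_mulVec_single fun j => ?_
  refine dotProduct_eq _ _ fun z => ?_
  rw [dotProduct_comm, dotProduct_comm _ z, Matrix.mulVec_transpose, dotProduct_comm,
    ← Matrix.dotProduct_mulVec, dotProduct_gram_mulVec, dotProduct_gram_mulVec, hI.symm, ip_comm]
  ring

theorem eq_zero_of_wedge_eq_zero {x y : Fin n → ℝ} (hx : x ⬝ᵥ x ≠ 0) (h : wedge y x = 0)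
    (hxy : x ⬝ᵥ y = 0) : y = 0 := by
  have h1 := wedge_mulVec y x x
  rw [h, dotProduct_comm y x, hxy, zero_smul, sub_zero] at h1
  have h2 : (x ⬝ᵥ x) • y = 0 := by
    rw [← h1]
    exact Matrix.zero_mulVec x
  exact (smul_eq_zero.1 h2).resolve_left hx

theorem ip_nonneg (hI : IsInertia I) (X : SO n) : 0 ≤ ip (I X) X := by
  by_cases h : X = 0
  · simp [h, ip]
  · exact (hI.pos X h).le

/-- The form `ip (I (y ∧ x)) (y ∧ x)` degenerates only along `x`, where the rank-one term `(x, y)²`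
is positive. -/
theorem gram_posDef (hI : IsInertia I) (hx : x ⬝ᵥ x ≠ 0) : (gram I x).PosDef := by
  refine Matrix.PosDef.of_dotProduct_mulVec_pos ?_ fun y hy => ?_
  · rw [Matrix.IsHermitian, Matrix.conjTranspose_eq_transpose_of_trivial]
    exact gram_transpose hI x
  · rw [star_trivial, dotProduct_gram_mulVec]
    have h1 := ip_nonneg hI (wedge y x)
    by_cases hw : wedge y x = 0
    · have : x ⬝ᵥ y ≠ 0 := fun h => hy (eq_zero_of_wedge_eq_zero hx hw h)
      have := mul_self_pos.2 this
      linarith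
    · have := hI.pos _ hw
      nlinarith [mul_self_nonneg (x ⬝ᵥ y)]

theorem gram_det_pos (hI : IsInertia I) (hx : x ⬝ᵥ x ≠ 0) : 0 < (gram I x).det :=
  (gram_posDef hI hx).det_pos

theorem isUnit_gram_det (hI : IsInertia I) (hx : x ⬝ᵥ x ≠ 0) : IsUnit (gram I x).det :=
  (gram_det_pos hI hx).ne'.isUnit

theorem gram_inv_transpose (hI : IsInertia I) (x : Fin n → ℝ) :
    ((gram I x)⁻¹)ᵀ = (gram I x)⁻¹ := by
  rw [Matrix.transpose_nonsing_inv, gram_transpose hI]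

theorem gram_mulVec_inv_mulVec (hI : IsInertia I) (hx : x ⬝ᵥ x ≠ 0) (y : Fin n → ℝ) :
    gram I x *ᵥ ((gram I x)⁻¹ *ᵥ y) = y := by
  rw [Matrix.mulVec_mulVec, Matrix.mul_nonsing_inv _ (isUnit_gram_det hI hx), Matrix.one_mulVec]

theorem gram_inv_mulVec_self (hI : IsInertia I) (hx : x ⬝ᵥ x ≠ 0) :
    (gram I x)⁻¹ *ᵥ x = (x ⬝ᵥ x)⁻¹ • x := by
  have h : gram I x *ᵥ ((x ⬝ᵥ x)⁻¹ • x) = x := by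
    rw [Matrix.mulVec_smul, gram_mulVec_self, inv_smul_smul₀ hx]
  have h' := congrArg ((gram I x)⁻¹ *ᵥ ·) h
  simp only [Matrix.mulVec_mulVec] at h'
  rw [Matrix.nonsing_inv_mul _ (isUnit_gram_det hI hx), Matrix.one_mulVec] at h'
  exact h'.symm

theorem gram_smul (I : SO n →ₗ[ℝ] SO n) (r : ℝ) (x : Fin n → ℝ) :
    gram I (r • x) = r ^ 2 • gram I x := by
  refine Matrix.ext_of_mulVec_single fun j => ?_
  rw [Matrix.smul_mulVec, gram_mulVec, gram_mulVec, wedge_smul_right, map_smul]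
  change applyAt (r • x) (r • _) + _ = _
  rw [applyAt_smul, map_smul, applyAt_apply, smul_dotProduct, smul_add, smul_smul, smul_smul,
    smul_smul, smul_eq_mul, pow_two]
  congr 2
  ring

/-- `x` is an eigenvector of the Gram matrix, so its inverse maps `x` to a multiple of `x`,
orthogonal to `u`. -/
theorem trace_inv_mul_vecMulVec_left (hI : IsInertia I) (hx : x ⬝ᵥ x ≠ 0) {u : Fin n → ℝ}
    (hu : x ⬝ᵥ u = 0) : ((gram I x)⁻¹ * Matrix.vecMulVec x u).trace = 0 := by
  rw [Matrix.mul_vecMulVec, Matrix.trace_vecMulVec, gram_inv_mulVec_self hI hx, smul_dotProduct,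
    hu, smul_zero]

theorem trace_inv_mul_vecMulVec_right (hI : IsInertia I) (hx : x ⬝ᵥ x ≠ 0) {u : Fin n → ℝ}
    (hu : x ⬝ᵥ u = 0) : ((gram I x)⁻¹ * Matrix.vecMulVec u x).trace = 0 := by
  rw [← Matrix.trace_transpose, Matrix.transpose_mul, Matrix.transpose_vecMulVec,
    gram_inv_transpose hI, Matrix.trace_mul_comm]
  exact trace_inv_mul_vecMulVec_left hI hx hu

theorem trace_mul_eq_zero_of_skew {S : Matrix (Fin n) (Fin n) ℝ} (hS : Sᵀ = S) (W : SO n) :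
    (S * (W : Matrix (Fin n) (Fin n) ℝ)).trace = 0 := by
  have h : (S * (W : Matrix (Fin n) (Fin n) ℝ)).trace =
      -(S * (W : Matrix (Fin n) (Fin n) ℝ)).trace := by
    conv_lhs => rw [← Matrix.trace_transpose, Matrix.transpose_mul, hS, transpose_coe,
      Matrix.neg_mul, Matrix.trace_neg, Matrix.trace_mul_comm]
  linarith

/-- The matrix of `y ↦ (I (y ∧ x)) u`. -/
def mixed (I : SO n →ₗ[ℝ] SO n) (x u : Fin n → ℝ) : Matrix (Fin n) (Fin n) ℝ :=
  LinearMap.toMatrix' (applyAt u ∘ₗ I ∘ₗ wedgeL x)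

theorem mixed_mulVec (I : SO n →ₗ[ℝ] SO n) (x u y : Fin n → ℝ) : mixed I x u *ᵥ y =
    (I (wedge y x) : Matrix (Fin n) (Fin n) ℝ) *ᵥ u := by
  rw [mixed, LinearMap.toMatrix'_mulVec]
  rfl

/-- Against a symmetric matrix, the two mixed terms of `gramDeriv` thus have equal traces; this is
the source of the factor `1/2` in the divergence. -/
theorem mixed_transpose (hI : IsInertia I) (x u : Fin n → ℝ) :
    (mixed I x u)ᵀ = mixed I u x := by
  refine Matrix.ext_of_mulVec_single fun j => ?_
  refine dotProduct_eq _ _ fun z => ?_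
  rw [dotProduct_comm, dotProduct_comm _ z, Matrix.mulVec_transpose, dotProduct_comm,
    ← Matrix.dotProduct_mulVec, mixed_mulVec, mixed_mulVec, ← ip_wedge, ← ip_wedge, hI.symm,
    ip_comm]

/-- The derivative of `gram I` at `x` in the direction `u`. -/
def gramDeriv (I : SO n →ₗ[ℝ] SO n) (x u : Fin n → ℝ) : Matrix (Fin n) (Fin n) ℝ :=
  mixed I x u + mixed I u x + (Matrix.vecMulVec x u + Matrix.vecMulVec u x)

theorem gram_add_smul (I : SO n →ₗ[ℝ] SO n) (x u : Fin n → ℝ) (r : ℝ) :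
    gram I (x + r • u) = gram I x + r • gramDeriv I x u + r ^ 2 • gram I u := by
  refine Matrix.ext_of_mulVec_single fun j => ?_
  simp only [Matrix.add_mulVec, Matrix.smul_mulVec, gramDeriv, gram_mulVec, mixed_mulVec,
    Matrix.vecMulVec_mulVec, wedge_add_right, wedge_smul_right, map_add, map_smul]
  simp only [← applyAt_apply]
  simp only [applyAt_add, applyAt_smul, map_add, map_smul, add_dotProduct, smul_dotProduct,
    smul_eq_mul]
  simp only [smul_add, smul_smul, add_smul, op_smul_eq_smul]
  rw [pow_two]
  module

theorem gramDeriv_smul (I : SO n →ₗ[ℝ] SO n) (x u : Fin n → ℝ) (r : ℝ) :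
    gramDeriv I x (r • u) = r • gramDeriv I x u := by
  refine Matrix.ext_of_mulVec_single fun j => ?_
  simp only [Matrix.add_mulVec, Matrix.smul_mulVec, gramDeriv, mixed_mulVec,
    Matrix.vecMulVec_mulVec, wedge_smul_right, map_smul]
  simp only [← applyAt_apply]
  simp only [applyAt_smul, map_smul, smul_add, smul_smul, smul_dotProduct, smul_eq_mul, op_smul_eq_smul]
  module

/-- The operator `y ↦ ([I (y ∧ x), ω] + [I ω, y ∧ x]) x` of `ℝⁿ`. -/
def fieldMap (I : SO n →ₗ[ℝ] SO n) (ω : SO n) (x : Fin n → ℝ) :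
    (Fin n → ℝ) →ₗ[ℝ] (Fin n → ℝ) where
  toFun y := applyAt x (⁅I (wedge y x), ω⁆ + ⁅I ω, wedge y x⁆)
  map_add' y z := by
    simp only [wedge_add_left, map_add, add_lie, lie_add]
    abel
  map_smul' r y := by
    simp only [wedge_smul_left, map_smul, smul_lie, lie_smul, map_add, smul_add, RingHom.id_apply]

/-- The algebraic identity behind the vanishing of the divergence. -/
theorem trace_inv_mul_fieldMap (hI : IsInertia I) (hx : x ⬝ᵥ x ≠ 0) (ω : SO n) :
    ((gram I x)⁻¹ * LinearMap.toMatrix' (fieldMap I ω x)).trace =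
      1 / 2 * ((gram I x)⁻¹ *
        gramDeriv I x ((ω : Matrix (Fin n) (Fin n) ℝ) *ᵥ x)).trace := by
  set S := (gram I x)⁻¹ with hS
  set u := (ω : Matrix (Fin n) (Fin n) ℝ) *ᵥ x with hu
  set w := (I ω : Matrix (Fin n) (Fin n) ℝ) *ᵥ x with hw
  have hSt : Sᵀ = S := gram_inv_transpose hI x
  have hxu : x ⬝ᵥ u = 0 := dotProduct_mulVec_self ω x
  have hxw : x ⬝ᵥ w = 0 := dotProduct_mulVec_self (I ω) x
  -- After multiplication by `S` only `mixed I x u` contributes to the trace: `ω * gram I x` leaves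
  -- the trace of the skew `ω`, `I ω` is skew against the symmetric `S`, and each rank-one term
  -- pairs `x` with a vector orthogonal to it.
  have hQ : LinearMap.toMatrix' (fieldMap I ω x) =
      mixed I x u - (ω : Matrix (Fin n) (Fin n) ℝ) * gram I x + Matrix.vecMulVec u x +
        (x ⬝ᵥ x) • (I ω : Matrix (Fin n) (Fin n) ℝ) - Matrix.vecMulVec w x +
        Matrix.vecMulVec x w := by
    refine Matrix.ext_of_mulVec_single fun j => ?_
    set y : Fin n → ℝ := Pi.single j 1
    simp only [Matrix.add_mulVec, Matrix.sub_mulVec, Matrix.smul_mulVec, mixed_mulVec,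
      ← Matrix.mulVec_mulVec, gram_mulVec, Matrix.vecMulVec_mulVec, LinearMap.toMatrix'_mulVec,
      op_smul_eq_smul, Matrix.mulVec_add, Matrix.mulVec_smul]
    change applyAt x (⁅I (wedge y x), ω⁆ + ⁅I ω, wedge y x⁆) = _
    rw [map_add, applyAt_apply, applyAt_apply, lie_mulVec, lie_mulVec, wedge_mulVec, wedge_mulVec,
      ← hu, ← hw, hxw, Matrix.mulVec_sub, Matrix.mulVec_smul, Matrix.mulVec_smul, ← hw,
      dotProduct_comm y x, dotProduct_comm y w]
    module
  have h1 : (S * mixed I u x).trace = (S * mixed I x u).trace := by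
    rw [← mixed_transpose hI x u, ← Matrix.trace_transpose, Matrix.transpose_mul, hSt,
      Matrix.transpose_transpose, Matrix.trace_mul_comm]
  have h2 : (S * ((ω : Matrix (Fin n) (Fin n) ℝ) * gram I x)).trace = 0 := by
    rw [Matrix.trace_mul_comm, Matrix.mul_assoc, Matrix.mul_nonsing_inv _ (isUnit_gram_det hI hx)]
    rw [Matrix.mul_one]
    have := trace_mul_eq_zero_of_skew (Matrix.transpose_one (n := Fin n) (α := ℝ)) ω
    rwa [Matrix.one_mul] at this
  rw [hQ, gramDeriv]
  simp only [Matrix.mul_add, Matrix.mul_sub, Matrix.mul_smul, Matrix.trace_add, Matrix.trace_sub,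
    Matrix.trace_smul, h1, h2, trace_mul_eq_zero_of_skew hSt]
  rw [trace_inv_mul_vecMulVec_left hI hx hxu, trace_inv_mul_vecMulVec_right hI hx hxu,
    trace_inv_mul_vecMulVec_left hI hx hxw, trace_inv_mul_vecMulVec_right hI hx hxw, smul_zero]
  ring

end Gram

end RubberRolling

/-! ### Momentum and angular velocity over a point of the sphere -/

namespace RubberRolling

variable {n : ℕ}

/-- Sylvester's determinant identity, which compares operators on `so(n)`, on `𝔳_γ` and on `ℝⁿ`. -/
theorem det_id_add_comp_comm {M N : Type*} [AddCommGroup M] [Module ℝ M] [AddCommGroup N]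
    [Module ℝ N] [FiniteDimensional ℝ M] [FiniteDimensional ℝ N] (f : N →ₗ[ℝ] M)
    (g : M →ₗ[ℝ] N) :
    LinearMap.det (LinearMap.id + f ∘ₗ g) = LinearMap.det (LinearMap.id + g ∘ₗ f) := by
  classical
  let b := Module.finBasis ℝ M
  let c := Module.finBasis ℝ N
  rw [← LinearMap.det_toMatrix b, ← LinearMap.det_toMatrix c, map_add, map_add,
    LinearMap.toMatrix_comp b c b, LinearMap.toMatrix_comp c b c, LinearMap.toMatrix_id,
    LinearMap.toMatrix_id, Matrix.det_one_add_mul_comm]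

theorem isInertia_modInertia {J : SO n →ₗ[ℝ] SO n} (hJ : IsInertia J) {D : ℝ} (hD : 0 < D) :
    IsInertia (modInertia J D) := by
  have hadd : ∀ X Y Z : SO n, ip (X + Y) Z = ip X Z + ip Y Z := fun X Y Z => by
    change -(1 / 2) * ((X.1 + Y.1) * Z.1).trace = _
    rw [Matrix.add_mul, Matrix.trace_add, ip, ip]
    ring
  have hsmul : ∀ (r : ℝ) (X Y : SO n), ip (r • X) Y = r * ip X Y := fun r X Y => by
    change -(1 / 2) * ((r • X.1) * Y.1).trace = _
    rw [Matrix.smul_mul, Matrix.trace_smul, ip, smul_eq_mul]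
    ring
  have hexp : ∀ X Y : SO n, ip (modInertia J D X) Y = ip (J X) Y + D * ip X Y := fun X Y => by
    rw [← hsmul, ← hadd]
    rfl
  refine ⟨fun X Y => ?_, fun X hX => ?_⟩
  · rw [hexp, ip_comm X (modInertia J D Y), hexp, hJ.symm, ip_comm X Y, ip_comm X (J Y)]
  · have hself : ip X X = 1 / 2 * ∑ i, ∑ j, (X : Matrix (Fin n) (Fin n) ℝ) i j ^ 2 := by
      have : (X : Matrix (Fin n) (Fin n) ℝ) * X =
          -((X : Matrix (Fin n) (Fin n) ℝ) * (X : Matrix (Fin n) (Fin n) ℝ)ᵀ) := by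
        rw [transpose_coe, Matrix.mul_neg, neg_neg]
      rw [ip, this, Matrix.trace_neg, Matrix.trace]
      simp [Matrix.mul_apply, pow_two]
    rw [hexp]
    have h1 := hJ.pos X hX
    have h2 : 0 ≤ ip X X := by
      rw [hself]
      positivity
    positivity

theorem vec_dotProduct_vec (γ : Sph n) : vec γ ⬝ᵥ vec γ = 1 := by
  have h := γ.2
  rw [mem_sphere_zero_iff_norm] at h
  have h2 := EuclideanSpace.real_norm_sq_eq (γ : EuclideanSpace ℝ (Fin n))
  rw [h] at h2
  simp only [dotProduct, vec]
  rw [one_pow] at h2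
  refine Eq.trans ?_ h2.symm
  simp only [pow_two]

theorem vec_dotProduct_vec_ne_zero (γ : Sph n) : vec γ ⬝ᵥ vec γ ≠ 0 := by
  rw [vec_dotProduct_vec]
  exact one_ne_zero

/-- The linear map `ω ↦ pr_{𝔳_γ} (I ω) + pr_{𝔥_γ} ω`. -/
def momentumMap (I : SO n →ₗ[ℝ] SO n) (γ : Sph n) : SO n →ₗ[ℝ] SO n :=
  prV γ ∘ₗ I + prH γ

theorem momentumMap_apply (I : SO n →ₗ[ℝ] SO n) (γ : Sph n) (ω : SO n) :
    momentumMap I γ ω = momentum I γ ω := rfl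

theorem prV_apply (γ : Sph n) (ξ : SO n) :
    prV γ ξ = wedge ((ξ : Matrix (Fin n) (Fin n) ℝ) *ᵥ vec γ) (vec γ) := rfl

theorem prH_apply (γ : Sph n) (ξ : SO n) : prH γ ξ = ξ - prV γ ξ := rfl

theorem wedge_vec_mulVec_vec (γ : Sph n) (y : Fin n → ℝ) :
    (wedge y (vec γ) : Matrix (Fin n) (Fin n) ℝ) *ᵥ vec γ = y - (y ⬝ᵥ vec γ) • vec γ := by
  rw [wedge_mulVec, vec_dotProduct_vec, one_smul]

theorem prV_wedge (γ : Sph n) (y : Fin n → ℝ) : prV γ (wedge y (vec γ)) = wedge y (vec γ) := by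
  rw [prV_apply, wedge_vec_mulVec_vec, wedge_sub_left, wedge_smul_left, wedge_self, smul_zero,
    sub_zero]

theorem prV_eq_self_of_mem {γ : Sph n} {ξ : SO n} (hξ : ξ ∈ v γ) : prV γ ξ = ξ := by
  obtain ⟨y, rfl⟩ := hξ
  exact prV_wedge γ y

theorem det_momentumMap (I : SO n →ₗ[ℝ] SO n) (γ : Sph n) :
    LinearMap.det (momentumMap I γ) = LinearMap.det (restrictV I γ) := by
  let p : SO n →ₗ[ℝ] v γ := (prV γ).codRestrict (v γ) (prV_mem γ)
  have h1 : momentumMap I γ = LinearMap.id + (v γ).subtype ∘ₗ (p ∘ₗ (I - LinearMap.id)) := by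
    ext1 ξ
    change prV γ (I ξ) + (ξ - prV γ ξ) = ξ + prV γ (I ξ - ξ)
    rw [map_sub]
    abel
  have h2 : restrictV I γ = LinearMap.id + (p ∘ₗ (I - LinearMap.id)) ∘ₗ (v γ).subtype := by
    ext1 ξ
    apply Subtype.ext
    change prV γ (I ξ) = ξ + prV γ (I ξ - ξ)
    rw [map_sub, prV_eq_self_of_mem ξ.2]
    abel
  rw [h1, h2, det_id_add_comp_comm]

/-- For a unit vector, `pr_𝔳` factors through `ℝⁿ` as `ξ ↦ ξ γ` followed by `y ↦ y ∧ γ`. The term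
`(x, y) x` in `gramMap` makes the composition in the other order a perturbation of the identity. -/
theorem det_gram_vec (I : SO n →ₗ[ℝ] SO n) (γ : Sph n) :
    (gram I (vec γ)).det = LinearMap.det (restrictV I γ) := by
  rw [← det_momentumMap, gram, LinearMap.det_toMatrix']
  have h1 : momentumMap I γ =
      LinearMap.id + wedgeL (vec γ) ∘ₗ (applyAt (vec γ) ∘ₗ (I - LinearMap.id)) := by
    ext1 ξ
    change prV γ (I ξ) + (ξ - prV γ ξ) = ξ + prV γ (I ξ - ξ)
    rw [map_sub]
    abel
  have h2 : gramMap I (vec γ) =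
      LinearMap.id + (applyAt (vec γ) ∘ₗ (I - LinearMap.id)) ∘ₗ wedgeL (vec γ) := by
    refine LinearMap.ext fun y => ?_
    change applyAt (vec γ) (I (wedge y (vec γ))) + Matrix.vecMulVec (vec γ) (vec γ) *ᵥ y =
      y + applyAt (vec γ) (I (wedge y (vec γ)) - wedge y (vec γ))
    rw [map_sub, applyAt_apply _ (wedge y (vec γ)), wedge_vec_mulVec_vec, Matrix.vecMulVec_mulVec,
      op_smul_eq_smul, dotProduct_comm]
    abel
  rw [h1, h2, det_id_add_comp_comm]

theorem det_restrictV_pos {I : SO n →ₗ[ℝ] SO n} (hI : IsInertia I) (γ : Sph n) :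
    0 < LinearMap.det (restrictV I γ) := by
  rw [← det_gram_vec]
  exact gram_det_pos hI (vec_dotProduct_vec_ne_zero γ)

/-- The angular velocity with momentum `m` at the point `γ`. -/
noncomputable def velocity (I : SO n →ₗ[ℝ] SO n) (m : SO n) (x : Fin n → ℝ) : SO n :=
  m - wedge ((m : Matrix (Fin n) (Fin n) ℝ) *ᵥ x) x +
    wedge ((gram I x)⁻¹ *ᵥ
      applyAt x (m - I (m - wedge ((m : Matrix (Fin n) (Fin n) ℝ) *ᵥ x) x))) x

variable {I : SO n →ₗ[ℝ] SO n}

/-- In the splitting into `𝔥_γ`, where `a γ = 0`, and `𝔳_γ`, the momentum map is block triangular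
with the Gram matrix as its only nontrivial diagonal block. The formula `velocity` inverts it
accordingly. -/
theorem momentum_wedge_add (γ : Sph n) (a : SO n)
    (ha : (a : Matrix (Fin n) (Fin n) ℝ) *ᵥ vec γ = 0) (y : Fin n → ℝ) :
    momentum I γ (a + wedge y (vec γ)) =
      a + prV γ (I a) + wedge (gram I (vec γ) *ᵥ y) (vec γ) := by
  have h1 : prV γ a = 0 := by
    rw [prV_apply, ha]
    exact (wedgeL (vec γ)).map_zero
  rw [momentum, prH_apply, map_add, map_add, map_add, prV_wedge, h1, zero_add, add_sub_cancel_right,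
    gram_mulVec, wedge_add_left, wedge_smul_left, wedge_self, smul_zero, add_zero,
    prV_apply γ (I (wedge y (vec γ)))]
  abel

theorem momentum_velocity (hI : IsInertia I) (m : SO n) (γ : Sph n) :
    momentum I γ (velocity I m (vec γ)) = m := by
  have ha : ((m - wedge ((m : Matrix (Fin n) (Fin n) ℝ) *ᵥ vec γ) (vec γ) : SO n) :
      Matrix (Fin n) (Fin n) ℝ) *ᵥ vec γ = 0 := by
    change applyAt (vec γ) _ = 0
    rw [map_sub, applyAt_apply, applyAt_apply, wedge_vec_mulVec_vec, dotProduct_comm,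
      dotProduct_mulVec_self, zero_smul, sub_zero, sub_self]
  rw [velocity, momentum_wedge_add γ _ ha,
    gram_mulVec_inv_mulVec hI (vec_dotProduct_vec_ne_zero γ), ← prV_apply γ m, applyAt_apply,
    ← prV_apply, map_sub (prV γ) m]
  abel

theorem momentumMap_injective (hI : IsInertia I) (γ : Sph n) :
    Function.Injective (momentumMap I γ) := by
  rw [LinearMap.injective_iff_surjective]
  exact fun m => ⟨velocity I m (vec γ), momentum_velocity hI m γ⟩

theorem velocity_momentum (hI : IsInertia I) (ω : SO n) (γ : Sph n) :
    velocity I (momentum I γ ω) (vec γ) = ω :=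
  momentumMap_injective hI γ (momentum_velocity hI _ γ)

/-- The velocity `ω'` of the angular velocity. -/
noncomputable def field (I : SO n →ₗ[ℝ] SO n) (ω : SO n) (x : Fin n → ℝ) : SO n :=
  wedge ((gram I x)⁻¹ *ᵥ applyAt x ⁅I ω, ω⁆) x

theorem momentum_field (hI : IsInertia I) (ω : SO n) (γ : Sph n) :
    momentum I γ (field I ω (vec γ)) = prV γ ⁅I ω, ω⁆ := by
  have h := momentum_wedge_add (I := I) γ 0 (Matrix.zero_mulVec _)
    ((gram I (vec γ))⁻¹ *ᵥ applyAt (vec γ) ⁅I ω, ω⁆)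
  rw [zero_add, map_zero, map_zero, zero_add, zero_add,
    gram_mulVec_inv_mulVec hI (vec_dotProduct_vec_ne_zero γ)] at h
  exact h

/-- The equation of motion for the momentum, written in terms of the angular velocity. -/
theorem momentum_equation (I : SO n →ₗ[ℝ] SO n) (ε : ℝ) (ω : SO n) (γ : Sph n) :
    ε • ⁅momentum I γ ω, ω⁆ + (1 - ε) • prV γ ⁅I ω, ω⁆ =
      prV γ ⁅I ω, ω⁆ +
        (wedge (((I ω - ω : SO n) : Matrix (Fin n) (Fin n) ℝ) *ᵥ
          (-ε • (ω : Matrix (Fin n) (Fin n) ℝ) *ᵥ vec γ)) (vec γ) +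
        wedge (((I ω - ω : SO n) : Matrix (Fin n) (Fin n) ℝ) *ᵥ vec γ)
          (-ε • (ω : Matrix (Fin n) (Fin n) ℝ) *ᵥ vec γ)) := by
  -- Here `[I ω, ω] = [ζ, ω]` and `𝐦 = ω + (ζ γ) ∧ γ`. The bracket with `ω` acts on the wedge as a
  -- derivation, and the terms in `ε` form the derivative of `(ζ γ) ∧ γ` along `γ' = -ε ω γ` with
  -- `ω` frozen.
  set ζ := I ω - ω with hζ
  have h1 : ⁅I ω, ω⁆ = ⁅ζ, ω⁆ := by rw [hζ, sub_lie, lie_self, sub_zero]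
  have h2 : momentum I γ ω = ω + wedge ((ζ : Matrix (Fin n) (Fin n) ℝ) *ᵥ vec γ) (vec γ) := by
    rw [← prV_apply, hζ, map_sub, momentum, prH_apply]
    abel
  rw [h1, h2, add_lie, lie_self, zero_add, wedge_lie, prV_apply, lie_mulVec, wedge_sub_left,
    Matrix.mulVec_smul, wedge_smul_left, wedge_smul_right]
  module

end RubberRolling

namespace RubberRolling

variable {n : ℕ}

/-! ### Smooth dependence on the angular velocity and the vector -/

section Smooth

variable {F : Type*} [NormedAddCommGroup F] [NormedSpace ℝ F] {k : WithTop ℕ∞} {s : Set F}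

theorem contDiffOn_matrix_det {A : F → Matrix (Fin n) (Fin n) ℝ}
    (hA : ∀ i j, ContDiffOn ℝ k (fun p => A p i j) s) : ContDiffOn ℝ k (fun p => (A p).det) s := by
  simp only [Matrix.det_apply']
  exact ContDiffOn.sum fun σ _ => contDiffOn_const.mul (contDiffOn_prod fun i _ => hA _ _)

theorem contDiffOn_matrix_inv {A : F → Matrix (Fin n) (Fin n) ℝ}
    (hA : ∀ i j, ContDiffOn ℝ k (fun p => A p i j) s) (h0 : ∀ p ∈ s, (A p).det ≠ 0)
    (i j : Fin n) : ContDiffOn ℝ k (fun p => (A p)⁻¹ i j) s := by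
  have h : (fun p => (A p)⁻¹ i j) =
      fun p => (A p).det⁻¹ * ((A p).updateRow j (Pi.single i 1)).det := by
    funext p
    rw [Matrix.inv_def, Ring.inverse_eq_inv', Matrix.smul_apply, Matrix.adjugate_apply, smul_eq_mul]
  rw [h]
  refine ((contDiffOn_matrix_det hA).inv h0).mul (contDiffOn_matrix_det fun a b => ?_)
  simp only [Matrix.updateRow_apply]
  split_ifs
  · exact contDiffOn_const
  · exact hA a b

theorem contDiffOn_mulVec {A : F → Matrix (Fin n) (Fin n) ℝ} {y : F → Fin n → ℝ}
    (hA : ∀ i j, ContDiffOn ℝ k (fun p => A p i j) s) (hy : ∀ i, ContDiffOn ℝ k (fun p => y p i) s)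
    (i : Fin n) : ContDiffOn ℝ k (fun p => (A p *ᵥ y p) i) s := by
  simp only [Matrix.mulVec, dotProduct]
  exact ContDiffOn.sum fun j _ => (hA i j).mul (hy j)

theorem contDiffOn_wedge {y z : F → Fin n → ℝ}
    (hy : ∀ i, ContDiffOn ℝ k (fun p => y p i) s) (hz : ∀ i, ContDiffOn ℝ k (fun p => z p i) s)
    (i j : Fin n) :
    ContDiffOn ℝ k (fun p => (wedge (y p) (z p) : Matrix (Fin n) (Fin n) ℝ) i j) s := by
  simp only [wedge_apply]
  exact ((hy i).mul (hz j)).sub ((hz i).mul (hy j))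

theorem contDiffOn_lie {A B : F → SO n}
    (hA : ∀ i j, ContDiffOn ℝ k (fun p => (A p : Matrix (Fin n) (Fin n) ℝ) i j) s)
    (hB : ∀ i j, ContDiffOn ℝ k (fun p => (B p : Matrix (Fin n) (Fin n) ℝ) i j) s) (i j : Fin n) :
    ContDiffOn ℝ k (fun p => ((⁅A p, B p⁆ : SO n) : Matrix (Fin n) (Fin n) ℝ) i j) s := by
  simp only [coe_lie, Matrix.sub_apply, Matrix.mul_apply]
  exact (ContDiffOn.sum fun l _ => (hA i l).mul (hB l j)).sub
    (ContDiffOn.sum fun l _ => (hB i l).mul (hA l j))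

/-- The entries of a skew-symmetric matrix are linear functions. -/
def entry (i j : Fin n) : SO n →ₗ[ℝ] ℝ where
  toFun ξ := (ξ : Matrix (Fin n) (Fin n) ℝ) i j
  map_add' _ _ := rfl
  map_smul' _ _ := rfl

/-- A linear operator of `so(n)` preserves smoothness of the entries. -/
theorem contDiffOn_linearMap {A : F → SO n} (I : SO n →ₗ[ℝ] SO n)
    (hA : ∀ i j, ContDiffOn ℝ k (fun p => (A p : Matrix (Fin n) (Fin n) ℝ) i j) s) (i j : Fin n) :
    ContDiffOn ℝ k (fun p => (I (A p) : Matrix (Fin n) (Fin n) ℝ) i j) s := by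
  let ℓ : (Upper n → ℝ) →L[ℝ] ℝ := LinearMap.toContinuousLinearMap
    (entry i j ∘ₗ I ∘ₗ (coordEquiv n).toLinearMap)
  have h : (fun p => (I (A p) : Matrix (Fin n) (Fin n) ℝ) i j) =
      fun p => ℓ ((coordEquiv n).symm (A p)) := by
    funext p
    change _ = (I ((coordEquiv n) ((coordEquiv n).symm (A p))) : Matrix (Fin n) (Fin n) ℝ) i j
    rw [LinearEquiv.apply_symm_apply]
  rw [h]
  exact ℓ.contDiff.comp_contDiffOn (contDiffOn_pi.2 fun p => hA _ _)

theorem gram_apply (I : SO n →ₗ[ℝ] SO n) (x : Fin n → ℝ) (i j : Fin n) :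
    gram I x i j = ((I (wedge (Pi.single j 1) x) : Matrix (Fin n) (Fin n) ℝ) *ᵥ x) i +
      x j * x i := by
  have := congrFun (gram_mulVec I x (Pi.single j 1)) i
  simpa using this

theorem contDiffOn_gram (I : SO n →ₗ[ℝ] SO n) {y : F → Fin n → ℝ}
    (hy : ∀ i, ContDiffOn ℝ k (fun p => y p i) s) (i j : Fin n) :
    ContDiffOn ℝ k (fun p => gram I (y p) i j) s := by
  simp only [gram_apply]
  refine (contDiffOn_mulVec ?_ hy i).add ((hy j).mul (hy i))
  exact contDiffOn_linearMap I (contDiffOn_wedge (fun _ => contDiffOn_const) hy)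

variable {I : SO n →ₗ[ℝ] SO n}

theorem contDiffOn_gram_inv (hI : IsInertia I) {y : F → Fin n → ℝ}
    (hy : ∀ i, ContDiffOn ℝ k (fun p => y p i) s) (h0 : ∀ p ∈ s, y p ⬝ᵥ y p ≠ 0) (i j : Fin n) :
    ContDiffOn ℝ k (fun p => (gram I (y p))⁻¹ i j) s :=
  contDiffOn_matrix_inv (contDiffOn_gram I hy) (fun p hp => (gram_det_pos hI (h0 p hp)).ne') i j

theorem contDiffOn_field (hI : IsInertia I) {A : F → SO n} {y : F → Fin n → ℝ}
    (hA : ∀ i j, ContDiffOn ℝ k (fun p => (A p : Matrix (Fin n) (Fin n) ℝ) i j) s)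
    (hy : ∀ i, ContDiffOn ℝ k (fun p => y p i) s) (h0 : ∀ p ∈ s, y p ⬝ᵥ y p ≠ 0) (i j : Fin n) :
    ContDiffOn ℝ k (fun p => (field I (A p) (y p) : Matrix (Fin n) (Fin n) ℝ) i j) s :=
  contDiffOn_wedge (contDiffOn_mulVec (contDiffOn_gram_inv hI hy h0)
    (contDiffOn_mulVec (contDiffOn_lie (contDiffOn_linearMap I hA) hA) hy)) hy i j

theorem contDiffOn_velocity (hI : IsInertia I) {A : F → SO n} {y : F → Fin n → ℝ}
    (hA : ∀ i j, ContDiffOn ℝ k (fun p => (A p : Matrix (Fin n) (Fin n) ℝ) i j) s)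
    (hy : ∀ i, ContDiffOn ℝ k (fun p => y p i) s) (h0 : ∀ p ∈ s, y p ⬝ᵥ y p ≠ 0) (i j : Fin n) :
    ContDiffOn ℝ k (fun p => (velocity I (A p) (y p) : Matrix (Fin n) (Fin n) ℝ) i j) s := by
  have h1 : ∀ i j, ContDiffOn ℝ k (fun p => ((A p - wedge ((A p : Matrix (Fin n) (Fin n) ℝ) *ᵥ y p)
      (y p) : SO n) : Matrix (Fin n) (Fin n) ℝ) i j) s := fun i j =>
    (hA i j).sub (contDiffOn_wedge (contDiffOn_mulVec hA hy) hy i j)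
  have h2 : ∀ i j, ContDiffOn ℝ k (fun p => ((A p - I (A p - wedge
      ((A p : Matrix (Fin n) (Fin n) ℝ) *ᵥ y p) (y p)) : SO n) : Matrix (Fin n) (Fin n) ℝ) i j) s :=
    fun i j => (hA i j).sub (contDiffOn_linearMap I h1 i j)
  exact (h1 i j).add (contDiffOn_wedge (contDiffOn_mulVec (contDiffOn_gram_inv hI hy h0)
    (contDiffOn_mulVec h2 hy)) hy i j)

end Smooth

/-! ### Jacobi's formula and the trace on a product -/

section Jacobi

theorem hasDerivAt_quadratic {V : Type*} [NormedAddCommGroup V] [NormedSpace ℝ V] (a b c : V) :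
    HasDerivAt (fun r : ℝ => a + r • b + r ^ 2 • c) b 0 := by
  have h := (((hasDerivAt_id (0 : ℝ)).smul_const b).const_add a).add
    (((hasDerivAt_id (0 : ℝ)).pow 2).smul_const c)
  exact h.congr_deriv (by simp)

/-- Jacobi's formula along a curve with given first-order expansion. -/
theorem hasDerivAt_det_add_smul_add {N M M' : Matrix (Fin n) (Fin n) ℝ} (hN : IsUnit N.det) :
    HasDerivAt (fun r : ℝ => (N + r • M + r ^ 2 • M').det) (N.det * (N⁻¹ * M).trace) 0 := by
  obtain ⟨A, rfl⟩ : ∃ A : Fin n → Fin n → ℝ, Matrix.of A = N := ⟨N, rfl⟩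
  obtain ⟨B, rfl⟩ : ∃ B : Fin n → Fin n → ℝ, Matrix.of B = M := ⟨M, rfl⟩
  obtain ⟨C, rfl⟩ : ∃ C : Fin n → Fin n → ℝ, Matrix.of C = M' := ⟨M', rfl⟩
  let d : (Fin n → Fin n → ℝ) → ℝ := fun A => (Matrix.of A).det
  have hd : ContDiff ℝ 1 d := by
    rw [← contDiffOn_univ]
    refine contDiffOn_matrix_det fun i j => ?_
    rw [contDiffOn_univ]
    exact contDiff_apply_apply ℝ ℝ i j
  have hd' := ((hd.differentiable one_ne_zero) A).hasFDerivAt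
  have h1 := HasFDerivAt.comp_hasDerivAt_of_eq (0 : ℝ) hd' (hasDerivAt_quadratic A B C) (by simp)
  -- The derivative at `0` does not see the quadratic term, so it may be computed with that term
  -- removed, where `det N` factors out.
  have h2 := HasFDerivAt.comp_hasDerivAt_of_eq (0 : ℝ) hd' (hasDerivAt_quadratic A B 0) (by simp)
  have h3 : HasDerivAt (fun r : ℝ => (Matrix.of A).det * (1 + r • ((Matrix.of A)⁻¹ *
      Matrix.of B)).det) ((Matrix.of A).det * ((Matrix.of A)⁻¹ * Matrix.of B).trace) 0 :=
    (Liouville.hasDerivAt_det_one_add_smul _).const_mul _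
  have h4 : (d ∘ fun r : ℝ => A + r • B + r ^ 2 • (0 : Fin n → Fin n → ℝ)) =
      fun r : ℝ => (Matrix.of A).det * (1 + r • ((Matrix.of A)⁻¹ * Matrix.of B)).det := by
    funext r
    rw [Function.comp_apply, smul_zero, add_zero, ← Matrix.det_mul, Matrix.mul_add, Matrix.mul_one,
      Matrix.mul_smul, ← Matrix.mul_assoc, Matrix.mul_nonsing_inv _ hN, Matrix.one_mul]
    rfl
  rw [h4] at h2
  rw [← h2.unique h3]
  exact h1

theorem trace_prod {V W : Type*} [AddCommGroup V] [Module ℝ V] [AddCommGroup W] [Module ℝ W]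
    [FiniteDimensional ℝ V] [FiniteDimensional ℝ W] (D : V × W →ₗ[ℝ] V × W) :
    LinearMap.trace ℝ (V × W) D =
      LinearMap.trace ℝ V (LinearMap.fst ℝ V W ∘ₗ D ∘ₗ LinearMap.inl ℝ V W) +
      LinearMap.trace ℝ W (LinearMap.snd ℝ V W ∘ₗ D ∘ₗ LinearMap.inr ℝ V W) := by
  have h : D = (D ∘ₗ LinearMap.inl ℝ V W) ∘ₗ LinearMap.fst ℝ V W +
      (D ∘ₗ LinearMap.inr ℝ V W) ∘ₗ LinearMap.snd ℝ V W := by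
    refine LinearMap.ext fun p => ?_
    simp [← map_add]
  conv_lhs => rw [h, map_add, LinearMap.trace_comp_comm' (LinearMap.fst ℝ V W),
    LinearMap.trace_comp_comm' (LinearMap.snd ℝ V W)]

end Jacobi

/-! ### The extended vector field and its vanishing weighted divergence -/

section Ambient

/-- The system in the coordinates of `ω` and a vector `x` of any positive length. -/
noncomputable def ambientField (I : SO n →ₗ[ℝ] SO n) (ε : ℝ)
    (p : (Upper n → ℝ) × EuclideanSpace ℝ (Fin n)) : (Upper n → ℝ) × EuclideanSpace ℝ (Fin n) :=
  ((coordEquiv n).symm (field I (coordEquiv n p.1) p.2.ofLp),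
    WithLp.toLp 2 (-ε • (coordEquiv n p.1 : Matrix (Fin n) (Fin n) ℝ) *ᵥ p.2.ofLp))

/-- The density of the invariant measure in the coordinates `(ω, x)`. -/
noncomputable def ambientDensity (I : SO n →ₗ[ℝ] SO n) (ε : ℝ)
    (p : (Upper n → ℝ) × EuclideanSpace ℝ (Fin n)) : ℝ :=
  (gram I p.2.ofLp).det ^ (1 / (2 * ε))

theorem dotProduct_ofLp_ne_zero {x : EuclideanSpace ℝ (Fin n)} (hx : x ≠ 0) :
    x.ofLp ⬝ᵥ x.ofLp ≠ 0 := by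
  rw [Ne, dotProduct_self_eq_zero]
  intro h
  exact hx (by ext i; exact congrFun h i)

variable {I : SO n →ₗ[ℝ] SO n}

theorem contDiff_ofLp_snd {k : WithTop ℕ∞} (i : Fin n) :
    ContDiff ℝ k (fun p : (Upper n → ℝ) × EuclideanSpace ℝ (Fin n) => p.2.ofLp i) :=
  ((EuclideanSpace.proj i).comp (ContinuousLinearMap.snd ℝ (Upper n → ℝ)
    (EuclideanSpace ℝ (Fin n)))).contDiff

theorem contDiff_coord_fst {k : WithTop ℕ∞} (i j : Fin n) :
    ContDiff ℝ k (fun p : (Upper n → ℝ) × EuclideanSpace ℝ (Fin n) =>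
      (coordEquiv n p.1 : Matrix (Fin n) (Fin n) ℝ) i j) :=
  ((LinearMap.toContinuousLinearMap (entry i j ∘ₗ (coordEquiv n).toLinearMap)).comp
    (ContinuousLinearMap.fst ℝ (Upper n → ℝ) (EuclideanSpace ℝ (Fin n)))).contDiff

theorem contDiffOn_ambientField (hI : IsInertia I) (ε : ℝ) {k : WithTop ℕ∞} :
    ContDiffOn ℝ k (ambientField I ε) {p | p.2 ≠ 0} := by
  refine ContDiffOn.prodMk (contDiffOn_pi.2 fun a => ?_) ?_
  · exact contDiffOn_field hI (fun i j => (contDiff_coord_fst i j).contDiffOn)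
      (fun i => (contDiff_ofLp_snd i).contDiffOn) (fun p hp => dotProduct_ofLp_ne_zero hp) _ _
  · rw [contDiffOn_euclidean]
    intro i
    refine ContDiffOn.const_smul (-ε) ?_
    exact contDiffOn_mulVec (fun i j => (contDiff_coord_fst i j).contDiffOn)
      (fun i => (contDiff_ofLp_snd i).contDiffOn) i

theorem contDiffOn_ambientDensity (hI : IsInertia I) (ε : ℝ) {k : WithTop ℕ∞} :
    ContDiffOn ℝ k (ambientDensity I ε) {p | p.2 ≠ 0} := by
  refine ContDiffOn.rpow_const_of_ne (contDiffOn_matrix_det (contDiffOn_gram I fun i =>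
    (contDiff_ofLp_snd i).contDiffOn)) fun p hp => ?_
  exact (gram_det_pos hI (dotProduct_ofLp_ne_zero hp)).ne'

theorem hasDerivAt_line {V W : Type*} [NormedAddCommGroup V] [NormedSpace ℝ V]
    [NormedAddCommGroup W] [NormedSpace ℝ W] {f : V → W} {p : V} (hf : DifferentiableAt ℝ f p)
    (w : V) : HasDerivAt (fun r : ℝ => f (p + r • w)) (fderiv ℝ f p w) 0 := by
  have h1 : HasDerivAt (fun r : ℝ => p + r • w) w 0 := by
    have := ((hasDerivAt_id (0 : ℝ)).smul_const w).const_add p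
    exact this.congr_deriv (by simp)
  exact HasFDerivAt.comp_hasDerivAt_of_eq (0 : ℝ) hf.hasFDerivAt h1 (by simp)

/-- The linear map that turns `[I ω, ω]` into the velocity of `ω`. -/
noncomputable def fieldLin (I : SO n →ₗ[ℝ] SO n) (x : Fin n → ℝ) : SO n →ₗ[ℝ] SO n :=
  wedgeL x ∘ₗ Matrix.toLin' (gram I x)⁻¹ ∘ₗ applyAt x

theorem fieldLin_lie (I : SO n →ₗ[ℝ] SO n) (x : Fin n → ℝ) (ω : SO n) :
    fieldLin I x ⁅I ω, ω⁆ = field I ω x := rfl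

/-- The polarization of the quadratic map `ω ↦ [I ω, ω]`. -/
def lieSym (I : SO n →ₗ[ℝ] SO n) (ω : SO n) : SO n →ₗ[ℝ] SO n where
  toFun ξ := ⁅I ξ, ω⁆ + ⁅I ω, ξ⁆
  map_add' ξ η := by
    simp only [map_add, add_lie, lie_add]
    abel
  map_smul' r ξ := by
    simp only [map_smul, smul_lie, lie_smul, smul_add, RingHom.id_apply]

theorem field_add_smul (I : SO n →ₗ[ℝ] SO n) (ω ξ : SO n) (x : Fin n → ℝ) (r : ℝ) :
    field I (ω + r • ξ) x =
      field I ω x + r • fieldLin I x (lieSym I ω ξ) + r ^ 2 • field I ξ x := by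
  rw [← fieldLin_lie, ← fieldLin_lie, ← fieldLin_lie, ← map_smul (fieldLin I x),
    ← map_smul (fieldLin I x), ← map_add, ← map_add]
  congr 1
  change _ = _ + r • (⁅I ξ, ω⁆ + ⁅I ω, ξ⁆) + _
  simp only [map_add, map_smul, lie_add, add_lie, lie_smul, smul_lie]
  rw [pow_two]
  module

/-- For fixed `x` the field is quadratic in `ω`, so its partial derivative is the linear coefficient
along a line. -/
theorem fderiv_ambientField_inl (I : SO n →ₗ[ℝ] SO n) (ε : ℝ)
    {p : (Upper n → ℝ) × EuclideanSpace ℝ (Fin n)}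
    (hd : DifferentiableAt ℝ (ambientField I ε) p) (q : Upper n → ℝ) :
    (fderiv ℝ (ambientField I ε) p (q, 0)).1 = (coordEquiv n).symm
      (fieldLin I p.2.ofLp (lieSym I (coordEquiv n p.1) (coordEquiv n q))) := by
  have h1 := (ContinuousLinearMap.fst ℝ (Upper n → ℝ)
    (EuclideanSpace ℝ (Fin n))).hasFDerivAt.comp_hasDerivAt (0 : ℝ) (hasDerivAt_line hd (q, 0))
  refine HasDerivAt.unique h1 ?_
  have h2 : ∀ r : ℝ, (ambientField I ε (p + r • (q, 0))).1 =
      (coordEquiv n).symm (field I (coordEquiv n p.1) p.2.ofLp) +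
      r • (coordEquiv n).symm
        (fieldLin I p.2.ofLp (lieSym I (coordEquiv n p.1) (coordEquiv n q))) +
      r ^ 2 • (coordEquiv n).symm (field I (coordEquiv n q) p.2.ofLp) := by
    intro r
    have h3 : p.2 + r • (0 : EuclideanSpace ℝ (Fin n)) = p.2 := by rw [smul_zero, add_zero]
    change (coordEquiv n).symm (field I (coordEquiv n (p.1 + r • q))
      (p.2 + r • (0 : EuclideanSpace ℝ (Fin n))).ofLp) = _
    rw [h3, map_add, map_smul, field_add_smul, map_add, map_add, map_smul, map_smul]
  exact (hasDerivAt_quadratic _ _ _).congr_of_eventuallyEq (Filter.Eventually.of_forall h2)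

theorem fderiv_ambientField_inr (I : SO n →ₗ[ℝ] SO n) (ε : ℝ)
    {p : (Upper n → ℝ) × EuclideanSpace ℝ (Fin n)}
    (hd : DifferentiableAt ℝ (ambientField I ε) p) (z : EuclideanSpace ℝ (Fin n)) :
    (fderiv ℝ (ambientField I ε) p (0, z)).2 =
      WithLp.toLp 2 (-ε • (coordEquiv n p.1 : Matrix (Fin n) (Fin n) ℝ) *ᵥ z.ofLp) := by
  have h1 := (ContinuousLinearMap.snd ℝ (Upper n → ℝ)
    (EuclideanSpace ℝ (Fin n))).hasFDerivAt.comp_hasDerivAt (0 : ℝ) (hasDerivAt_line hd (0, z))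
  refine HasDerivAt.unique h1 ?_
  have h2 : ∀ r : ℝ, (ambientField I ε (p + r • (0, z))).2 = (ambientField I ε p).2 + r •
        WithLp.toLp 2 (-ε • (coordEquiv n p.1 : Matrix (Fin n) (Fin n) ℝ) *ᵥ z.ofLp) +
        r ^ 2 • (0 : EuclideanSpace ℝ (Fin n)) := by
    intro r
    have h3 : p.1 + r • (0 : Upper n → ℝ) = p.1 := by rw [smul_zero, add_zero]
    change WithLp.toLp 2 (-ε • (coordEquiv n (p.1 + r • (0 : Upper n → ℝ)) :
      Matrix (Fin n) (Fin n) ℝ) *ᵥ (p.2.ofLp + r • z.ofLp)) = _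
    rw [h3, smul_zero, add_zero, ambientField, ← WithLp.toLp_smul, ← WithLp.toLp_add,
      Matrix.mulVec_add, Matrix.mulVec_smul, smul_add, smul_comm r]
  exact (hasDerivAt_quadratic _ _ _).congr_of_eventuallyEq (Filter.Eventually.of_forall h2)

/-- The `ω`-block factors through `y ↦ y ∧ x`; cyclicity of the trace moves it from `so(n)` to `ℝⁿ`,
where it is the inverse Gram matrix times `fieldMap`. The `x`-block is conjugate to `-ε ω` and has
trace zero. -/
theorem trace_fderiv_ambientField (hI : IsInertia I) (ε : ℝ)
    {p : (Upper n → ℝ) × EuclideanSpace ℝ (Fin n)} (hp : p.2 ≠ 0)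
    (hd : DifferentiableAt ℝ (ambientField I ε) p) :
    LinearMap.trace ℝ _ (fderiv ℝ (ambientField I ε) p).toLinearMap =
      1 / 2 * ((gram I p.2.ofLp)⁻¹ * gramDeriv I p.2.ofLp
        ((coordEquiv n p.1 : Matrix (Fin n) (Fin n) ℝ) *ᵥ p.2.ofLp)).trace := by
  have h11 : LinearMap.fst ℝ (Upper n → ℝ) (EuclideanSpace ℝ (Fin n)) ∘ₗ
      (fderiv ℝ (ambientField I ε) p).toLinearMap ∘ₗ
        LinearMap.inl ℝ (Upper n → ℝ) (EuclideanSpace ℝ (Fin n)) =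
      ((coordEquiv n).symm.toLinearMap ∘ₗ wedgeL p.2.ofLp) ∘ₗ
        (Matrix.toLin' (gram I p.2.ofLp)⁻¹ ∘ₗ applyAt p.2.ofLp ∘ₗ lieSym I (coordEquiv n p.1) ∘ₗ
          (coordEquiv n).toLinearMap) :=
    LinearMap.ext fun q => fderiv_ambientField_inl I ε hd q
  have h22 : LinearMap.snd ℝ (Upper n → ℝ) (EuclideanSpace ℝ (Fin n)) ∘ₗ
      (fderiv ℝ (ambientField I ε) p).toLinearMap ∘ₗ
        LinearMap.inr ℝ (Upper n → ℝ) (EuclideanSpace ℝ (Fin n)) =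
      (WithLp.linearEquiv 2 ℝ (Fin n → ℝ)).symm.toLinearMap ∘ₗ
        Matrix.toLin' (-ε • (coordEquiv n p.1 : Matrix (Fin n) (Fin n) ℝ)) ∘ₗ
        (WithLp.linearEquiv 2 ℝ (Fin n → ℝ)).toLinearMap := by
    refine LinearMap.ext fun z => (fderiv_ambientField_inr I ε hd z).trans ?_
    rw [← Matrix.smul_mulVec]
    rfl
  have h3 : (Matrix.toLin' (gram I p.2.ofLp)⁻¹ ∘ₗ applyAt p.2.ofLp ∘ₗ
      lieSym I (coordEquiv n p.1) ∘ₗ (coordEquiv n).toLinearMap) ∘ₗ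
      ((coordEquiv n).symm.toLinearMap ∘ₗ wedgeL p.2.ofLp) =
      Matrix.toLin' (gram I p.2.ofLp)⁻¹ ∘ₗ fieldMap I (coordEquiv n p.1) p.2.ofLp := by
    refine LinearMap.ext fun y => ?_
    change Matrix.toLin' _ (applyAt _ (lieSym I _ (coordEquiv n ((coordEquiv n).symm _)))) = _
    rw [LinearEquiv.apply_symm_apply]
    rfl
  have h4 : (WithLp.linearEquiv 2 ℝ (Fin n → ℝ)).toLinearMap ∘ₗ
      (WithLp.linearEquiv 2 ℝ (Fin n → ℝ)).symm.toLinearMap = LinearMap.id := by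
    ext; simp
  have h5 := trace_mul_eq_zero_of_skew (Matrix.transpose_one (n := Fin n) (α := ℝ))
    (coordEquiv n p.1)
  rw [Matrix.one_mul] at h5
  rw [trace_prod, h11, h22, LinearMap.trace_comp_comm', h3,
    LinearMap.trace_comp_comm' (_ ∘ₗ _) (WithLp.linearEquiv 2 ℝ (Fin n → ℝ)).symm.toLinearMap,
    LinearMap.comp_assoc, h4, LinearMap.comp_id, Matrix.trace_toLin'_eq, Matrix.trace_smul, h5,
    smul_zero, add_zero, ← trace_inv_mul_fieldMap hI (dotProduct_ofLp_ne_zero hp),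
    ← Matrix.trace_toLin'_eq, Matrix.toLin'_mul, Matrix.toLin'_toMatrix']

/-- The exponent `1/(2ε)` meets the factor `-ε` of `x' = -ε ω x` and leaves `-1/2`, exactly what the
trace of the field requires. -/
theorem fderiv_ambientDensity (hI : IsInertia I) {ε : ℝ} (hε : ε ≠ 0)
    {p : (Upper n → ℝ) × EuclideanSpace ℝ (Fin n)} (hp : p.2 ≠ 0)
    (hd : DifferentiableAt ℝ (ambientDensity I ε) p) :
    fderiv ℝ (ambientDensity I ε) p (ambientField I ε p) =
      -(1 / 2) * ambientDensity I ε p * ((gram I p.2.ofLp)⁻¹ * gramDeriv I p.2.ofLp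
        ((coordEquiv n p.1 : Matrix (Fin n) (Fin n) ℝ) *ᵥ p.2.ofLp)).trace := by
  set x := p.2.ofLp with hx
  set u := (coordEquiv n p.1 : Matrix (Fin n) (Fin n) ℝ) *ᵥ x with hu
  have hx0 := dotProduct_ofLp_ne_zero hp
  have hpos := gram_det_pos hI hx0
  have h1 := hasDerivAt_line hd (ambientField I ε p)
  have h2 : (fun r : ℝ => ambientDensity I ε (p + r • ambientField I ε p)) =
      fun r : ℝ => (gram I x + r • gramDeriv I x (-ε • u) + r ^ 2 • gram I (-ε • u)).det ^
        (1 / (2 * ε)) := by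
    funext r
    rw [← gram_add_smul]
    rfl
  rw [h2] at h1
  have h3 := (hasDerivAt_det_add_smul_add (M := gramDeriv I x (-ε • u)) (M' := gram I (-ε • u))
    (isUnit_gram_det hI hx0)).rpow_const (p := 1 / (2 * ε)) (Or.inl (by simpa using hpos.ne'))
  rw [h1.unique h3, gramDeriv_smul, ambientDensity]
  simp only [zero_smul, add_zero, zero_pow two_ne_zero, Matrix.mul_smul, Matrix.trace_smul,
    smul_eq_mul]
  rw [Real.rpow_sub_one hpos.ne']
  field_simp
  rfl

theorem isInvariantDensity_ambient (hI : IsInertia I) {ε : ℝ} (hε : ε ≠ 0) :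
    Liouville.IsInvariantDensity (ambientField I ε) (ambientDensity I ε) {p | p.2 ≠ 0} where
  isOpen := isOpen_ne_fun continuous_snd continuous_const
  contDiffOn_field := contDiffOn_ambientField hI ε
  contDiffOn_density := contDiffOn_ambientDensity hI ε
  pos p hp := Real.rpow_pos_of_pos (gram_det_pos hI (dotProduct_ofLp_ne_zero hp)) _
  div_eq_zero p hp := by
    have hU : IsOpen {p : (Upper n → ℝ) × EuclideanSpace ℝ (Fin n) | p.2 ≠ 0} :=
      isOpen_ne_fun continuous_snd continuous_const
    have hd := ((contDiffOn_ambientField hI ε (k := 1)).contDiffAt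
      (hU.mem_nhds hp)).differentiableAt one_ne_zero
    have hd' := ((contDiffOn_ambientDensity hI ε (k := 1)).contDiffAt
      (hU.mem_nhds hp)).differentiableAt one_ne_zero
    rw [fderiv_ambientDensity hI hε hp hd', trace_fderiv_ambientField hI ε hp hd]
    ring

end Ambient

end RubberRolling

/-! ### Solutions lifted to the extended system -/

namespace RubberRolling

open Set

variable {n : ℕ} {I : SO n →ₗ[ℝ] SO n}

/-- The inverse Gram matrix has degree `-2` in `x` and the two other occurrences of `x` have degree
`1` each. Hence a solution over the sphere lifts to every radius. -/
theorem field_smul (hI : IsInertia I) (ω : SO n) {x : Fin n → ℝ} (hx : x ⬝ᵥ x ≠ 0) {r : ℝ}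
    (hr : r ≠ 0) : field I ω (r • x) = field I ω x := by
  have h2 : (gram I (r • x))⁻¹ = (r ^ 2)⁻¹ • (gram I x)⁻¹ := by
    rw [gram_smul]
    refine Matrix.inv_eq_right_inv ?_
    rw [Matrix.smul_mul, Matrix.mul_smul, smul_smul, mul_inv_cancel₀ (pow_ne_zero 2 hr), one_smul,
      Matrix.mul_nonsing_inv _ (isUnit_gram_det hI hx)]
  rw [field, h2, applyAt_smul, Matrix.mulVec_smul, Matrix.smul_mulVec, wedge_smul_right,
    wedge_smul_left, wedge_smul_left, smul_smul, smul_smul, field]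
  have : r * r * (r ^ 2)⁻¹ = 1 := by field_simp
  rw [this, one_smul]

theorem hasDerivWithinAt_entry (L : SO n →ₗ[ℝ] SO n) {q : ℝ → Upper n → ℝ} {q' : Upper n → ℝ}
    {T : Set ℝ} {s : ℝ} (hq : HasDerivWithinAt q q' T s) (i j : Fin n) :
    HasDerivWithinAt (fun τ => (L (coordEquiv n (q τ)) : Matrix (Fin n) (Fin n) ℝ) i j)
      ((L (coordEquiv n q') : Matrix (Fin n) (Fin n) ℝ) i j) T s :=
  (LinearMap.toContinuousLinearMap
    (entry i j ∘ₗ L ∘ₗ (coordEquiv n).toLinearMap)).hasFDerivAt.comp_hasDerivWithinAt s hq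

theorem hasDerivWithinAt_mulVec {A : ℝ → Matrix (Fin n) (Fin n) ℝ} {A' : Matrix (Fin n) (Fin n) ℝ}
    {y : ℝ → Fin n → ℝ} {y' : Fin n → ℝ} {T : Set ℝ} {s : ℝ}
    (hA : ∀ i j, HasDerivWithinAt (fun τ => A τ i j) (A' i j) T s)
    (hy : ∀ i, HasDerivWithinAt (fun τ => y τ i) (y' i) T s) (i : Fin n) :
    HasDerivWithinAt (fun τ => (A τ *ᵥ y τ) i) ((A' *ᵥ y s + A s *ᵥ y') i) T s := by
  have h := HasDerivWithinAt.fun_sum (u := Finset.univ) fun j _ => (hA i j).mul (hy j)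
  refine h.congr_deriv ?_
  rw [Finset.sum_add_distrib]
  rfl

theorem hasDerivWithinAt_wedge {y z : ℝ → Fin n → ℝ} {y' z' : Fin n → ℝ} {T : Set ℝ} {s : ℝ}
    (hy : ∀ i, HasDerivWithinAt (fun τ => y τ i) (y' i) T s)
    (hz : ∀ i, HasDerivWithinAt (fun τ => z τ i) (z' i) T s) (i j : Fin n) :
    HasDerivWithinAt (fun τ => (wedge (y τ) (z τ) : Matrix (Fin n) (Fin n) ℝ) i j)
      (((wedge y' (z s) + wedge (y s) z' : SO n) : Matrix (Fin n) (Fin n) ℝ) i j) T s := by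
  refine (((hy i).mul (hz j)).sub ((hz i).mul (hy j))).congr_deriv ?_
  change _ = (y' i * z s j - z s i * y' j) + (y s i * z' j - z' i * y s j)
  ring

theorem momentum_eq_add (I : SO n →ₗ[ℝ] SO n) (γ : Sph n) (ω : SO n) :
    momentum I γ ω =
      ω + wedge (((I - LinearMap.id : SO n →ₗ[ℝ] SO n) ω : Matrix (Fin n) (Fin n) ℝ) *ᵥ vec γ) (vec γ) := by
  rw [← prV_apply, momentum, prH_apply, LinearMap.sub_apply, LinearMap.id_apply, map_sub]
  abel

/-- Along a solution the angular velocity is differentiable and satisfies its own equation. -/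
theorem IsSolution.hasDerivWithinAt_velocity (hI : IsInertia I) {ε : ℝ} {T : Set ℝ}
    {c : ℝ → Phase n} (hc : IsSolution I ε T c) {s : ℝ} (hs : s ∈ T)
    (hT : UniqueDiffWithinAt ℝ T s) :
    HasDerivWithinAt (fun τ => (coordEquiv n).symm (velocity I (c τ).1 (vec (c τ).2)))
      ((coordEquiv n).symm (field I (velocity I (c s).1 (vec (c s).2)) (vec (c s).2))) T s := by
  obtain ⟨ω, hω⟩ := hc
  have hv : ∀ τ ∈ T, velocity I (c τ).1 (vec (c τ).2) = ω τ := fun τ hτ => by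
    rw [(hω τ hτ).1, velocity_momentum hI]
  set x := vec (c s).2 with hx
  set x' : Fin n → ℝ := -ε • (ω s : Matrix (Fin n) (Fin n) ℝ) *ᵥ x with hx'
  have hγ : ∀ i, HasDerivWithinAt (fun τ => vec (c τ).2 i) (x' i) T s := (hω s hs).2.1
  have hm := (hω s hs).2.2
  set m' : SO n := ε • ⁅(c s).1, ω s⁆ + (1 - ε) • prV (c s).2 ⁅I (ω s), ω s⁆ with hm'
  let k : ℝ → (Upper n → ℝ) × (Fin n → ℝ) := fun τ => ((coordEquiv n).symm (c τ).1, vec (c τ).2)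
  have hk : HasDerivWithinAt k ((coordEquiv n).symm m', x') T s :=
    (hasDerivWithinAt_pi.2 fun p : Upper n => hm p.1.1 p.1.2).prodMk (hasDerivWithinAt_pi.2 hγ)
  -- The definition of a solution does not assume `ω` differentiable. As a smooth function of `(𝐦,
  -- x)` near the sphere it is, and its derivative `q'` is then identified from the momentum
  -- relation.
  let V : (Upper n → ℝ) × (Fin n → ℝ) → Upper n → ℝ := fun p =>
    (coordEquiv n).symm (velocity I (coordEquiv n p.1) p.2)
  have hU : IsOpen {p : (Upper n → ℝ) × (Fin n → ℝ) | p.2 ⬝ᵥ p.2 ≠ 0} := by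
    refine isOpen_ne_fun ?_ continuous_const
    exact continuous_snd.dotProduct continuous_snd
  have hV : ContDiffOn ℝ 1 V {p | p.2 ⬝ᵥ p.2 ≠ 0} := by
    refine contDiffOn_pi.2 fun p => contDiffOn_velocity hI (fun i j => ?_) (fun i => ?_)
      (fun p hp => hp) _ _
    · exact ((LinearMap.toContinuousLinearMap (entry i j ∘ₗ (coordEquiv n).toLinearMap)).comp
        (ContinuousLinearMap.fst ℝ (Upper n → ℝ) (Fin n → ℝ))).contDiff.contDiffOn
    · exact ((ContinuousLinearMap.proj (R := ℝ) (φ := fun _ : Fin n => ℝ) i).comp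
        (ContinuousLinearMap.snd ℝ (Upper n → ℝ) (Fin n → ℝ))).contDiff.contDiffOn
  have hks : k s ∈ {p : (Upper n → ℝ) × (Fin n → ℝ) | p.2 ⬝ᵥ p.2 ≠ 0} :=
    vec_dotProduct_vec_ne_zero (c s).2
  have hV' := ((hV.contDiffAt (hU.mem_nhds hks)).differentiableAt one_ne_zero).hasFDerivAt
  have hq := hV'.comp_hasDerivWithinAt s hk
  set q' := fderiv ℝ V (k s) ((coordEquiv n).symm m', x') with hq'
  have hVk : V ∘ k = fun τ => (coordEquiv n).symm (velocity I (c τ).1 (vec (c τ).2)) := by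
    funext τ
    change (coordEquiv n).symm (velocity I (coordEquiv n ((coordEquiv n).symm (c τ).1)) _) = _
    rw [LinearEquiv.apply_symm_apply]
  rw [hVk] at hq
  refine hq.congr_deriv ?_
  rw [LinearEquiv.eq_symm_apply, hv s hs]
  -- differentiate the relation between momentum and angular velocity
  have hent : ∀ L : SO n →ₗ[ℝ] SO n, ∀ i j, HasDerivWithinAt
      (fun τ => (L (velocity I (c τ).1 (vec (c τ).2)) : Matrix (Fin n) (Fin n) ℝ) i j)
      ((L (coordEquiv n q') : Matrix (Fin n) (Fin n) ℝ) i j) T s := by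
    intro L i j
    have := hasDerivWithinAt_entry L hq i j
    simpa only [LinearEquiv.apply_symm_apply] using this
  have hrel : ∀ i j, HasDerivWithinAt (fun τ => ((c τ).1 : Matrix (Fin n) (Fin n) ℝ) i j)
      (((coordEquiv n q' + (wedge (((I - LinearMap.id : SO n →ₗ[ℝ] SO n) (coordEquiv n q') :
          Matrix (Fin n) (Fin n) ℝ) *ᵥ x + ((I - LinearMap.id : SO n →ₗ[ℝ] SO n) (velocity I (c s).1 x) :
          Matrix (Fin n) (Fin n) ℝ) *ᵥ x') x +
        wedge (((I - LinearMap.id : SO n →ₗ[ℝ] SO n) (velocity I (c s).1 x) : Matrix (Fin n) (Fin n) ℝ) *ᵥ x) x') :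
        SO n) : Matrix (Fin n) (Fin n) ℝ) i j) T s := by
    intro i j
    have h1 := (hent LinearMap.id i j).add (hasDerivWithinAt_wedge
      (hasDerivWithinAt_mulVec (hent (I - LinearMap.id : SO n →ₗ[ℝ] SO n)) hγ) hγ i j)
    refine h1.congr_of_eventuallyEq (Filter.Eventually.of_forall fun τ => ?_) ?_
    · have := momentum_velocity hI (c τ).1 (c τ).2
      rw [momentum_eq_add] at this
      exact (congrFun (congrFun (congrArg Subtype.val this) i) j).symm
    · have := momentum_velocity hI (c s).1 (c s).2
      rw [momentum_eq_add] at this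
      exact (congrFun (congrFun (congrArg Subtype.val this) i) j).symm
  have heq := ext_of_lt fun i j _ => hT.eq_deriv _ (hrel i j) (hm i j)
  have hme := momentum_equation I ε (ω s) (c s).2
  rw [← (hω s hs).1, ← hm', ← hx, ← hx'] at hme
  rw [hv s hs, hme] at heq
  refine momentumMap_injective hI (c s).2 ?_
  rw [momentumMap_apply, momentumMap_apply, momentum_field hI, momentum_eq_add, ← hx]
  rw [wedge_add_left, LinearMap.sub_apply I, LinearMap.sub_apply I, LinearMap.id_apply,
    LinearMap.id_apply, add_assoc, ← add_assoc (coordEquiv n q')] at heq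
  exact add_right_cancel heq

/-- The point of the ambient space over a point of the phase space, at distance `r`. -/
noncomputable def lift (I : SO n →ₗ[ℝ] SO n) (r : ℝ) (p : Phase n) :
    (Upper n → ℝ) × EuclideanSpace ℝ (Fin n) :=
  ((coordEquiv n).symm (velocity I p.1 (vec p.2)), r • (p.2 : EuclideanSpace ℝ (Fin n)))

theorem lift_snd_ne_zero {r : ℝ} (hr : 0 < r) (p : Phase n) : (lift I r p).2 ≠ 0 :=
  smul_ne_zero hr.ne' (ne_zero_of_mem_unit_sphere p.2)

theorem IsSolution.hasDerivWithinAt_lift (hI : IsInertia I) {ε : ℝ} {T : Set ℝ}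
    {c : ℝ → Phase n} (hc : IsSolution I ε T c) {s : ℝ} (hs : s ∈ T)
    (hT : UniqueDiffWithinAt ℝ T s) {r : ℝ} (hr : 0 < r) :
    HasDerivWithinAt (fun τ => lift I r (c τ)) (ambientField I ε (lift I r (c s))) T s := by
  have h1 := hc.hasDerivWithinAt_velocity hI hs hT
  refine HasDerivWithinAt.prodMk (h1.congr_deriv ?_) ?_
  · change _ = (coordEquiv n).symm (field I (coordEquiv n ((coordEquiv n).symm _)) (r • vec (c s).2))
    rw [LinearEquiv.apply_symm_apply, field_smul hI _ (vec_dotProduct_vec_ne_zero _) hr.ne']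
  · obtain ⟨ω, hω⟩ := hc
    refine hasFDerivWithinAt_euclidean.2 fun i => ?_
    have hi : HasDerivWithinAt (fun τ => r * vec (c τ).2 i)
        ((ambientField I ε (lift I r (c s))).2.ofLp i) T s := by
      refine (((hω s hs).2.1 i).const_mul r).congr_deriv ?_
      change _ = -ε • ((coordEquiv n ((coordEquiv n).symm (velocity I (c s).1 (vec (c s).2))) :
      Matrix (Fin n) (Fin n) ℝ) *ᵥ (r • vec (c s).2)) i
      rw [LinearEquiv.apply_symm_apply, (hω s hs).1, velocity_momentum hI, Matrix.mulVec_smul,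
        Pi.smul_apply, smul_eq_mul, smul_eq_mul]
      ring
    refine hi.hasFDerivWithinAt.congr_fderiv (ContinuousLinearMap.ext_ring ?_)
    simp only [ContinuousLinearMap.comp_apply, ContinuousLinearMap.toSpanSingleton_apply, one_smul]
    rfl

theorem IsSolution.flowsIn (hI : IsInertia I) {ε t : ℝ} (ht : 0 ≤ t) {c : ℝ → Phase n}
    (hc : IsSolution I ε (uIcc 0 t) c) {r : ℝ} (hr : 0 < r) :
    Liouville.FlowsIn (ambientField I ε) {p | p.2 ≠ 0} t (lift I r (c 0)) (lift I r (c t)) := by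
  rw [uIcc_of_le ht] at hc
  refine ⟨fun s => lift I r (c s), fun s hs => ⟨lift_snd_ne_zero hr _, ?_⟩, rfl, rfl⟩
  -- For `t = 0` derivatives within the time interval are not unique, but any derivative within a
  -- singleton is admissible.
  rcases ht.eq_or_lt with rfl | ht
  · rw [Icc_self] at hs ⊢
    rw [mem_singleton_iff.1 hs]
    exact HasFDerivWithinAt.singleton
  · exact hc.hasDerivWithinAt_lift hI hs (uniqueDiffOn_Icc ht s hs) hr

theorem IsSolution.flowsIn_neg (hI : IsInertia I) {ε t : ℝ} (ht : t < 0) {c : ℝ → Phase n}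
    (hc : IsSolution I ε (uIcc 0 t) c) {r : ℝ} (hr : 0 < r) :
    Liouville.FlowsIn (-ambientField I ε) {p | p.2 ≠ 0} (-t) (lift I r (c 0)) (lift I r (c t)) := by
  rw [uIcc_of_ge ht.le] at hc
  refine ⟨fun s => lift I r (c (-s)), fun s hs => ⟨lift_snd_ne_zero hr _, ?_⟩, by simp, by simp⟩
  have hm : MapsTo Neg.neg (Icc 0 (-t)) (Icc t 0) := fun s hs =>
    ⟨by linarith [hs.2], by linarith [hs.1]⟩
  have h1 := hc.hasDerivWithinAt_lift hI (hm hs) (uniqueDiffOn_Icc ht _ (hm hs)) hr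
  exact (h1.scomp s (hasDerivAt_neg s).hasDerivWithinAt hm).congr_deriv (by simp)

end RubberRolling

/-! ### Cones over subsets of the phase space -/

namespace RubberRolling

open Set MeasureTheory
open scoped ENNReal

variable {n : ℕ} {I : SO n →ₗ[ℝ] SO n}

section Direction

/-- The unit vector `x / |x|`, with the value `γ₀` at `x = 0`. -/
noncomputable def dir (γ₀ : Sph n) (x : EuclideanSpace ℝ (Fin n)) : Sph n :=
  open Classical in
  ⟨if x = 0 then γ₀ else ‖x‖⁻¹ • x, by
    split_ifs with h
    · exact γ₀.2
    · rw [mem_sphere_zero_iff_norm, norm_smul, norm_inv, norm_norm,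
        inv_mul_cancel₀ (norm_ne_zero_iff.2 h)]⟩

theorem measurable_dir (γ₀ : Sph n) : Measurable (dir γ₀) := by
  classical
  refine Measurable.subtype_mk (Measurable.ite (measurableSet_singleton 0) measurable_const ?_)
  exact measurable_norm.inv.smul measurable_id

theorem coe_dir (γ₀ : Sph n) {x : EuclideanSpace ℝ (Fin n)} (hx : x ≠ 0) :
    (dir γ₀ x : EuclideanSpace ℝ (Fin n)) = ‖x‖⁻¹ • x := by
  simp [dir, hx]

theorem dir_smul (γ₀ γ : Sph n) {r : ℝ} (hr : 0 < r) :
    dir γ₀ (r • (γ : EuclideanSpace ℝ (Fin n))) = γ := by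
  apply Subtype.ext
  have hγ : ‖(γ : EuclideanSpace ℝ (Fin n))‖ = 1 := mem_sphere_zero_iff_norm.1 γ.2
  rw [coe_dir γ₀ (smul_ne_zero hr.ne' (ne_zero_of_mem_unit_sphere γ)), norm_smul, hγ, mul_one,
    Real.norm_of_nonneg hr.le, inv_smul_smul₀ hr.ne']

theorem norm_smul_dir (γ₀ : Sph n) {x : EuclideanSpace ℝ (Fin n)} (hx : x ≠ 0) :
    ‖x‖ • (dir γ₀ x : EuclideanSpace ℝ (Fin n)) = x := by
  rw [coe_dir γ₀ hx, smul_inv_smul₀ (norm_ne_zero_iff.2 hx)]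

end Direction

section Measurability

theorem continuous_SO_of_entries {α : Type*} [TopologicalSpace α] {f : α → SO n}
    (h : ∀ i j, Continuous fun a => (f a : Matrix (Fin n) (Fin n) ℝ) i j) : Continuous f :=
  continuous_induced_rng.2 (continuous_matrix h)

theorem continuous_entry (i j : Fin n) :
    Continuous fun X : SO n => (X : Matrix (Fin n) (Fin n) ℝ) i j :=
  (continuous_apply_apply i j).comp continuous_subtype_val

theorem continuous_coordEquiv : Continuous (coordEquiv n) :=
  continuous_SO_of_entries fun i j =>
    (LinearMap.toContinuousLinearMap (entry i j ∘ₗ (coordEquiv n).toLinearMap)).continuous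

theorem continuous_coordEquiv_symm : Continuous (coordEquiv n).symm :=
  continuous_pi fun _ => continuous_entry _ _

theorem continuous_vec : Continuous (vec : Sph n → Fin n → ℝ) :=
  (PiLp.continuous_ofLp 2 _).comp continuous_subtype_val

theorem continuous_momentum (I : SO n →ₗ[ℝ] SO n) :
    Continuous fun p : (Upper n → ℝ) × EuclideanSpace ℝ (Fin n) => coordEquiv n p.1 +
      wedge (((I - LinearMap.id : SO n →ₗ[ℝ] SO n) (coordEquiv n p.1) :
        Matrix (Fin n) (Fin n) ℝ) *ᵥ p.2.ofLp) p.2.ofLp := by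
  have hA : ∀ i j, ContDiffOn ℝ 0 (fun p : (Upper n → ℝ) × EuclideanSpace ℝ (Fin n) =>
      (coordEquiv n p.1 : Matrix (Fin n) (Fin n) ℝ) i j) univ :=
    fun i j => (contDiff_coord_fst i j).contDiffOn
  have hy : ∀ i, ContDiffOn ℝ 0 (fun p : (Upper n → ℝ) × EuclideanSpace ℝ (Fin n) =>
      p.2.ofLp i) univ := fun i => (contDiff_ofLp_snd i).contDiffOn
  refine continuous_SO_of_entries fun i j => ?_
  rw [← continuousOn_univ]
  exact ((hA i j).add (contDiffOn_wedge (contDiffOn_mulVec (contDiffOn_linearMap _ hA) hy) hy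
    i j)).continuousOn

theorem measurable_momentum_dir (I : SO n →ₗ[ℝ] SO n) (γ₀ : Sph n) :
    Measurable fun p : (Upper n → ℝ) × EuclideanSpace ℝ (Fin n) =>
      ((momentum I (dir γ₀ p.2) (coordEquiv n p.1), dir γ₀ p.2) : Phase n) := by
  have hd : Measurable fun p : (Upper n → ℝ) × EuclideanSpace ℝ (Fin n) => dir γ₀ p.2 :=
    (measurable_dir γ₀).comp measurable_snd
  refine Measurable.prodMk ?_ hd
  have h := (continuous_momentum I).measurable.comp
    (measurable_fst.prodMk (measurable_subtype_coe.comp hd))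
  simp only [momentum_eq_add]
  exact h

theorem measurable_lift (hI : IsInertia I) (r : ℝ) : Measurable (lift I r) := by
  refine Measurable.prodMk ?_ ?_
  · refine Continuous.measurable (continuous_pi fun p => ?_)
    have hV : ContinuousOn (fun q : (Upper n → ℝ) × (Fin n → ℝ) =>
        (velocity I (coordEquiv n q.1) q.2 : Matrix (Fin n) (Fin n) ℝ) p.1.1 p.1.2)
        {q | q.2 ⬝ᵥ q.2 ≠ 0} := by
      refine (contDiffOn_velocity (k := 0) hI (fun i j => ?_) (fun i => ?_)
        (fun p hp => hp) _ _).continuousOn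
      · exact ((LinearMap.toContinuousLinearMap (entry i j ∘ₗ (coordEquiv n).toLinearMap)).comp
          (ContinuousLinearMap.fst ℝ (Upper n → ℝ) (Fin n → ℝ))).contDiff.contDiffOn
      · exact ((ContinuousLinearMap.proj (R := ℝ) (φ := fun _ : Fin n => ℝ) i).comp
          (ContinuousLinearMap.snd ℝ (Upper n → ℝ) (Fin n → ℝ))).contDiff.contDiffOn
    have h := hV.comp_continuous (f := fun q : Phase n => ((coordEquiv n).symm q.1, vec q.2))
      ((continuous_coordEquiv_symm.comp continuous_fst).prodMk (continuous_vec.comp continuous_snd))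
      fun q => vec_dotProduct_vec_ne_zero q.2
    refine h.congr fun q => ?_
    change (velocity I (coordEquiv n ((coordEquiv n).symm q.1)) (vec q.2) :
      Matrix (Fin n) (Fin n) ℝ) p.1.1 p.1.2 = _
    rw [LinearEquiv.apply_symm_apply]
    rfl
  · exact (measurable_subtype_coe.comp measurable_snd).const_smul r

theorem measurable_gram_det (I : SO n →ₗ[ℝ] SO n) :
    Measurable fun x : EuclideanSpace ℝ (Fin n) => (gram I x.ofLp).det := by
  have h : ContDiffOn ℝ 0 (fun x : EuclideanSpace ℝ (Fin n) => (gram I x.ofLp).det) univ :=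
    contDiffOn_matrix_det (contDiffOn_gram I fun i =>
      (EuclideanSpace.proj i : EuclideanSpace ℝ (Fin n) →L[ℝ] ℝ).contDiff.contDiffOn)
  exact (continuousOn_univ.1 h.continuousOn).measurable

theorem measurable_density (I : SO n →ₗ[ℝ] SO n) (ε : ℝ) : Measurable (density I ε) := by
  have h : density I ε = fun γ : Sph n =>
      (gram I (γ : EuclideanSpace ℝ (Fin n)).ofLp).det ^ (1 / (2 * ε) - 1) := by
    funext γ
    rw [density, ← det_gram_vec]
    rfl
  rw [h]
  exact ((measurable_gram_det I).comp measurable_subtype_coe).pow_const _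

theorem measurable_ambientDensity (I : SO n →ₗ[ℝ] SO n) (ε : ℝ) :
    Measurable (ambientDensity I ε) :=
  ((measurable_gram_det I).comp measurable_snd).pow_const _

end Measurability

section Cone

/-- The part at distance in `[1/2, 1)` of the cone over a subset of the phase space. -/
def cone (I : SO n →ₗ[ℝ] SO n) (γ₀ : Sph n) (B : Set (Phase n)) :
    Set ((Upper n → ℝ) × EuclideanSpace ℝ (Fin n)) :=
  {p | ‖p.2‖ ∈ Ico (1 / 2) 1 ∧ (momentum I (dir γ₀ p.2) (coordEquiv n p.1), dir γ₀ p.2) ∈ B}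

theorem measurableSet_cone (I : SO n →ₗ[ℝ] SO n) (γ₀ : Sph n) {B : Set (Phase n)}
    (hB : MeasurableSet B) : MeasurableSet (cone I γ₀ B) :=
  ((measurable_norm.comp measurable_snd) measurableSet_Ico).inter
    (measurable_momentum_dir I γ₀ hB)

theorem snd_ne_zero_of_mem_cone {γ₀ : Sph n} {B : Set (Phase n)}
    {p : (Upper n → ℝ) × EuclideanSpace ℝ (Fin n)} (hp : p ∈ cone I γ₀ B) : p.2 ≠ 0 := by
  intro h
  have := hp.1.1
  rw [h, norm_zero] at this
  norm_num at this

theorem norm_lift_snd {r : ℝ} (hr : 0 < r) (y : Phase n) : ‖(lift I r y).2‖ = r := by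
  have hγ : ‖(y.2 : EuclideanSpace ℝ (Fin n))‖ = 1 := mem_sphere_zero_iff_norm.1 y.2.2
  change ‖r • (y.2 : EuclideanSpace ℝ (Fin n))‖ = r
  rw [norm_smul, hγ, mul_one, Real.norm_of_nonneg hr.le]

theorem dir_lift_snd (γ₀ : Sph n) {r : ℝ} (hr : 0 < r) (y : Phase n) :
    dir γ₀ (lift I r y).2 = y.2 := dir_smul γ₀ y.2 hr

theorem momentum_lift (hI : IsInertia I) (r : ℝ) (y : Phase n) :
    momentum I y.2 (coordEquiv n (lift I r y).1) = y.1 := by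
  rw [lift, LinearEquiv.apply_symm_apply, momentum_velocity hI]

theorem lift_mem_cone (hI : IsInertia I) (γ₀ : Sph n) {B : Set (Phase n)} {r : ℝ}
    (hr : r ∈ Ico (1 / 2 : ℝ) 1) {y : Phase n} : lift I r y ∈ cone I γ₀ B ↔ y ∈ B := by
  have hr0 : 0 < r := lt_of_lt_of_le (by norm_num) hr.1
  rw [cone, mem_ofPred_eq, norm_lift_snd hr0, dir_lift_snd γ₀ hr0, momentum_lift hI]
  exact and_iff_right hr

theorem lift_momentum (hI : IsInertia I) (γ₀ : Sph n)
    {p : (Upper n → ℝ) × EuclideanSpace ℝ (Fin n)} (hp : p.2 ≠ 0) :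
    lift I ‖p.2‖ (momentum I (dir γ₀ p.2) (coordEquiv n p.1), dir γ₀ p.2) = p := by
  refine Prod.ext ?_ (norm_smul_dir γ₀ hp)
  change (coordEquiv n).symm (velocity I _ _) = _
  rw [velocity_momentum hI, LinearEquiv.symm_apply_apply]

/-- Nothing is assumed about the measurability of `Φ`; that of `Φ '' B` is recovered from its cone,
a section of which at radius `1/2` is the set itself. -/
theorem measurableSet_of_measurableSet_cone (hI : IsInertia I) (γ₀ : Sph n) {B : Set (Phase n)}
    (hB : MeasurableSet (cone I γ₀ B)) : MeasurableSet B := by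
  have h : B = lift I (1 / 2) ⁻¹' cone I γ₀ B := by
    ext y
    exact (lift_mem_cone hI γ₀ ⟨le_rfl, by norm_num⟩).symm
  rw [h]
  exact measurable_lift hI _ hB

/-- The map of the ambient space over a map of the phase space. -/
noncomputable def ambientMap (I : SO n →ₗ[ℝ] SO n) (γ₀ : Sph n) (Φ : Phase n → Phase n)
    (p : (Upper n → ℝ) × EuclideanSpace ℝ (Fin n)) : (Upper n → ℝ) × EuclideanSpace ℝ (Fin n) :=
  lift I ‖p.2‖ (Φ (momentum I (dir γ₀ p.2) (coordEquiv n p.1), dir γ₀ p.2))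

theorem ambientMap_lift (hI : IsInertia I) (γ₀ : Sph n) (Φ : Phase n → Phase n) {r : ℝ}
    (hr : 0 < r) (y : Phase n) : ambientMap I γ₀ Φ (lift I r y) = lift I r (Φ y) := by
  rw [ambientMap, norm_lift_snd hr, dir_lift_snd γ₀ hr, momentum_lift hI]

/-- The lifted map keeps the radius and acts as `Φ` on the remaining variables. -/
theorem image_cone (hI : IsInertia I) (γ₀ : Sph n) (Φ : Phase n → Phase n) (B : Set (Phase n)) :
    ambientMap I γ₀ Φ '' cone I γ₀ B = cone I γ₀ (Φ '' B) := by
  ext z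
  constructor
  · rintro ⟨p, hp, rfl⟩
    exact (lift_mem_cone hI γ₀ hp.1).2 (mem_image_of_mem Φ hp.2)
  · intro hz
    obtain ⟨y, hy, hyz⟩ := hz.2
    have hr0 : 0 < ‖z.2‖ := norm_pos_iff.2 (snd_ne_zero_of_mem_cone hz)
    refine ⟨lift I ‖z.2‖ y, (lift_mem_cone hI γ₀ hz.1).2 hy, ?_⟩
    rw [ambientMap_lift hI γ₀ Φ hr0, hyz, lift_momentum hI γ₀ (snd_ne_zero_of_mem_cone hz)]

end Cone

end RubberRolling

namespace RubberRolling

open Set MeasureTheory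
open scoped ENNReal

variable {n : ℕ} {I : SO n →ₗ[ℝ] SO n}

/-! ### The phase measure through polar coordinates -/

section Integral

instance sFinite_volSO (n : ℕ) : SFinite (volSO n) :=
  inferInstanceAs (SFinite (Measure.map _ _))

/-- The half-open interval `[1/2, 1)` of radii. -/
def radii : Set (Ioi (0 : ℝ)) := {r | (r : ℝ) ∈ Ico (1 / 2) 1}

theorem measurableSet_radii : MeasurableSet radii := measurable_subtype_coe measurableSet_Ico

theorem volumeIoiPow_radii (d : ℕ) :
    Measure.volumeIoiPow d radii ≠ 0 ∧ Measure.volumeIoiPow d radii ≠ ∞ := by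
  have h1 : Measure.volumeIoiPow d (Iio ⟨1, mem_Ioi.2 one_pos⟩) = ENNReal.ofReal (1 / (d + 1)) := by
    rw [Measure.volumeIoiPow_apply_Iio, one_pow]
  have h2 : Measure.volumeIoiPow d (Iio ⟨1 / 2, by norm_num⟩) =
      ENNReal.ofReal ((1 / 2) ^ (d + 1) / (d + 1)) := Measure.volumeIoiPow_apply_Iio _ _
  constructor
  · intro h0
    have hsub : (Iio ⟨1, mem_Ioi.2 one_pos⟩ : Set (Ioi (0 : ℝ))) ⊆ Iio ⟨1 / 2, by norm_num⟩ ∪ radii := by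
      intro r hr
      rcases lt_or_ge (r : ℝ) (1 / 2) with h | h
      · exact Or.inl h
      · exact Or.inr ⟨h, hr⟩
    have h3 := (measure_mono hsub).trans (measure_union_le (μ := Measure.volumeIoiPow d) _ _)
    rw [h0, add_zero, h1, h2, ENNReal.ofReal_le_ofReal_iff (by positivity)] at h3
    have h4 : ((1 / 2 : ℝ)) ^ (d + 1) < 1 := pow_lt_one₀ (by norm_num) (by norm_num) (by simp)
    have h5 : ((1 / 2 : ℝ)) ^ (d + 1) / (d + 1) < 1 / (d + 1) := by gcongr
    linarith
  · have hsub : radii ⊆ (Iio ⟨1, mem_Ioi.2 one_pos⟩ : Set (Ioi (0 : ℝ))) := fun r hr => hr.2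
    refine ne_top_of_le_ne_top ?_ (measure_mono hsub)
    rw [h1]
    exact ENNReal.ofReal_ne_top

/-- The total mass of the radial density. -/
noncomputable def radialMass (n : ℕ) (κ : ℝ) : ℝ≥0∞ :=
  ∫⁻ r in radii, ENNReal.ofReal (((r : ℝ) ^ (2 * n)) ^ κ)
    ∂Measure.volumeIoiPow (Module.finrank ℝ (EuclideanSpace ℝ (Fin n)) - 1)

/-- The radii avoid `0`, so the weight lies between positive constants whatever the sign of the
exponent; `ε` may be negative. -/
theorem radialMass_ne (n : ℕ) (κ : ℝ) : radialMass n κ ≠ 0 ∧ radialMass n κ ≠ ∞ := by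
  have hr0 : ∀ r ∈ Icc (1 / 2 : ℝ) 1, 0 < r := fun r hr => lt_of_lt_of_le (by norm_num) hr.1
  have hc : ContinuousOn (fun r : ℝ => (r ^ (2 * n)) ^ κ) (Icc (1 / 2) 1) :=
    ContinuousOn.rpow_const (by fun_prop) fun r hr => Or.inl (pow_pos (hr0 r hr) _).ne'
  obtain ⟨m, hm0, hm⟩ := isCompact_Icc.exists_forall_le' hc fun r hr =>
    Real.rpow_pos_of_pos (pow_pos (hr0 r hr) _) _
  obtain ⟨M, hM⟩ := isCompact_Icc.exists_bound_of_continuousOn hc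
  obtain ⟨h1, h2⟩ := volumeIoiPow_radii (Module.finrank ℝ (EuclideanSpace ℝ (Fin n)) - 1)
  constructor
  · refine ne_of_gt (lt_of_lt_of_le (ENNReal.mul_pos (ENNReal.ofReal_pos.2 hm0).ne' h1) ?_)
    rw [← setLIntegral_const]
    exact setLIntegral_mono' measurableSet_radii fun r hr =>
      ENNReal.ofReal_le_ofReal (hm r ⟨hr.1, hr.2.le⟩)
  · refine ne_top_of_le_ne_top (ENNReal.mul_ne_top ENNReal.ofReal_ne_top h2)
      (b := ENNReal.ofReal M * _) ?_
    rw [← setLIntegral_const]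
    exact setLIntegral_mono' measurableSet_radii fun r hr =>
      ENNReal.ofReal_le_ofReal ((le_abs_self _).trans (hM r ⟨hr.1, hr.2.le⟩))

theorem gram_det_smul (I : SO n →ₗ[ℝ] SO n) (r : ℝ) (x : Fin n → ℝ) :
    (gram I (r • x)).det = r ^ (2 * n) * (gram I x).det := by
  rw [gram_smul, Matrix.det_smul, Fintype.card_fin, ← pow_mul]

theorem volume_momentum_preimage (hI : IsInertia I) (γ : Sph n) (S : Set (SO n)) :
    (volume : Measure (Upper n → ℝ)) {q | momentum I γ (coordEquiv n q) ∈ S} =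
      ENNReal.ofReal (LinearMap.det (restrictV I γ))⁻¹ *
        (volume : Measure (Upper n → ℝ)) {q | coordEquiv n q ∈ S} := by
  let f : (Upper n → ℝ) →ₗ[ℝ] (Upper n → ℝ) :=
    (coordEquiv n).symm.toLinearMap ∘ₗ momentumMap I γ ∘ₗ (coordEquiv n).symm.symm.toLinearMap
  have hdet : LinearMap.det f = LinearMap.det (restrictV I γ) := by
    rw [← det_momentumMap]
    exact LinearMap.det_conj _ _
  have hpos := det_restrictV_pos hI γ
  have h := Measure.addHaar_preimage_linearMap (volume : Measure (Upper n → ℝ))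
    (f := f) (hdet ▸ hpos.ne') {q | coordEquiv n q ∈ S}
  rw [hdet, abs_of_pos (inv_pos.2 hpos)] at h
  rw [← h]
  congr 1
  ext q
  change _ ↔ coordEquiv n ((coordEquiv n).symm (momentum I γ (coordEquiv n q))) ∈ S
  rw [LinearEquiv.apply_symm_apply]
  rfl

/-- The fibre integral of the phase measure. -/
noncomputable def fibreMass (I : SO n →ₗ[ℝ] SO n) (ε : ℝ) (B : Set (Phase n)) (γ : Sph n) : ℝ≥0∞ :=
  ENNReal.ofReal (density I ε γ) *
    (volume : Measure (Upper n → ℝ)) {q | (coordEquiv n q, γ) ∈ B}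

theorem measurable_fibreMass (I : SO n →ₗ[ℝ] SO n) (ε : ℝ) {B : Set (Phase n)}
    (hB : MeasurableSet B) : Measurable (fibreMass I ε B) := by
  refine (measurable_density I ε).ennreal_ofReal.mul ?_
  have h : Measurable fun p : (Upper n → ℝ) × Sph n => ((coordEquiv n p.1, p.2) : Phase n) :=
    (continuous_coordEquiv.measurable.comp measurable_fst).prodMk measurable_snd
  exact measurable_measure_prodMk_right (h hB)

theorem phaseMeasure_apply (I : SO n →ₗ[ℝ] SO n) (ε : ℝ) {B : Set (Phase n)}
    (hB : MeasurableSet B) : phaseMeasure I ε B = ∫⁻ γ, fibreMass I ε B γ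
      ∂(volume : Measure (EuclideanSpace ℝ (Fin n))).toSphere := by
  have hd : Measurable fun p : Phase n => ENNReal.ofReal (density I ε p.2) :=
    ((measurable_density I ε).comp measurable_snd).ennreal_ofReal
  rw [phaseMeasure, withDensity_apply _ hB, ← lintegral_indicator hB,
    lintegral_prod_symm _ (hd.indicator hB).aemeasurable]
  refine lintegral_congr fun γ => ?_
  have hs : MeasurableSet {m : SO n | (m, γ) ∈ B} := (measurable_id.prodMk measurable_const) hB
  have h1 : (fun m : SO n => B.indicator (fun p => ENNReal.ofReal (density I ε p.2)) (m, γ)) =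
      {m : SO n | (m, γ) ∈ B}.indicator fun _ => ENNReal.ofReal (density I ε γ) := by
    funext m
    by_cases h : (m, γ) ∈ B <;> simp [indicator, h]
  rw [h1, lintegral_indicator_const hs, volSO, fibreMass,
    Measure.map_apply (show Measurable (ofCoords n) from continuous_coordEquiv.measurable) hs]
  rfl

/-- On a slice of fixed `x = r γ` the density is the constant `(r^(2n))^κ (det I|_𝔳)^κ`, and passing
from `ω` to `𝐦` divides by `det I|_𝔳`. This is where the exponent `1/(2ε)` turns into `1/(2ε) - 1`.
-/
theorem lintegral_cone_slice (hI : IsInertia I) (ε : ℝ) (γ₀ : Sph n) {B : Set (Phase n)}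
    (hB : MeasurableSet B) (γ : Sph n) (r : Ioi (0 : ℝ)) :
    ∫⁻ q, (cone I γ₀ B).indicator (fun p => ENNReal.ofReal (ambientDensity I ε p))
        (q, (r : ℝ) • (γ : EuclideanSpace ℝ (Fin n))) =
      fibreMass I ε B γ *
        radii.indicator (fun r => ENNReal.ofReal (((r : ℝ) ^ (2 * n)) ^ (1 / (2 * ε)))) r := by
  set κ := 1 / (2 * ε) with hκ
  set δ := LinearMap.det (restrictV I γ) with hδ
  have hδ0 : 0 < δ := det_restrictV_pos hI γ
  have hr : (0 : ℝ) < r := r.2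
  have hγ : ‖(γ : EuclideanSpace ℝ (Fin n))‖ = 1 := mem_sphere_zero_iff_norm.1 γ.2
  have hmem : ∀ q : Upper n → ℝ, (q, (r : ℝ) • (γ : EuclideanSpace ℝ (Fin n))) ∈ cone I γ₀ B ↔
      r ∈ radii ∧ (momentum I γ (coordEquiv n q), γ) ∈ B := by
    intro q
    rw [cone, mem_ofPred_eq, dir_smul γ₀ γ hr, norm_smul, hγ, mul_one, Real.norm_of_nonneg hr.le]
    rfl
  by_cases hrr : r ∈ radii
  · have hs : MeasurableSet {q : Upper n → ℝ | (momentum I γ (coordEquiv n q), γ) ∈ B} := by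
      have h := (measurableSet_cone I γ₀ hB).preimage
        (measurable_prodMk_right (y := (r : ℝ) • (γ : EuclideanSpace ℝ (Fin n))))
      convert h using 1
      ext q
      exact ((hmem q).trans (and_iff_right hrr)).symm
    have h1 : (fun q : Upper n → ℝ => (cone I γ₀ B).indicator
        (fun p => ENNReal.ofReal (ambientDensity I ε p))
        (q, (r : ℝ) • (γ : EuclideanSpace ℝ (Fin n)))) =
        {q : Upper n → ℝ | (momentum I γ (coordEquiv n q), γ) ∈ B}.indicator
          fun _ => ENNReal.ofReal (((r : ℝ) ^ (2 * n)) ^ κ * δ ^ κ) := by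
      funext q
      have h2 : ambientDensity I ε (q, (r : ℝ) • (γ : EuclideanSpace ℝ (Fin n))) =
          ((r : ℝ) ^ (2 * n)) ^ κ * δ ^ κ := by
        rw [ambientDensity, ← Real.mul_rpow (by positivity) hδ0.le, hδ, ← det_gram_vec,
          ← gram_det_smul]
        rfl
      by_cases h : (momentum I γ (coordEquiv n q), γ) ∈ B
      · rw [indicator_of_mem ((hmem q).2 ⟨hrr, h⟩), indicator_of_mem (by exact h), h2]
      · rw [indicator_of_notMem fun h' => h ((hmem q).1 h').2, indicator_of_notMem (by exact h)]
    have h3 := volume_momentum_preimage hI γ {m | (m, γ) ∈ B}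
    simp only [mem_ofPred_eq] at h3
    rw [h1, lintegral_indicator_const hs, indicator_of_mem hrr, h3, fibreMass, density, ← hκ, ← hδ,
      ENNReal.ofReal_mul (by positivity), Real.rpow_sub_one hδ0.ne', div_eq_mul_inv,
      ENNReal.ofReal_mul (by positivity)]
    ring
  · have h1 : (fun q : Upper n → ℝ => (cone I γ₀ B).indicator
        (fun p => ENNReal.ofReal (ambientDensity I ε p))
        (q, (r : ℝ) • (γ : EuclideanSpace ℝ (Fin n)))) = fun _ => 0 := by
      funext q
      exact indicator_of_notMem (fun h => hrr ((hmem q).1 h).1) _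
    rw [h1, lintegral_zero, indicator_of_notMem hrr, mul_zero]

theorem lintegral_cone (hI : IsInertia I) (ε : ℝ) (γ₀ : Sph n) {B : Set (Phase n)}
    (hB : MeasurableSet B) :
    ∫⁻ p in cone I γ₀ B, ENNReal.ofReal (ambientDensity I ε p)
      ∂((volume : Measure (Upper n → ℝ)).prod (volume : Measure (EuclideanSpace ℝ (Fin n)))) =
      phaseMeasure I ε B * radialMass n (1 / (2 * ε)) := by
  have hcone := measurableSet_cone I γ₀ hB
  set g : (Upper n → ℝ) × EuclideanSpace ℝ (Fin n) → ℝ≥0∞ :=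
    (cone I γ₀ B).indicator fun p => ENNReal.ofReal (ambientDensity I ε p) with hg
  have hgm : Measurable g := (measurable_ambientDensity I ε).ennreal_ofReal.indicator hcone
  set F : EuclideanSpace ℝ (Fin n) → ℝ≥0∞ := fun x => ∫⁻ q, g (q, x) with hF
  have hFm : Measurable F := hgm.lintegral_prod_left'
  have hF0 : F 0 = 0 := by
    have : (fun q : Upper n → ℝ => g (q, 0)) = fun _ => 0 := by
      funext q
      exact indicator_of_notMem (fun h => snd_ne_zero_of_mem_cone h rfl) _
    simp only [hF, this, lintegral_zero]
  rw [← lintegral_indicator hcone, lintegral_prod_symm _ hgm.aemeasurable]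
  -- Polar coordinates exist off the origin only; `F` vanishes at `0`, so no appeal to null points
  -- is needed.
  have h1 : ∫⁻ x, F x = ∫⁻ x in {0}ᶜ, F x := by
    rw [← lintegral_add_compl F (measurableSet_singleton 0),
      setLIntegral_congr_fun (g := fun _ => 0) (measurableSet_singleton 0)
        (fun x hx => by rw [mem_singleton_iff.1 hx, hF0]), lintegral_zero, zero_add]
  have h2 := Measure.measurePreserving_homeomorphUnitSphereProd
    (volume : Measure (EuclideanSpace ℝ (Fin n)))
  have hsm : Measurable fun p : Sph n × Ioi (0 : ℝ) =>
      F ((p.2 : ℝ) • (p.1 : EuclideanSpace ℝ (Fin n))) :=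
    hFm.comp ((measurable_subtype_coe.comp measurable_snd).smul
      (measurable_subtype_coe.comp measurable_fst))
  have h3 := h2.lintegral_comp hsm
  have h4 : ∀ x : ({0}ᶜ : Set (EuclideanSpace ℝ (Fin n))),
      ((homeomorphUnitSphereProd _ x).2 : ℝ) •
        ((homeomorphUnitSphereProd _ x).1 : EuclideanSpace ℝ (Fin n)) = x := by
    intro x
    rw [homeomorphUnitSphereProd_apply_fst_coe, homeomorphUnitSphereProd_apply_snd_coe,
      smul_inv_smul₀ (norm_ne_zero_iff.2 x.2)]
  simp only [h4] at h3
  rw [lintegral_subtype_comap (measurableSet_singleton 0).compl F] at h3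
  change ∫⁻ x, F x = _
  rw [h1, h3]
  have h5 : ∀ p : Sph n × Ioi (0 : ℝ), F ((p.2 : ℝ) • (p.1 : EuclideanSpace ℝ (Fin n))) =
      fibreMass I ε B p.1 * radii.indicator
        (fun r => ENNReal.ofReal (((r : ℝ) ^ (2 * n)) ^ (1 / (2 * ε)))) p.2 :=
    fun p => lintegral_cone_slice hI ε γ₀ hB p.1 p.2
  simp only [h5]
  have hw : Measurable fun r : Ioi (0 : ℝ) =>
      ENNReal.ofReal (((r : ℝ) ^ (2 * n)) ^ (1 / (2 * ε))) :=
    ((measurable_subtype_coe.pow_const _).pow_const _).ennreal_ofReal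
  rw [lintegral_prod_mul (measurable_fibreMass I ε hB).aemeasurable
    (hw.indicator measurableSet_radii).aemeasurable, ← phaseMeasure_apply I ε hB,
    lintegral_indicator measurableSet_radii]
  rfl

end Integral

theorem isInvariantMeasure_phaseMeasure (hI : IsInertia I) {ε : ℝ} (hε : ε ≠ 0) :
    IsInvariantMeasure I ε (phaseMeasure I ε) := by
  intro t Φ B hB hΦ
  -- A point of `B` provides the default direction `γ₀`; the sphere may be empty.
  rcases B.eq_empty_or_nonempty with rfl | ⟨y₀, -⟩
  · rw [image_empty]
  set γ₀ := y₀.2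
  have : (Measure.prod (volume : Measure (Upper n → ℝ))
      (volume : Measure (EuclideanSpace ℝ (Fin n)))).IsAddHaarMeasure :=
    Measure.prod.instIsAddHaarMeasure _ _
  have hcone := measurableSet_cone I γ₀ hB
  have hlift : ∀ p ∈ cone I γ₀ B, ∃ c : ℝ → Phase n, IsSolution I ε (uIcc 0 t) c ∧
      lift I ‖p.2‖ (c 0) = p ∧ lift I ‖p.2‖ (c t) = ambientMap I γ₀ Φ p := by
    intro p hp
    obtain ⟨c, hc, h0, h1⟩ := hΦ _ hp.2
    refine ⟨c, hc, ?_, ?_⟩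
    · rw [h0, lift_momentum hI γ₀ (snd_ne_zero_of_mem_cone hp)]
    · rw [h1, ambientMap]
  have key : MeasurableSet (ambientMap I γ₀ Φ '' cone I γ₀ B) ∧
      ∫⁻ p in ambientMap I γ₀ Φ '' cone I γ₀ B, ENNReal.ofReal (ambientDensity I ε p)
        ∂((volume : Measure (Upper n → ℝ)).prod (volume : Measure (EuclideanSpace ℝ (Fin n)))) =
      ∫⁻ p in cone I γ₀ B, ENNReal.ofReal (ambientDensity I ε p)
        ∂((volume : Measure (Upper n → ℝ)).prod (volume : Measure (EuclideanSpace ℝ (Fin n)))) := by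
    have H := isInvariantDensity_ambient hI hε
    rcases le_or_gt 0 t with ht | ht
    · refine Liouville.lintegral_image_eq_of_isInvariantDensity _ H ht hcone fun p hp => ?_
      obtain ⟨c, hc, h0, h1⟩ := hlift p hp
      have := hc.flowsIn hI ht (norm_pos_iff.2 (snd_ne_zero_of_mem_cone hp))
      rwa [h0, h1] at this
    · refine Liouville.lintegral_image_eq_of_isInvariantDensity _ H.neg (neg_pos.2 ht).le hcone
        fun p hp => ?_
      obtain ⟨c, hc, h0, h1⟩ := hlift p hp
      have := hc.flowsIn_neg hI ht (norm_pos_iff.2 (snd_ne_zero_of_mem_cone hp))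
      rwa [h0, h1] at this
  rw [image_cone hI] at key
  have hΦB := measurableSet_of_measurableSet_cone hI γ₀ key.1
  have h := key.2
  rw [lintegral_cone hI ε γ₀ hΦB, lintegral_cone hI ε γ₀ hB] at h
  obtain ⟨hm0, hm⟩ := radialMass_ne n (1 / (2 * ε))
  exact (ENNReal.mul_left_inj hm0 hm).1 h

end RubberRolling

/-- The determinant of a rank two perturbation of the identity. -/
theorem Matrix.det_one_add_vecMulVec_add_vecMulVec {ι R : Type*} [Fintype ι] [DecidableEq ι]
    [CommRing R] (u v w z : ι → R) :
    (1 + (Matrix.vecMulVec u v + Matrix.vecMulVec w z)).det =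
      (1 + v ⬝ᵥ u) * (1 + z ⬝ᵥ w) - (v ⬝ᵥ w) * (z ⬝ᵥ u) := by
  have h : Matrix.vecMulVec u v + Matrix.vecMulVec w z =
      (Matrix.of ![u, w])ᵀ * Matrix.of ![v, z] := by
    ext i j
    simp [Matrix.mul_apply, Fin.sum_univ_two, Matrix.vecMulVec_apply]
  rw [h, Matrix.det_one_add_mul_comm, Matrix.det_fin_two]
  simp only [Matrix.add_apply, Matrix.mul_apply, Matrix.transpose_apply, Matrix.of_apply,
    Matrix.cons_val_zero, Matrix.cons_val_one, Matrix.one_apply_eq, Matrix.one_apply_ne zero_ne_one,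
    Matrix.one_apply_ne one_ne_zero, zero_add, dotProduct]

namespace RubberRolling

variable {n : ℕ} {I : SO n →ₗ[ℝ] SO n}

/-! ### The diagonal inertia operator -/

section Diagonal

variable {a : Fin n → ℝ}

theorem coe_eq_diagonal_mul_mul (hI : ∀ i j, I (wedge (E i) (E j)) =
    (a i * a j) • wedge (E i) (E j)) (X : SO n) :
    (I X : Matrix (Fin n) (Fin n) ℝ) =
      Matrix.diagonal a * (X : Matrix (Fin n) (Fin n) ℝ) * Matrix.diagonal a := by
  let ι : SO n →ₗ[ℝ] Matrix (Fin n) (Fin n) ℝ :=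
    { toFun := fun X => X, map_add' := fun _ _ => rfl, map_smul' := fun _ _ => rfl }
  have h : ι ∘ₗ I =
      (LinearMap.mulRight ℝ (Matrix.diagonal a) ∘ₗ LinearMap.mulLeft ℝ (Matrix.diagonal a)) ∘ₗ
        ι := by
    refine linearMap_ext_wedge fun i j => ?_
    change ((I (wedge (E i) (E j)) : SO n) : Matrix (Fin n) (Fin n) ℝ) =
      Matrix.diagonal a * (wedge (E i) (E j) : Matrix (Fin n) (Fin n) ℝ) * Matrix.diagonal a
    rw [hI]
    ext k l
    rw [Matrix.mul_diagonal, Matrix.diagonal_mul]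
    change a i * a j * (E i k * E j l - E j k * E i l) =
      a k * (E i k * E j l - E j k * E i l) * a l
    simp only [E, Pi.single_apply]
    split_ifs <;> simp_all
    all_goals ring
  exact LinearMap.congr_fun h X

theorem map_wedge_of_diagonal (hI : ∀ i j, I (wedge (E i) (E j)) =
    (a i * a j) • wedge (E i) (E j)) (x y : Fin n → ℝ) :
    I (wedge x y) = wedge (Matrix.diagonal a *ᵥ x) (Matrix.diagonal a *ᵥ y) := by
  apply Subtype.ext
  rw [coe_eq_diagonal_mul_mul hI]
  ext k l
  rw [Matrix.mul_diagonal, Matrix.diagonal_mul, wedge_apply, wedge_apply]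
  simp only [Matrix.mulVec_diagonal]
  ring

theorem dotProduct_diagonal_mulVec_pos (ha : ∀ i, 0 < a i) {x : Fin n → ℝ} (hx : x ⬝ᵥ x = 1) :
    0 < x ⬝ᵥ (Matrix.diagonal a *ᵥ x) := by
  have hx0 : x ≠ 0 := by
    rintro rfl
    simp at hx
  have h := (Matrix.PosDef.diagonal (n := Fin n) (d := a) ha).dotProduct_mulVec_pos hx0
  rwa [star_trivial] at h

/-- Since `I (y ∧ x) = A y ∧ A x`, the Gram matrix is `q A - (A x)(A x)ᵀ + x xᵀ` with `q = (x, A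
x)`. After factoring out `q A`, the rank-two determinant has first product zero and equals `q⁻²`.
The form `q ^ n * q⁻¹ ^ 2` avoids the truncated subtraction `n - 2`. -/
theorem gram_det_of_diagonal (ha : ∀ i, 0 < a i) (hI : ∀ i j, I (wedge (E i) (E j)) =
    (a i * a j) • wedge (E i) (E j)) {x : Fin n → ℝ} (hx : x ⬝ᵥ x = 1) :
    (gram I x).det =
      (∏ i, a i) * ((x ⬝ᵥ (Matrix.diagonal a *ᵥ x)) ^ n * (x ⬝ᵥ (Matrix.diagonal a *ᵥ x))⁻¹ ^ 2) := by
  set q := x ⬝ᵥ (Matrix.diagonal a *ᵥ x) with hq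
  have hq0 : q ≠ 0 := (dotProduct_diagonal_mulVec_pos ha hx).ne'
  have hgram : gram I x = Matrix.diagonal a * (q • (1 +
      (Matrix.vecMulVec (-q⁻¹ • x) (Matrix.diagonal a *ᵥ x) +
        Matrix.vecMulVec (q⁻¹ • fun i => (a i)⁻¹ * x i) x))) := by
    refine Matrix.ext_of_mulVec_single fun j => ?_
    generalize (Pi.single j 1 : Fin n → ℝ) = y
    have hsymm : (Matrix.diagonal a *ᵥ y) ⬝ᵥ x = (Matrix.diagonal a *ᵥ x) ⬝ᵥ y := by
      refine Finset.sum_congr rfl fun i _ => ?_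
      rw [Matrix.mulVec_diagonal, Matrix.mulVec_diagonal]
      ring
    rw [gram_mulVec, map_wedge_of_diagonal hI, wedge_mulVec, dotProduct_comm _ x, ← hq, hsymm,
      ← Matrix.mulVec_mulVec, Matrix.smul_mulVec, Matrix.add_mulVec, Matrix.add_mulVec,
      Matrix.one_mulVec, Matrix.vecMulVec_mulVec, Matrix.vecMulVec_mulVec]
    funext k
    have hk := (ha k).ne'
    simp only [Pi.add_apply, Pi.sub_apply, Pi.smul_apply, smul_eq_mul, Matrix.mulVec_diagonal,
      op_smul_eq_smul]
    field_simp
    ring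
  have h1 : (Matrix.diagonal a *ᵥ x) ⬝ᵥ (q⁻¹ • fun i => (a i)⁻¹ * x i) = q⁻¹ := by
    have h : (Matrix.diagonal a *ᵥ x) ⬝ᵥ (fun i => (a i)⁻¹ * x i) = x ⬝ᵥ x := by
      refine Finset.sum_congr rfl fun i _ => ?_
      have hi := (ha i).ne'
      rw [Matrix.mulVec_diagonal]
      field_simp
    rw [dotProduct_smul, h, hx, smul_eq_mul, mul_one]
  rw [hgram, Matrix.det_mul, Matrix.det_diagonal, Matrix.det_smul, Fintype.card_fin,
    Matrix.det_one_add_vecMulVec_add_vecMulVec, h1, dotProduct_smul,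
    dotProduct_smul (-q⁻¹) x x, hx, dotProduct_comm (Matrix.diagonal a *ᵥ x) x, ← hq]
  congr 2
  simp only [smul_eq_mul]
  field_simp
  ring

theorem density_of_diagonal (ha : ∀ i, 0 < a i) (hI : ∀ i j, I (wedge (E i) (E j)) =
    (a i * a j) • wedge (E i) (E j)) (ε : ℝ) (γ : Sph n) :
    density I ε γ = (∏ i, a i) ^ (1 / (2 * ε) - 1) *
      (vec γ ⬝ᵥ (Matrix.diagonal a *ᵥ vec γ)) ^ ((1 / (2 * ε) - 1) * ((n : ℝ) - 2)) := by
  have hq := dotProduct_diagonal_mulVec_pos ha (vec_dotProduct_vec γ)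
  rw [density, ← det_gram_vec, gram_det_of_diagonal ha hI (vec_dotProduct_vec γ),
    Real.mul_rpow (Finset.prod_nonneg fun i _ => (ha i).le) (by positivity),
    mul_comm _ ((n : ℝ) - 2), Real.rpow_mul hq.le, Real.rpow_sub hq, Real.rpow_natCast,
    Real.rpow_two, div_eq_mul_inv (_ ^ n), inv_pow]

end Diagonal

theorem modInertia_wedge {J : SO n →ₗ[ℝ] SO n} {D : ℝ} {a : Fin n → ℝ} (hJ : ∀ i j,
    J (wedge (E i) (E j)) = (a i * a j - D) • wedge (E i) (E j)) (i j : Fin n) :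
    modInertia J D (wedge (E i) (E j)) = (a i * a j) • wedge (E i) (E j) := by
  rw [modInertia, LinearMap.add_apply, LinearMap.smul_apply, LinearMap.id_apply, hJ, ← add_smul,
    sub_add_cancel]

end RubberRolling

theorem theorem3p2 (n : ℕ) (mass ρ σ s : ℝ) (hmass : 0 < mass) (hρ : 0 < ρ) (hσ : 0 < σ)
    (hs : s = 1 ∨ s = -1) (hne : σ + s * ρ ≠ 0)
    (J : SO n →ₗ[ℝ] SO n) (hJ : IsInertia J) :
    ((∀ γ : Sph n, 0 < LinearMap.det (restrictV (modInertia J (coefD mass ρ)) γ)) ∧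
      IsInvariantMeasure (modInertia J (coefD mass ρ)) (eps σ ρ s)
        (phaseMeasure (modInertia J (coefD mass ρ)) (eps σ ρ s))) ∧
    ∀ a : Fin n → ℝ, (∀ i, 0 < a i) →
      (∀ i j, J (wedge (E i) (E j)) = (a i * a j - coefD mass ρ) • wedge (E i) (E j)) →
      (∀ i j, modInertia J (coefD mass ρ) (wedge (E i) (E j)) =
        (a i * a j) • wedge (E i) (E j)) ∧
      ∃ C : ℝ, 0 < C ∧ ∀ γ : Sph n,
        density (modInertia J (coefD mass ρ)) (eps σ ρ s) γ =
          C * (vec γ ⬝ᵥ (Matrix.diagonal a *ᵥ vec γ)) ^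
            ((1 / (2 * eps σ ρ s) - 1) * ((n : ℝ) - 2)) := by
  have hI := isInertia_modInertia hJ (D := coefD mass ρ) (mul_pos hmass (pow_pos hρ 2))
  refine ⟨⟨det_restrictV_pos hI, isInvariantMeasure_phaseMeasure hI (div_ne_zero hσ.ne' hne)⟩,
    fun a ha hJa => ⟨modInertia_wedge hJa, _,
      Real.rpow_pos_of_pos (Finset.prod_pos fun i _ => ha i) _,
      density_of_diagonal ha (modInertia_wedge hJa) _⟩⟩
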